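/- **Model.** The machine is a unit-cost word RAM with $w$-bit words, $w=\Theta(\log n)$: $w\ge\lfloor\log_2 n\rfloor+1+c_0$ for a suitable absolute constant $c_0$, and $w\le C(\lfloor\log_2 n\rfloor+1)$ for an arbitrary constant $C$. Output goes to a write-only stream. **Text.** Let $T[1..n-1]$ be a string over the alphabet $[1..\sigma]$ with $\sigma\le n^{1/3}$, and let $\$$ (written as $0$) be an end marker smaller than all characters of $T$. The suffix array $A[1..n]$ lists the starting positions of the suffixes of $T\$$ in lexicographic order. The Burrows–Wheeler transform is given by $\mathrm{bwt}[i]=T[A[i]-1]$ if $A[i]>1$ and $\mathrm{bwt}[i]=\$$ otherwise. The interval of a string $p$ that occurs in $T\$$ is the set $[i..j]$ of ranks of the suffixes that start with $p$. **Suffix tree.** The suffix tree of $T$ is the compacted trie of the suffixes of $T\$$. Its internal nodes are the right-maximal strings $p$, i.e. those for which $pa$ and $pb$ occur in $T\$$ for two distinct characters $a,b$. Its leaves are the nonempty suffixes of $T\$$. The edge from a node $p$ to a child $pcq$ ($c$ a character) has label $c$. **Lemma.** Suppose that the text is accessible through a data structure built on $\mathrm{bwt}$ that, given any interval $[i..j]\subseteq[1..n]$,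 $i\le j$, reports in arbitrary order each distinct character $c$ occurring in $\mathrm{bwt}[i..j]$ exactly once, together with $\mathrm{rank}_c(\ell)$ and $\mathrm{rank}_c(r)$, where $\ell$ and $r$ are the positions of the leftmost and the rightmost occurrence of $c$ in $\mathrm{bwt}[i..j]$ and $\mathrm{rank}_c(k)$ is the number of occurrences of $c$ in $\mathrm{bwt}[1..k]$; suppose that a query takes $t_e\ge 1$ time per reported character. Then there is a single program, not depending on $n,\sigma,T,t_e,w$ or the data structure, that receives $n$ and $\sigma$ and, in time $O(n\cdot t_e)$ with an absolute implied constant and with $o(n)$ bits of working space (the bound depending only on $n$ and $C$), outputs every internal node of the suffix tree of $T$ exactly once, in some order. For each internal node it outputs the node's suffix array interval, the number of its children, and the list of all its children in increasing order of their labels, each child given by its label and its suffix array interval. -/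

import Mathlib

namespace BWTEnum

/-! ### Texts, suffix arrays, Burrows-Wheeler transform

A text is a list `T` of characters from `[1..σ]`.  The end marker `$` is the number `0`, so it is
smaller than every character of `T`.  The length of `T$` is called `n`.  Positions in strings, ranks
in the suffix array and positions in the transform all start from `1`. -/

/-- The string `T$`. -/
def withEnd (T : List ℕ) : List ℕ := T ++ [0]

/-- The length `n` of `T$`. -/
def size (T : List ℕ) : ℕ := T.length + 1

/-- The entry `L[i]`, with positions starting from `1`. -/
def entry (L : List ℕ) (i : ℕ) : ℕ := L.getD (i - 1) 0

/-- The suffix of `T$` that starts at position `k`, for `1 ≤ k ≤ n`. -/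
def suffixFrom (T : List ℕ) (k : ℕ) : List ℕ := (withEnd T).drop (k - 1)

/-- The suffix array: the positions `1, …, n`, sorted by the lexicographic order of the suffixes of
`T$` that start there. -/
def suffixArray (T : List ℕ) : List ℕ :=
  (List.range' 1 (size T)).mergeSort (fun a b => decide (suffixFrom T a ≤ suffixFrom T b))

/-- The Burrows-Wheeler transform: `bwt[i] = T[A[i] - 1]` if `A[i] > 1`, and `$` otherwise, where
`A` is the suffix array. -/
def bwt (T : List ℕ) : List ℕ :=
  (suffixArray T).map (fun k => if 1 < k then entry (withEnd T) (k - 1) else 0)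

/-- `[i..j]` is the (nonempty) suffix array interval of the string `p`: its ranks are exactly those
of the suffixes of `T$` that are prefixed by `p`. -/
def IsInterval (T p : List ℕ) (i j : ℕ) : Prop :=
  1 ≤ i ∧ i ≤ j ∧ j ≤ size T ∧
    ∀ r, 1 ≤ r → r ≤ size T → ((i ≤ r ∧ r ≤ j) ↔ p <+: suffixFrom T (entry (suffixArray T) r))

/-! ### The suffix tree

The nodes of the compacted trie of the suffixes of `T$` are identified with the strings on the paths
from the root. -/

/-- Internal nodes: the right-maximal factors, that is the strings `p` such that `pa` and `pb` occur
in `T$` for two distinct characters `a`, `b`. -/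
def IsInternal (T p : List ℕ) : Prop :=
  ∃ a b : ℕ, a ≠ b ∧ (p ++ [a]) <:+: withEnd T ∧ (p ++ [b]) <:+: withEnd T

/-- Leaves: the nonempty suffixes of `T$`. -/
def IsLeaf (T p : List ℕ) : Prop := p ≠ [] ∧ p <:+ withEnd T

def IsNode (T p : List ℕ) : Prop := IsInternal T p ∨ IsLeaf T p

/-- `y` is a child of `p`: a node below `p`, with no other node between them. -/
def IsChild (T p y : List ℕ) : Prop :=
  IsNode T y ∧ p <+: y ∧ y ≠ p ∧
    ∀ z, IsNode T z → p <+: z → z ≠ p → z <+: y → z = y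

/-- `[i..j]` is the suffix array interval of a child of `p` that is joined to `p` by an edge with
label (first character) `c`. -/
def IsChildEntry (T p : List ℕ) (c i j : ℕ) : Prop :=
  ∃ q, IsChild T p (p ++ c :: q) ∧ IsInterval T (p ++ c :: q) i j

/-! ### What is to be output -/

/-- A list of triples, written as a sequence of words. -/
def flattenTriples (L : List (ℕ × ℕ × ℕ)) : List ℕ :=
  L.flatMap (fun t => [t.1, t.2.1, t.2.2])

/-- What is reported for one node: the bounds `lo`, `hi` of an interval, and for every child the
triple formed by its label and the bounds of its interval. -/
structure NodeRecord where
  lo : ℕ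
  hi : ℕ
  children : List (ℕ × ℕ × ℕ)

/-- A record as a sequence of words: the bounds, the number of children, the triples. -/
def NodeRecord.encode (R : NodeRecord) : List ℕ :=
  R.lo :: R.hi :: R.children.length :: flattenTriples R.children

/-- `R` is the right record for the node `p`: it has the interval of `p`, and it lists exactly the
children of `p`, in increasing order of their labels, with their labels and intervals. -/
def IsRecordOf (T p : List ℕ) (R : NodeRecord) : Prop :=
  IsInterval T p R.lo R.hi ∧
    (R.children.map Prod.fst).Pairwise (· < ·) ∧
    ∀ c i j, (c, i, j) ∈ R.children ↔ IsChildEntry T p c i j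

/-- The sequence of words `out` is an enumeration of all the internal nodes of the suffix tree, each
one once, in some order, with the right record for each. -/
def IsEnumeration (T out : List ℕ) : Prop :=
  ∃ L : List (List ℕ × NodeRecord),
    (L.map Prod.fst).Nodup ∧
    (∀ p, p ∈ L.map Prod.fst ↔ IsInternal T p) ∧
    (∀ x ∈ L, IsRecordOf T x.1 x.2) ∧
    out = L.flatMap (fun x => x.2.encode)

/-! ### Range reporting -/

/-- The number of occurrences of `c` in `B[1..i]`. -/
def rank (B : List ℕ) (c i : ℕ) : ℕ := (B.take i).count c

/-- `l` is the position of the leftmost occurrence of `c` in `B[i..j]`. -/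
def IsLeftmost (B : List ℕ) (c i j l : ℕ) : Prop :=
  i ≤ l ∧ l ≤ j ∧ entry B l = c ∧ ∀ m, i ≤ m → m ≤ j → entry B m = c → l ≤ m

/-- `r` is the position of the rightmost occurrence of `c` in `B[i..j]`. -/
def IsRightmost (B : List ℕ) (c i j r : ℕ) : Prop :=
  i ≤ r ∧ r ≤ j ∧ entry B r = c ∧ ∀ m, i ≤ m → m ≤ j → entry B m = c → m ≤ r

/-- For every interval `[i..j]` within `B`, `report i j` lists every distinct character `c` of
`B[i..j]` once, in an arbitrary order, with the ranks of its leftmost and of its rightmost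
occurrence in `B[i..j]`. -/
def IsRangeReporter (B : List ℕ) (report : ℕ → ℕ → List (ℕ × ℕ × ℕ)) : Prop :=
  ∀ i j, 1 ≤ i → i ≤ j → j ≤ B.length →
    ((report i j).map Prod.fst).Nodup ∧
    ∀ c a b, (c, a, b) ∈ report i j ↔
      ∃ l r, IsLeftmost B c i j l ∧ IsRightmost B c i j r ∧ a = rank B c l ∧ b = rank B c r

/-! ### The unit-cost word RAM

Registers and memory cells hold `w`-bit words.  Programs are structured (sequence, conditional,
loop); every elementary instruction and every test of a condition costs one unit of time.  The text
is accessible through range reporting queries only (the character `bwt[i]` is what the query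
`[i..i]` reports).  The output goes to a write-only stream. -/

inductive BinOp
  | add | sub | mul | div | mod | and | or | xor | shl | shr | lt | eq

/-- Word operations.  Results are reduced modulo `2 ^ w`; subtraction stops at `0`; comparisons give
`0` or `1`. -/
def BinOp.eval (w : ℕ) (o : BinOp) (x y : ℕ) : ℕ :=
  (match o with
    | .add => x + y
    | .sub => x - y
    | .mul => x * y
    | .div => x / y
    | .mod => x % y
    | .and => x &&& y
    | .or => x ||| y
    | .xor => x ^^^ y
    | .shl => x <<< y
    | .shr => x >>> y
    | .lt => if x < y then 1 else 0
    | .eq => if x = y then 1 else 0) % 2 ^ w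

/-- Programs; all the arguments except the constant `k` in `const` are names of registers. -/
inductive Cmd
  /-- `r := k` -/
  | const (r k : ℕ)
  /-- `r := x o y` -/
  | op (o : BinOp) (r x y : ℕ)
  /-- `r := mem[a]` -/
  | load (r a : ℕ)
  /-- `mem[a] := r` -/
  | store (a r : ℕ)
  /-- append `r` to the output -/
  | emit (r : ℕ)
  /-- write the answer to the query with interval `[i..j]` to the cells from `a` on, three cells for
  each character, and the number of reported characters to the register `k` -/
  | query (i j a k : ℕ)
  | seq (p q : Cmd)
  /-- test whether `r` is nonzero -/
  | ite (r : ℕ) (p q : Cmd)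
  /-- repeat `p` while `r` is nonzero -/
  | loop (r : ℕ) (p : Cmd)

/-- A number that exceeds all the register names in a program. -/
def Cmd.numRegs : Cmd → ℕ
  | .const r _ => r + 1
  | .op _ r x y => max r (max x y) + 1
  | .load r a => max r a + 1
  | .store a r => max a r + 1
  | .emit r => r + 1
  | .query i j a k => max (max i j) (max a k) + 1
  | .seq p q => max p.numRegs q.numRegs
  | .ite r p q => max (r + 1) (max p.numRegs q.numRegs)
  | .loop r p => max (r + 1) p.numRegs

/-- The configuration of the machine: contents of registers and memory, output so far, time elapsed,
and a number `cells` such that no memory cell with address `≥ cells` was ever read or written. -/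
structure State where
  reg : ℕ → ℕ
  mem : ℕ → ℕ
  out : List ℕ
  time : ℕ
  cells : ℕ

/-- The environment of a run: the word size `w`, the length `n` of the reported sequence, the
answers to the queries, and the time `te` that a query takes per reported character. -/
structure Env where
  w : ℕ
  n : ℕ
  report : ℕ → ℕ → List (ℕ × ℕ × ℕ)
  te : ℕ

def State.setReg (s : State) (r v : ℕ) : State :=
  { s with reg := Function.update s.reg r v }

def State.tick (s : State) (t : ℕ) : State :=
  { s with time := s.time + t }

/-- Record that the cells with address `< m` may have been accessed. -/
def State.touch (s : State) (m : ℕ) : State :=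
  { s with cells := max s.cells m }

/-- Write the words of a list to consecutive cells from address `a` on. -/
def State.writeBlock (s : State) (a : ℕ) (L : List ℕ) : State :=
  { s with mem := fun x => if a ≤ x then L.getD (x - a) (s.mem x) else s.mem x }

/-- `Exec E p s s'`: the program `p`, started in the configuration `s`, terminates, in the
configuration `s'`.  A query needs an interval within `[1..n]` and room for its answer in the
address space `[0, 2 ^ w)`; otherwise the machine is stuck. -/
inductive Exec (E : Env) : Cmd → State → State → Prop
  | const (r k : ℕ) (s : State) :
      Exec E (.const r k) s ((s.setReg r (k % 2 ^ E.w)).tick 1)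
  | op (o : BinOp) (r x y : ℕ) (s : State) :
      Exec E (.op o r x y) s ((s.setReg r (o.eval E.w (s.reg x) (s.reg y))).tick 1)
  | load (r a : ℕ) (s : State) :
      Exec E (.load r a) s (((s.setReg r (s.mem (s.reg a))).touch (s.reg a + 1)).tick 1)
  | store (a r : ℕ) (s : State) :
      Exec E (.store a r) s (((s.writeBlock (s.reg a) [s.reg r]).touch (s.reg a + 1)).tick 1)
  | emit (r : ℕ) (s : State) :
      Exec E (.emit r) s (({ s with out := s.out ++ [s.reg r] } : State).tick 1)
  | query (i j a k : ℕ) (s : State)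
      (hi : 1 ≤ s.reg i) (hij : s.reg i ≤ s.reg j) (hj : s.reg j ≤ E.n)
      (L : List (ℕ × ℕ × ℕ)) (hL : L = E.report (s.reg i) (s.reg j))
      (hroom : s.reg a + 3 * L.length ≤ 2 ^ E.w) :
      Exec E (.query i j a k) s
        ((((s.writeBlock (s.reg a) (flattenTriples L)).touch
          (s.reg a + 3 * L.length)).setReg k L.length).tick (E.te * L.length))
  | seq (p q : Cmd) (s s' s'' : State) (hp : Exec E p s s') (hq : Exec E q s' s'') :
      Exec E (.seq p q) s s''
  | iteTrue (r : ℕ) (p q : Cmd) (s s' : State) (h : s.reg r ≠ 0) (hp : Exec E p (s.tick 1) s') :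
      Exec E (.ite r p q) s s'
  | iteFalse (r : ℕ) (p q : Cmd) (s s' : State) (h : s.reg r = 0) (hq : Exec E q (s.tick 1) s') :
      Exec E (.ite r p q) s s'
  | loopDone (r : ℕ) (p : Cmd) (s : State) (h : s.reg r = 0) :
      Exec E (.loop r p) s (s.tick 1)
  | loopStep (r : ℕ) (p : Cmd) (s s' s'' : State) (h : s.reg r ≠ 0)
      (hp : Exec E p (s.tick 1) s') (hl : Exec E (.loop r p) s' s'') :
      Exec E (.loop r p) s s''

/-- The initial configuration: register `0` holds `n`, register `1` holds `σ`, everything else is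
zero. -/
def initState (n σ : ℕ) : State where
  reg := fun r => if r = 0 then n else if r = 1 then σ else 0
  mem := fun _ => 0
  out := []
  time := 0
  cells := 0

/-- The working space, in bits, of a run of `p` with word size `w` that ends in `s`: all the
registers and all the memory cells up to the largest address that was accessed. -/
def spaceBits (w : ℕ) (p : Cmd) (s : State) : ℕ := w * (p.numRegs + s.cells)

end BWTEnum

set_option linter.constructorNameAsVariable false

namespace BWTEnum

/-! ### A layer of instructions with named variables over the machine

The memory is viewed as an array with `R` rows of `F` cells.  Programs use named variables; the
registers from `100` on are reserved for `F` and for intermediate results. -/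

/-! Deleting the first character of an internal node leaves an internal node (`IsInternal.of_cons`).
So the internal nodes form a tree rooted at the empty string, whose edges prepend a character, and
the program traverses this tree with an explicit stack. The stack entry of a node `p` is only the
list of its children with labels and intervals; the interval of `p` is read off the first and the
last child (`lo_head_kids`, `hi_last_kids`). A child may be represented by `p` and the first
character of its edge, because both strings have the same interval (`isChildEntry_iff`).

To visit `p`, the interval of each `pd` is queried, in increasing order of `d`. By backward search
(`lo_cons`, `hi_cons`) the ranks reported for a character `c ≥ 1`, shifted by the number of smaller
characters, are the bounds of the interval of `cpd`. They are appended to a list kept for `c`. In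
the end this is the list of children of `cp` (`absorb_partialTable`, `partialTable_kids`), and `cp`
is internal exactly if the list has at least two members.

Time: the work at `p` is of order `te` times `weight`, the number of children of `p` and of all the
`cp`. The weights of the internal nodes add up to at most `5n` (`sum_weight_le`): children other
than first ones start at different ranks, and the `cp` that occur without being internal have at
most one child each and end at different positions of the text.

Space: if the most frequent left extension of `p` is internal, it is pushed first and hence popped
last. Every other one has at most half of the occurrences of `p` (`occ_cons_add_le`). So the stack
consists of at most `log n` groups of at most `σ` nodes (`Good`). Each entry takes `3σ + 4` words,
and `σ ^ 3 ≤ n` makes the total `o(n)` bits.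

The program is verified with total correctness rules (`Runs`) that also account for time and memory.
-/

inductive Var
  | n | sigma | fb | sp | top | k | kk | x | y | m | c | d | i | j | a | b | base | row | cnt | dst
  | best | z | rem | flag
  deriving DecidableEq

def Var.idx (x : Var) : ℕ := x.ctorIdx

theorem Var.idx_injective : Function.Injective Var.idx := by
  intro x y h
  cases x <;> cases y <;> first | rfl | (exfalso; revert h; decide)

theorem Var.idx_lt (x : Var) : x.idx < 100 := by
  cases x <;> decide

@[simp] theorem Var.idx_inj {x y : Var} : x.idx = y.idx ↔ x = y := Var.idx_injective.eq_iff

structure VState where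
  get : Var → ℕ
  M : ℕ → ℕ → ℕ
  out : List ℕ
  time : ℕ

def VState.tick (v : VState) (t : ℕ) : VState := { v with time := v.time + t }

def VState.set (v : VState) (x : Var) (a : ℕ) : VState :=
  { v with get := Function.update v.get x a }

def VState.write (v : VState) (i j a : ℕ) : VState :=
  { v with M := Function.update v.M i (Function.update (v.M i) j a) }

def VState.setRow (v : VState) (i : ℕ) (f : ℕ → ℕ) : VState :=
  { v with M := Function.update v.M i f }

/-- The intended layout: row `0` has the number of smaller characters for each `c`, row `1` the
characters met during an expansion, row `2` the answer to a query, row `c + 3` the list collected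
for `c`, and the rows from `σ + 4` on the stack. `mem_fit` makes every address a machine word. -/
structure Machine extends Env where
  F : ℕ
  R : ℕ
  consts_fit : 256 ≤ 2 ^ w
  mem_fit : R * F ≤ 2 ^ w

/-- Time is only bounded from above, so that an instruction has one price whatever the kind of its
operands. The registers above `100` are left free. `cells` is the space bound in the end. -/
structure Rel (A : Machine) (s : State) (v : VState) : Prop where
  reg : ∀ x : Var, s.reg x.idx = v.get x
  width : s.reg 100 = A.F
  mem : ∀ i < A.R, ∀ j < A.F, s.mem (i * A.F + j) = v.M i j
  out : s.out = v.out
  time : s.time ≤ v.time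
  cells : s.cells ≤ A.R * A.F

/-- Total correctness: from a configuration described by `v`, the program terminates in a
configuration whose description satisfies `Q`. -/
def Runs (A : Machine) (p : Cmd) (v : VState) (Q : VState → Prop) : Prop :=
  ∀ s, Rel A s v → ∃ s' v', Exec A.toEnv p s s' ∧ Rel A s' v' ∧ Q v'

/-- Operands of instructions. -/
inductive Opd
  | var (x : Var)
  | num (k : ℕ)

instance : Coe Var Opd := ⟨Opd.var⟩

instance (k : ℕ) : OfNat Opd k := ⟨Opd.num k⟩

def Opd.val (v : VState) : Opd → ℕ
  | .var x => v.get x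
  | .num k => k

def Opd.Small : Opd → Prop
  | .var _ => True
  | .num k => k < 256

def withOpd (o : Opd) (t : ℕ) (f : ℕ → Cmd) : Cmd :=
  match o with
  | .var x => f x.idx
  | .num k => .seq (.const t k) (f t)

def bin (o : BinOp) (r : Var) (x y : Opd) : Cmd :=
  withOpd x 101 fun a => withOpd y 102 fun b => .op o r.idx a b

def ld (r : Var) (i j : Opd) : Cmd :=
  withOpd i 101 fun a => withOpd j 102 fun b =>
    .seq (.op .mul 103 a 100) (.seq (.op .add 103 103 b) (.load r.idx 103))

def st (i j x : Opd) : Cmd :=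
  withOpd i 101 fun a => withOpd j 102 fun b => withOpd x 104 fun c =>
    .seq (.op .mul 103 a 100) (.seq (.op .add 103 103 b) (.store 103 c))

def put (x : Opd) : Cmd := withOpd x 101 .emit

theorem length_flattenTriples (L : List (ℕ × ℕ × ℕ)) :
    (flattenTriples L).length = 3 * L.length := by
  induction L with
  | nil => rfl
  | cons t L ih =>
    simp only [flattenTriples, List.flatMap_cons, List.length_append, List.length_cons,
      List.length_nil] at ih ⊢
    omega

/-- The answer to the query is written to row `2`. -/
def ask (i j k : Var) : Cmd :=
  .seq (.const 103 2) (.seq (.op .mul 103 103 100) (.query i.idx j.idx 103 k.idx))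

def skip : Cmd := .const 103 0

/-! ### Simulation of single machine instructions. -/

theorem Rel.mono {A : Machine} {s : State} {v : VState} (h : Rel A s v) (t : ℕ) :
    Rel A s (v.tick t) :=
  ⟨h.reg, h.width, h.mem, h.out, h.time.trans (Nat.le_add_right _ _), h.cells⟩

/-- Changes to the registers for intermediate results are invisible. -/
theorem Rel.scratch {A : Machine} {s : State} {v : VState} (h : Rel A s v) {t a c : ℕ}
    (ht : 100 < t) (hc : c ≤ A.R * A.F) (d : ℕ) :
    Rel A (((s.setReg t a).touch c).tick d) (v.tick d) where
  reg x := by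
    have := x.idx_lt
    simp only [State.setReg, State.tick, State.touch]
    rw [Function.update_of_ne (by omega)]; exact h.reg x
  width := by
    simp only [State.setReg, State.tick, State.touch]
    rw [Function.update_of_ne (by omega)]; exact h.width
  mem := h.mem
  out := h.out
  time := Nat.add_le_add_right h.time d
  cells := max_le h.cells hc

theorem Rel.scratch' {A : Machine} {s : State} {v : VState} (h : Rel A s v) {t a : ℕ}
    (ht : 100 < t) (d : ℕ) :
    Rel A ((s.setReg t a).tick d) (v.tick d) := by
  have := h.scratch (a := a) ht (Nat.zero_le _) d
  simpa [State.touch, State.setReg, State.tick] using this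

theorem Rel.set {A : Machine} {s : State} {v : VState} (h : Rel A s v) (x : Var) (a : ℕ) {c : ℕ}
    (hc : c ≤ A.R * A.F) (d : ℕ) :
    Rel A (((s.setReg x.idx a).touch c).tick d) ((v.set x a).tick d) where
  reg y := by
    simp only [State.setReg, State.tick, State.touch, VState.tick, VState.set,
      Function.update_apply, Var.idx_inj, h.reg]
  width := by
    have := x.idx_lt
    simp only [State.setReg, State.tick, State.touch]
    rw [Function.update_of_ne (by omega)]; exact h.width
  mem := h.mem
  out := h.out
  time := Nat.add_le_add_right h.time d
  cells := max_le h.cells hc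

theorem Rel.set' {A : Machine} {s : State} {v : VState} (h : Rel A s v) (x : Var) (a d : ℕ) :
    Rel A ((s.setReg x.idx a).tick d) ((v.set x a).tick d) := by
  have := h.set x a (Nat.zero_le _) d
  simpa [State.touch, State.setReg, State.tick] using this

theorem exec_withOpd {A : Machine} {s : State} {v : VState} (h : Rel A s v) {o : Opd}
    (ho : o.Small) {t : ℕ} (ht : 100 < t) {f : ℕ → Cmd} {P : State → Prop}
    (H : ∀ r s₁, Rel A s₁ (v.tick 1) → s₁.reg r = o.val v → (r = t ∨ r < 100) →
      (∀ q, q ≠ t → s₁.reg q = s.reg q) → ∃ s', Exec A.toEnv (f r) s₁ s' ∧ P s') :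
    ∃ s', Exec A.toEnv (withOpd o t f) s s' ∧ P s' := by
  cases o with
  -- A variable needs no instruction, but is charged one unit like a literal.
  | var x => exact H x.idx s (h.mono 1) (h.reg x) (Or.inr x.idx_lt) fun _ _ => rfl
  | num k =>
    have hk : k % 2 ^ A.w = k := Nat.mod_eq_of_lt (lt_of_lt_of_le ho A.consts_fit)
    obtain ⟨s', h₁, h₂⟩ := H t _ (h.scratch' (a := k % 2 ^ A.w) ht 1)
      (by simp [State.setReg, State.tick, hk, Opd.val]) (Or.inl rfl)
      (by intro q hq; simp [State.setReg, State.tick, hq])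
    exact ⟨s', .seq _ _ _ _ _ (.const _ _ _) h₁, h₂⟩

theorem Machine.cell_lt (A : Machine) {i j : ℕ} (hi : i < A.R) (hj : j < A.F) :
    i * A.F + j + 1 ≤ A.R * A.F := by
  calc i * A.F + j + 1 ≤ i * A.F + A.F := by omega
    _ = (i + 1) * A.F := by ring
    _ ≤ A.R * A.F := Nat.mul_le_mul_right _ hi

theorem cell_inj {F i j i' j' : ℕ} (hj : j < F) (hj' : j' < F) :
    i * F + j = i' * F + j' ↔ i = i' ∧ j = j' := by
  constructor
  · intro h
    have hF : 0 < F := by omega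
    have h1 : i = i' := by
      have := congrArg (· / F) h
      simpa [Nat.mul_comm _ F, Nat.mul_add_div hF, Nat.div_eq_of_lt hj, Nat.div_eq_of_lt hj']
        using this
    subst h1
    exact ⟨rfl, by omega⟩
  · rintro ⟨rfl, rfl⟩; rfl

/-! ### Total correctness rules for instructions and control structures. -/

theorem Runs.bin {A : Machine} {v : VState} {Q : VState → Prop} {o : BinOp} {r : Var} {x y : Opd}
    (hx : x.Small) (hy : y.Small)
    (H : Q ((v.set r (o.eval A.w (x.val v) (y.val v))).tick 3)) : Runs A (bin o r x y) v Q := by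
  intro s hs
  suffices h : ∃ s', Exec A.toEnv (BWTEnum.bin o r x y) s s' ∧
      Rel A s' ((v.set r (o.eval A.w (x.val v) (y.val v))).tick 3) by
    obtain ⟨s', h1, h2⟩ := h
    exact ⟨s', _, h1, h2, H⟩
  refine exec_withOpd hs hx (by omega) fun a s₁ h₁ ha hat _ => ?_
  refine exec_withOpd h₁ hy (by omega) fun b s₂ h₂ hb hbt hf => ?_
  refine ⟨_, .op _ _ _ _ _, ?_⟩
  have hy' : y.val (v.tick 1) = y.val v := by cases y <;> rfl
  have ha' : s₂.reg a = x.val v := by rw [hf a (by omega), ha]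
  rw [ha', hb, hy']
  exact h₂.set' r _ 1

theorem Runs.add {A : Machine} {v : VState} {Q : VState → Prop} {r : Var} {x y : Opd}
    (hx : x.Small) (hy : y.Small) (hlt : x.val v + y.val v < 2 ^ A.w)
    (H : Q ((v.set r (x.val v + y.val v)).tick 3)) : Runs A (BWTEnum.bin .add r x y) v Q := by
  apply Runs.bin hx hy
  rwa [BinOp.eval, Nat.mod_eq_of_lt hlt]

theorem Runs.sub {A : Machine} {v : VState} {Q : VState → Prop} {r : Var} {x y : Opd}
    (hx : x.Small) (hy : y.Small) (hlt : x.val v - y.val v < 2 ^ A.w)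
    (H : Q ((v.set r (x.val v - y.val v)).tick 3)) : Runs A (BWTEnum.bin .sub r x y) v Q := by
  apply Runs.bin hx hy
  rwa [BinOp.eval, Nat.mod_eq_of_lt hlt]

theorem Runs.lt {A : Machine} {v : VState} {Q : VState → Prop} {r : Var} {x y : Opd}
    (hx : x.Small) (hy : y.Small)
    (H : Q ((v.set r (if x.val v < y.val v then 1 else 0)).tick 3)) :
    Runs A (BWTEnum.bin .lt r x y) v Q := by
  apply Runs.bin hx hy
  have := A.consts_fit
  rwa [BinOp.eval, Nat.mod_eq_of_lt (by split_ifs <;> omega)]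

/-- The address cannot overflow, since the cell lies in a block of `R * F ≤ 2 ^ w` cells. Register
`103` is overwritten before `b` is read, hence `b ≠ 103`. -/
theorem exec_addr {A : Machine} {s : State} {v : VState} (h : Rel A s v) {a b i j : ℕ}
    (ha : s.reg a = i) (hb : s.reg b = j) (hi : i < A.R) (hj : j < A.F) (hb' : b ≠ 103)
    {q : Cmd} {P : State → Prop}
    (H : ∀ s₁, Rel A s₁ (v.tick 2) → s₁.reg 103 = i * A.F + j →
      (∀ q, q ≠ 103 → s₁.reg q = s.reg q) → ∃ s', Exec A.toEnv q s₁ s' ∧ P s') :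
    ∃ s', Exec A.toEnv (.seq (.op .mul 103 a 100) (.seq (.op .add 103 103 b) q)) s s' ∧ P s' := by
  have hc := A.cell_lt hi hj
  have hm := A.mem_fit
  have e1 : BinOp.eval A.w .mul (s.reg a) (s.reg 100) = i * A.F := by
    rw [BinOp.eval, ha, h.width, Nat.mod_eq_of_lt (by omega)]
  set s₀ := (s.setReg 103 (BinOp.eval A.w .mul (s.reg a) (s.reg 100))).tick 1 with hs₀
  have r1 : Rel A s₀ (v.tick 1) := h.scratch' (by omega) 1
  have e2 : BinOp.eval A.w .add (s₀.reg 103) (s₀.reg b) = i * A.F + j := by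
    have : s₀.reg 103 = i * A.F := by simp [hs₀, State.setReg, State.tick, e1]
    have hb'' : s₀.reg b = j := by simp [hs₀, State.setReg, State.tick, hb', hb]
    rw [BinOp.eval, this, hb'', Nat.mod_eq_of_lt (by omega)]
  obtain ⟨s', x1, x2⟩ := H ((s₀.setReg 103 (BinOp.eval A.w .add (s₀.reg 103) (s₀.reg b))).tick 1)
    (r1.scratch' (by omega) 1) (by simp [State.setReg, State.tick, e2])
    (by intro q hq; simp [hs₀, State.setReg, State.tick, hq])
  exact ⟨s', .seq _ _ _ _ _ (.op _ _ _ _ _) (.seq _ _ _ _ _ (.op _ _ _ _ _) x1), x2⟩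

@[simp] theorem Opd.val_tick (o : Opd) (v : VState) (t : ℕ) : o.val (v.tick t) = o.val v := by
  cases o <;> rfl

theorem Runs.ld {A : Machine} {v : VState} {Q : VState → Prop} {r : Var} {i j : Opd}
    (hi : i.Small) (hj : j.Small) (hiR : i.val v < A.R) (hjF : j.val v < A.F)
    (H : Q ((v.set r (v.M (i.val v) (j.val v))).tick 6)) : Runs A (BWTEnum.ld r i j) v Q := by
  intro s hs
  suffices h : ∃ s', Exec A.toEnv (BWTEnum.ld r i j) s s' ∧
      Rel A s' ((v.set r (v.M (i.val v) (j.val v))).tick 6) by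
    obtain ⟨s', h1, h2⟩ := h
    exact ⟨s', _, h1, h2, H⟩
  refine exec_withOpd hs hi (by omega) fun a s₁ h₁ ha hat _ => ?_
  refine exec_withOpd h₁ hj (by omega) fun b s₂ h₂ hb hbt hf => ?_
  rw [Opd.val_tick] at hb
  refine exec_addr h₂ ((hf a (by omega)).trans ha) hb hiR hjF (by omega) fun s₃ h₃ e _ => ?_
  refine ⟨_, .load _ _ _, ?_⟩
  have hm := h₃.mem _ hiR _ hjF
  have := (h₃.set r (s₃.mem (s₃.reg 103)) (c := s₃.reg 103 + 1)
    (by rw [e]; exact A.cell_lt hiR hjF) 1).mono 1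
  rw [e, hm] at this
  rw [e, hm]
  exact this

theorem Runs.st {A : Machine} {v : VState} {Q : VState → Prop} {i j x : Opd}
    (hi : i.Small) (hj : j.Small) (hx : x.Small) (hiR : i.val v < A.R) (hjF : j.val v < A.F)
    (H : Q ((v.write (i.val v) (j.val v) (x.val v)).tick 6)) : Runs A (BWTEnum.st i j x) v Q := by
  intro s hs
  suffices h : ∃ s', Exec A.toEnv (BWTEnum.st i j x) s s' ∧
      Rel A s' ((v.write (i.val v) (j.val v) (x.val v)).tick 6) by
    obtain ⟨s', h1, h2⟩ := h
    exact ⟨s', _, h1, h2, H⟩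
  refine exec_withOpd hs hi (by omega) fun a s₁ h₁ ha hat _ => ?_
  refine exec_withOpd h₁ hj (by omega) fun b s₂ h₂ hb hbt hf => ?_
  refine exec_withOpd h₂ hx (by omega) fun c s₃ h₃ hc hct hf' => ?_
  simp only [Opd.val_tick] at hb hc
  refine exec_addr h₃ ((hf' a (by omega)).trans ((hf a (by omega)).trans ha))
    ((hf' b (by omega)).trans hb) hiR hjF (by omega) fun s₄ h₄ e hf'' => ?_
  refine ⟨_, .store _ _ _, ?_⟩
  have hc' : s₄.reg c = x.val v := (hf'' c (by omega)).trans hc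
  constructor
  · exact h₄.reg
  · exact h₄.width
  · intro i' hi' j' hj'
    have hcell := cell_inj (i := i.val v) (i' := i') hjF hj'
    have hm : s₄.mem (i' * A.F + j') = v.M i' j' := h₄.mem _ hi' _ hj'
    simp only [State.writeBlock, State.touch, State.tick, e, hc', VState.write, VState.tick,
      Function.update_apply]
    by_cases hle : i.val v * A.F + j.val v ≤ i' * A.F + j'
    · rw [if_pos hle]
      rcases Nat.eq_or_lt_of_le hle with heq | hlt
      · obtain ⟨rfl, rfl⟩ := hcell.1 heq
        simp
      · have : ¬ (i' = i.val v ∧ j' = j.val v) := fun hh => by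
          have := hcell.2 ⟨hh.1.symm, hh.2.symm⟩; omega
        rw [List.getD_eq_default _ _ (by simp; omega), hm]
        split_ifs <;> simp_all
    · have : ¬ (i' = i.val v ∧ j' = j.val v) := fun hh => by
          have := hcell.2 ⟨hh.1.symm, hh.2.symm⟩; omega
      rw [if_neg hle, hm]
      split_ifs <;> simp_all
  · exact h₄.out
  · have := h₄.time
    simp only [VState.tick, VState.write, State.tick, State.touch, State.writeBlock] at this ⊢
    omega
  · refine max_le h₄.cells ?_
    rw [e]; exact A.cell_lt hiR hjF

theorem Runs.put {A : Machine} {v : VState} {Q : VState → Prop} {x : Opd} (hx : x.Small)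
    (H : Q ({ v with out := v.out ++ [x.val v] }.tick 2)) : Runs A (BWTEnum.put x) v Q := by
  intro s hs
  suffices h : ∃ s', Exec A.toEnv (BWTEnum.put x) s s' ∧
      Rel A s' ({ v with out := v.out ++ [x.val v] }.tick 2) by
    obtain ⟨s', h1, h2⟩ := h
    exact ⟨s', _, h1, h2, H⟩
  refine exec_withOpd hs hx (by omega) fun a s₁ h₁ ha hat _ => ?_
  refine ⟨_, .emit _ _, ⟨h₁.reg, h₁.width, h₁.mem, ?_, ?_, h₁.cells⟩⟩
  · have := h₁.out
    simp only [State.tick, VState.tick, ha] at this ⊢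
    rw [this]
  · have := h₁.time
    simp only [State.tick, VState.tick] at this ⊢
    omega

theorem Runs.skip {A : Machine} {v : VState} {Q : VState → Prop} (H : Q (v.tick 1)) :
    Runs A BWTEnum.skip v Q :=
  fun _ hs => ⟨_, _, .const _ _ _, hs.scratch' (by omega) 1, H⟩

theorem Runs.seq {A : Machine} {v : VState} {Q : VState → Prop} {p q : Cmd}
    (H : Runs A p v fun v' => Runs A q v' Q) : Runs A (.seq p q) v Q := by
  intro s hs
  obtain ⟨s₁, v₁, h₁, r₁, H₁⟩ := H s hs
  obtain ⟨s₂, v₂, h₂, r₂, H₂⟩ := H₁ s₁ r₁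
  exact ⟨s₂, v₂, .seq _ _ _ _ _ h₁ h₂, r₂, H₂⟩

theorem Runs.mono {A : Machine} {v : VState} {P Q : VState → Prop} {p : Cmd}
    (H : Runs A p v P) (h : ∀ v', P v' → Q v') : Runs A p v Q := by
  intro s hs
  obtain ⟨s', v', h₁, h₂, h₃⟩ := H s hs
  exact ⟨s', v', h₁, h₂, h _ h₃⟩

theorem Rel.tick {A : Machine} {s : State} {v : VState} (h : Rel A s v) (t : ℕ) :
    Rel A (s.tick t) (v.tick t) :=
  ⟨h.reg, h.width, h.mem, h.out, Nat.add_le_add_right h.time t, h.cells⟩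

theorem Runs.ite {A : Machine} {v : VState} {Q : VState → Prop} {x : Var} {p q : Cmd}
    (hp : v.get x ≠ 0 → Runs A p (v.tick 1) Q) (hq : v.get x = 0 → Runs A q (v.tick 1) Q) :
    Runs A (.ite x.idx p q) v Q := by
  intro s hs
  by_cases h : v.get x = 0
  · obtain ⟨s', v', h₁, h₂⟩ := hq h _ (hs.tick 1)
    exact ⟨s', v', .iteFalse _ _ _ _ _ ((hs.reg x).trans h) h₁, h₂⟩
  · obtain ⟨s', v', h₁, h₂⟩ := hp h _ (hs.tick 1)
    exact ⟨s', v', .iteTrue _ _ _ _ _ (by rwa [hs.reg x]) h₁, h₂⟩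

/-- The index of the invariant is a variant: it must decrease in each round, which gives
termination. -/
theorem Runs.loop {A : Machine} {x : Var} {p : Cmd} (I : ℕ → VState → Prop)
    (hp : ∀ N v, I N v → v.get x ≠ 0 → Runs A p (v.tick 1) fun v' => ∃ N' < N, I N' v')
    {Q : VState → Prop} (hQ : ∀ N v, I N v → v.get x = 0 → Q (v.tick 1))
    {N : ℕ} {v : VState} (h : I N v) : Runs A (.loop x.idx p) v Q := by
  induction N using Nat.strong_induction_on generalizing v with
  | _ N ih =>
    intro s hs
    by_cases h0 : v.get x = 0
    · exact ⟨_, _, .loopDone _ _ _ ((hs.reg x).trans h0), hs.tick 1, hQ N v h h0⟩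
    · obtain ⟨s₁, v₁, e₁, r₁, N', hN', h₁⟩ := hp N v h h0 _ (hs.tick 1)
      obtain ⟨s₂, v₂, e₂, r₂, q₂⟩ := ih N' hN' h₁ s₁ r₁
      exact ⟨s₂, v₂, .loopStep _ _ _ _ _ (by rwa [hs.reg x]) e₁ e₂, r₂, q₂⟩

/-- A loop that handles the members of a list one by one, and counts down the variable `x`. -/
theorem Runs.forEach {α : Type*} {A : Machine} {x : Var} {p : Cmd}
    (I : List α → List α → VState → Prop)
    (hp : ∀ l a r v, I l (a :: r) v → v.get x = r.length + 1 →
      Runs A p (v.tick 1) fun v' => v'.get x = r.length ∧ I (l ++ [a]) r v')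
    {Q : VState → Prop} {L : List α} (hQ : ∀ v, I L [] v → Q (v.tick 1))
    {v : VState} (h : I [] L v) (hx : v.get x = L.length) : Runs A (.loop x.idx p) v Q := by
  refine Runs.loop (fun N v => ∃ l r, L = l ++ r ∧ r.length = N ∧ v.get x = N ∧ I l r v)
    ?_ ?_ (N := L.length) ⟨[], L, rfl, rfl, hx, h⟩
  · rintro N v ⟨l, r, hL, hr, hN, hI⟩ h0
    cases r with
    | nil => simp only [List.length_nil] at hr; omega
    | cons a r =>
      simp only [List.length_cons] at hr
      refine (hp l a r v hI (by omega)).mono fun v' hv' => ?_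
      exact ⟨r.length, by omega, l ++ [a], r, by simp [hL], rfl, hv'.1, hv'.2⟩
  · rintro N v ⟨l, r, hL, hr, hN, hI⟩ h0
    obtain rfl : r = [] := List.eq_nil_of_length_eq_zero (by omega)
    obtain rfl : L = l := by simpa using hL
    exact hQ v hI

theorem Runs.ask {A : Machine} {v : VState} {Q : VState → Prop} {i j k : Var}
    {L : List (ℕ × ℕ × ℕ)} (hL : A.report (v.get i) (v.get j) = L)
    (hi : 1 ≤ v.get i) (hij : v.get i ≤ v.get j) (hj : v.get j ≤ A.n)
    (hR : 2 < A.R) (hF : 3 * L.length < A.F)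
    (H : Q (((v.setRow 2 fun j => (flattenTriples L).getD j (v.M 2 j)).set k L.length).tick
      (2 + A.te * L.length))) : Runs A (BWTEnum.ask i j k) v Q := by
  intro s hs
  have hm := A.mem_fit
  have hc := A.cell_lt hR hF
  have h1 := hs.scratch' (t := 103) (a := 2 % 2 ^ A.w) (by omega) 1
  set s₁ := (s.setReg 103 (2 % 2 ^ A.w)).tick 1 with hs₁
  set s₂ := (s₁.setReg 103 (BinOp.eval A.w .mul (s₁.reg 103) (s₁.reg 100))).tick 1 with hs₂
  have h2 : Rel A s₂ (v.tick 2) := h1.scratch' (by omega) 1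
  have e2 : s₂.reg 103 = 2 * A.F := by
    have e1 : s₁.reg 103 = 2 := by
      have := A.consts_fit
      simp only [hs₁, State.setReg, State.tick, Function.update_self]
      exact Nat.mod_eq_of_lt (by omega)
    have : BinOp.eval A.w .mul (s₁.reg 103) (s₁.reg 100) = 2 * A.F := by
      rw [BinOp.eval, e1, h1.width, Nat.mod_eq_of_lt (by omega)]
    simp only [hs₂, State.setReg, State.tick, Function.update_self]
    exact this
  have ei : s₂.reg i.idx = v.get i := h2.reg i
  have ej : s₂.reg j.idx = v.get j := h2.reg j
  refine ⟨_, _, .seq _ _ _ _ _ (.const _ _ _) (.seq _ _ _ _ _ (.op _ _ _ _ _)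
    (.query _ _ _ _ s₂ (by omega) (by omega) (by omega) L (by rw [ei, ej, hL])
      (by rw [e2]; omega))), ?_, H⟩
  constructor
  · intro y
    have := h2.reg y
    simp only [State.setReg, State.tick, State.touch, State.writeBlock, VState.tick, VState.set,
      VState.setRow, Function.update_apply, Var.idx_inj] at this ⊢
    rw [this]
  · have := k.idx_lt
    have hw := h2.width
    simp only [State.setReg, State.tick, State.touch, State.writeBlock] at hw ⊢
    rw [Function.update_of_ne (by omega)]; exact hw
  · intro i' hi' j' hj'
    have hm : s₂.mem (i' * A.F + j') = v.M i' j' := h2.mem _ hi' _ hj'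
    simp only [State.setReg, State.tick, State.touch, State.writeBlock, VState.tick, VState.set,
      VState.setRow, e2, Function.update_apply]
    by_cases h2i : i' = 2
    · subst h2i
      simp [hm]
    · rw [if_neg h2i]
      split_ifs with hle
      -- A later row lies behind the answer, which is shorter than one row, so `getD` returns the
      -- old content.
      · have : 2 < i' := by
          by_contra hlt
          have : i' * A.F + A.F ≤ 2 * A.F := by
            calc i' * A.F + A.F = (i' + 1) * A.F := by ring
              _ ≤ 2 * A.F := Nat.mul_le_mul_right _ (by omega)
          omega
        have : 3 * A.F ≤ i' * A.F := Nat.mul_le_mul_right _ this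
        rw [List.getD_eq_default _ _ (by rw [length_flattenTriples]; omega), hm]
      · exact hm
  · exact h2.out
  · have := h2.time
    simp only [State.setReg, State.tick, State.touch, State.writeBlock, VState.tick, VState.set,
      VState.setRow] at this ⊢
    omega
  · refine max_le h2.cells ?_
    rw [e2]; omega

attribute [irreducible] bin ld st put ask skip

/-! ### Counting in lists -/

theorem countP_eq_add {α : Type*} {P Q R : α → Prop} [DecidablePred P] [DecidablePred Q]
    [DecidablePred R] {l : List α} (h : ∀ x ∈ l, R x ↔ P x ∨ Q x)
    (hd : ∀ x ∈ l, P x → ¬ Q x) : l.countP (R ·) = l.countP (P ·) + l.countP (Q ·) := by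
  induction l with
  | nil => rfl
  | cons a l ih =>
    have ih' := ih (fun x hx => h x (List.mem_cons_of_mem _ hx))
      (fun x hx => hd x (List.mem_cons_of_mem _ hx))
    have ha := h a List.mem_cons_self
    have hb := hd a List.mem_cons_self
    simp only [List.countP_cons, ih', decide_eq_true_eq]
    by_cases p : P a <;> by_cases q : Q a <;> simp_all <;> omega

theorem countP_congr_prop {α : Type*} {P Q : α → Prop} [DecidablePred P] [DecidablePred Q]
    {l : List α} (h : ∀ x ∈ l, P x ↔ Q x) : l.countP (P ·) = l.countP (Q ·) :=
  List.countP_congr fun x hx => by simpa using h x hx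

theorem countP_le_of_imp {α : Type*} {P Q : α → Prop} [DecidablePred P] [DecidablePred Q]
    {l : List α} (h : ∀ x ∈ l, P x → Q x) : l.countP (P ·) ≤ l.countP (Q ·) :=
  List.countP_mono_left fun x hx => by simpa using h x hx

theorem countP_lt_of_imp {α : Type*} {P Q : α → Prop} [DecidablePred P] [DecidablePred Q]
    {l : List α} (h : ∀ x ∈ l, P x → Q x) {a : α} (ha : a ∈ l) (hP : ¬ P a) (hQ : Q a) :
    l.countP (P ·) < l.countP (Q ·) := by
  obtain ⟨l₁, l₂, rfl⟩ := List.append_of_mem ha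
  have h₁ : l₁.countP (P ·) ≤ l₁.countP (Q ·) := countP_le_of_imp fun x hx => h x (by simp [hx])
  have h₂ : l₂.countP (P ·) ≤ l₂.countP (Q ·) := countP_le_of_imp fun x hx => h x (by simp [hx])
  simp only [List.countP_append, List.countP_cons, hP, hQ, decide_true, decide_false]
  simp
  omega

/-! ### The lexicographic order -/

theorem le_of_prefix {q s : List ℕ} (h : q <+: s) : q ≤ s := by
  induction q generalizing s with
  | nil => exact not_lt.1 (List.not_lt_nil s)
  | cons a q ih =>
    cases s with
    | nil => simp at h
    | cons b s =>
      obtain ⟨rfl, -⟩ := List.cons_prefix_cons.1 h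
      exact not_lt.1 fun hlt => by
        rcases List.cons_lt_cons_iff.1 hlt with h' | ⟨_, h'⟩
        · exact lt_irrefl _ h'
        · exact not_lt.2 (ih (List.cons_prefix_cons.1 h).2) h'

theorem not_lt_of_prefix {q s : List ℕ} (h : q <+: s) : ¬ s < q := not_lt.2 (le_of_prefix h)

/-- The extensions of `q` are contiguous in the lexicographic order; this is why suffixes with a
common prefix occupy an interval of ranks. -/
theorem prefix_of_le_of_le {q s x : List ℕ} (h₁ : q ≤ s) (h₂ : s ≤ q ++ x) : q <+: s := by
  induction q generalizing s with
  | nil => exact List.nil_prefix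
  | cons a q ih =>
    cases s with
    | nil => exact absurd (List.nil_lt_cons a q) (not_lt.2 h₁)
    | cons b s =>
      have e₁ : ¬ (b < a ∨ b = a ∧ s < q) := fun h => not_lt.2 h₁ (List.cons_lt_cons_iff.2 h)
      have e₂ : ¬ (a < b ∨ a = b ∧ q ++ x < s) := fun h => not_lt.2 h₂ (List.cons_lt_cons_iff.2 h)
      have hab : a = b := by
        rcases lt_trichotomy a b with h | h | h
        · exact absurd (Or.inl h) e₂
        · exact h
        · exact absurd (Or.inl h) e₁
      subst hab
      exact List.cons_prefix_cons.2 ⟨rfl, ih (not_lt.1 fun h => e₁ (Or.inr ⟨rfl, h⟩))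
        (not_lt.1 fun h => e₂ (Or.inr ⟨rfl, h⟩))⟩

/-- All comparisons between the bounds of a node and those of its children go back to this case
distinction. -/
theorem lt_append_singleton_iff {p s : List ℕ} {d : ℕ} :
    s < p ++ [d] ↔ s < p ∨ s = p ∨ ∃ e < d, p ++ [e] <+: s := by
  induction p generalizing s with
  | nil =>
    cases s with
    | nil => simp
    | cons b s =>
      simp [List.cons_lt_cons_iff, List.cons_prefix_cons]
  | cons a p ih =>
    cases s with
    | nil => simp
    | cons b s =>
      simp only [List.cons_append, List.cons_lt_cons_iff, ih, List.cons_prefix_cons,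
        List.cons.injEq]
      constructor
      · rintro (h | ⟨rfl, h | rfl | ⟨e, he, h⟩⟩)
        · exact .inl (.inl h)
        · exact .inl (.inr ⟨rfl, h⟩)
        · exact .inr (.inl ⟨rfl, rfl⟩)
        · exact .inr (.inr ⟨e, he, rfl, h⟩)
      · rintro ((h | ⟨rfl, h⟩) | ⟨rfl, rfl⟩ | ⟨e, he, rfl, h⟩)
        · exact .inl h
        · exact .inr ⟨rfl, .inl h⟩
        · exact .inr ⟨rfl, .inr (.inl rfl)⟩
        · exact .inr ⟨rfl, .inr (.inr ⟨e, he, h⟩)⟩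

theorem prefix_iff_eq_or_append {p s : List ℕ} : p <+: s ↔ s = p ∨ ∃ e, p ++ [e] <+: s := by
  constructor
  · rintro ⟨t, rfl⟩
    cases t with
    | nil => simp
    | cons e t => exact .inr ⟨e, t, by simp⟩
  · rintro (rfl | ⟨e, h⟩)
    · exact List.prefix_rfl
    · exact (List.prefix_append _ _).trans h

theorem append_singleton_prefix_unique {p s : List ℕ} {d e : ℕ} (h₁ : p ++ [d] <+: s)
    (h₂ : p ++ [e] <+: s) : d = e := by
  have := List.prefix_of_prefix_length_le h₁ h₂ (by simp)
  simpa using this.eq_of_length (by simp)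

/-! ### The suffixes of the text -/

/-- The nonempty suffixes of the text with its end marker, in the order of their positions. -/
def suffixes (T : List ℕ) : List (List ℕ) := (List.range' 1 (size T)).map (suffixFrom T)

theorem mem_suffixes {T s : List ℕ} : s ∈ suffixes T ↔ IsLeaf T s := by
  simp only [suffixes, List.mem_map, List.mem_range'_1, IsLeaf, suffixFrom, size]
  constructor
  · rintro ⟨k, hk, rfl⟩
    refine ⟨?_, List.drop_suffix _ _⟩
    rw [Ne, List.drop_eq_nil_iff, withEnd, List.length_append, List.length_singleton]
    omega
  · rintro ⟨hs, u, hu⟩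
    have hl := congrArg List.length hu
    have : s.length ≠ 0 := by simpa using hs
    simp only [withEnd, List.length_append, List.length_singleton] at hl
    exact ⟨u.length + 1, by omega, by simp [← hu]⟩

@[simp] theorem length_suffixes (T : List ℕ) : (suffixes T).length = size T := by
  simp [suffixes]

/-- The string `q` occurs in the text with its end marker. -/
abbrev Occurs (T q : List ℕ) : Prop := q <:+: withEnd T

theorem occurs_of_prefix {T q s : List ℕ} (hs : s ∈ suffixes T) (h : q <+: s) : Occurs T q :=
  h.isInfix.trans (mem_suffixes.1 hs).2.isInfix

theorem Occurs.exists_suffix {T q : List ℕ} (h : Occurs T q) : ∃ s ∈ suffixes T, q <+: s := by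
  obtain ⟨u, v, huv⟩ := h
  by_cases hqv : q ++ v = []
  · obtain ⟨rfl, -⟩ := List.append_eq_nil_iff.1 hqv
    exact ⟨withEnd T, mem_suffixes.2 ⟨by simp [withEnd], List.suffix_rfl⟩, List.nil_prefix⟩
  · exact ⟨q ++ v, mem_suffixes.2 ⟨hqv, u, by simpa using huv⟩, List.prefix_append _ _⟩

theorem zero_mem_of_mem_suffixes {T s : List ℕ} (hs : s ∈ suffixes T) : ∃ t, s = t ++ [0] := by
  obtain ⟨hne, u, hu⟩ := mem_suffixes.1 hs
  obtain ⟨t, a, rfl⟩ := List.eq_nil_or_concat'  s |>.resolve_left hne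
  refine ⟨t, ?_⟩
  rw [withEnd, ← List.append_assoc] at hu
  have := List.append_inj_right' hu rfl
  rw [this]

/-- In the text with its end marker nothing follows the character `0`. -/
theorem Occurs.zero_not_mem {T p : List ℕ} (hT : ∀ x ∈ T, 1 ≤ x) {a : ℕ}
    (h : Occurs T (p ++ [a])) : 0 ∉ p := by
  obtain ⟨u, v, huv⟩ := h
  intro h0
  have hlen : (u ++ p).length < (withEnd T).length := by
    rw [← huv]; simp
  have hpre : u ++ p <+: T := by
    have h₁ : u ++ p <+: T ++ [0] := ⟨[a] ++ v, by rw [← withEnd, ← huv]; simp⟩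
    exact List.prefix_of_prefix_length_le h₁ (List.prefix_append _ _)
      (by simp [withEnd] at hlen ⊢; omega)
  have := hT 0 (hpre.subset (by simp [h0]))
  omega

theorem Occurs.le_sigma {T p : List ℕ} {σ : ℕ} (hT : ∀ x ∈ T, x ≤ σ) (h : Occurs T p) {a : ℕ}
    (ha : a ∈ p) : a ≤ σ := by
  have := h.subset ha
  simp only [withEnd, List.mem_append, List.mem_singleton] at this
  rcases this with h | rfl
  · exact hT a h
  · exact Nat.zero_le _

theorem IsInternal.occurs {T p : List ℕ} (h : IsInternal T p) : Occurs T p := by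
  obtain ⟨a, b, -, ha, -⟩ := h
  exact (List.prefix_append _ _).isInfix.trans ha

/-- An occurrence of `cpa` contains one of `pa`. This makes every internal node reachable from the
root by prepending characters, through internal nodes only. -/
theorem IsInternal.of_cons {T p : List ℕ} {c : ℕ} (h : IsInternal T (c :: p)) :
    IsInternal T p := by
  obtain ⟨a, b, hab, ha, hb⟩ := h
  exact ⟨a, b, hab, (List.suffix_cons c (p ++ [a])).isInfix.trans ha,
    (List.suffix_cons c (p ++ [b])).isInfix.trans hb⟩

theorem IsInternal.of_suffix {T p q : List ℕ} (h : IsInternal T q) (hp : p <:+ q) :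
    IsInternal T p := by
  induction q with
  | nil => rwa [List.suffix_nil.1 hp]
  | cons c q ih =>
    rcases List.suffix_cons_iff.1 hp with rfl | hp
    · exact h
    · exact ih h.of_cons hp

/-! ### Bounds of intervals -/

/-- The bounds are counts of suffixes and do not mention the suffix array. They are defined for
every string; if `q` does not occur, then `hi T q + 1 = lo T q`. -/
def lo (T q : List ℕ) : ℕ := (suffixes T).countP (fun s => s < q) + 1

def hi (T q : List ℕ) : ℕ := (suffixes T).countP (fun s => s < q ∨ q <+: s)

def occ (T q : List ℕ) : ℕ := (suffixes T).countP (fun s => q <+: s)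

theorem hi_eq (T q : List ℕ) : hi T q + 1 = lo T q + occ T q := by
  have : hi T q = (suffixes T).countP (fun s => s < q) + occ T q :=
    countP_eq_add (fun _ _ => Iff.rfl) fun s _ h h' => not_lt_of_prefix h' h
  rw [this, lo]; omega

theorem hi_le_size (T q : List ℕ) : hi T q ≤ size T := by
  rw [← length_suffixes]; exact List.countP_le_length

theorem Occurs.occ_pos {T q : List ℕ} (h : Occurs T q) : 0 < occ T q := by
  obtain ⟨s, hs, hq⟩ := h.exists_suffix
  exact List.countP_pos_iff.2 ⟨s, hs, by simpa using hq⟩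

theorem Occurs.lo_le_hi {T q : List ℕ} (h : Occurs T q) : lo T q ≤ hi T q := by
  have := hi_eq T q
  have := h.occ_pos
  omega

theorem occ_le_size (T q : List ℕ) : occ T q ≤ size T := by
  rw [← length_suffixes]; exact List.countP_le_length

/-- The children of `p`: labels and bounds of intervals, in increasing order of the labels. -/
def kids (T : List ℕ) (σ : ℕ) (p : List ℕ) : List (ℕ × ℕ × ℕ) :=
  ((List.range (σ + 1)).filter fun d => Occurs T (p ++ [d])).map
    fun d => (d, lo T (p ++ [d]), hi T (p ++ [d]))

theorem mem_kids {T : List ℕ} {σ : ℕ} (hT : ∀ x ∈ T, x ≤ σ) {p : List ℕ} {d i j : ℕ} :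
    (d, i, j) ∈ kids T σ p ↔
      Occurs T (p ++ [d]) ∧ i = lo T (p ++ [d]) ∧ j = hi T (p ++ [d]) := by
  simp only [kids, List.mem_map, List.mem_filter, List.mem_range, decide_eq_true_eq,
    Prod.mk.injEq]
  constructor
  · rintro ⟨d', ⟨-, h⟩, rfl, rfl, rfl⟩
    exact ⟨h, rfl, rfl⟩
  · rintro ⟨h, rfl, rfl⟩
    exact ⟨d, ⟨Nat.lt_succ_of_le (h.le_sigma hT (by simp)), h⟩, rfl, rfl, rfl⟩

theorem map_fst_kids (T : List ℕ) (σ : ℕ) (p : List ℕ) :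
    (kids T σ p).map Prod.fst = (List.range (σ + 1)).filter fun d => Occurs T (p ++ [d]) := by
  simp [kids, Function.comp_def]

theorem kids_sorted (T : List ℕ) (σ : ℕ) (p : List ℕ) :
    ((kids T σ p).map Prod.fst).Pairwise (· < ·) := by
  rw [map_fst_kids]
  exact List.pairwise_lt_range.filter _

theorem length_kids_le (T : List ℕ) (σ : ℕ) (p : List ℕ) : (kids T σ p).length ≤ σ + 1 := by
  rw [kids, List.length_map]
  exact (List.length_filter_le _ _).trans (by simp)

/-- This is the form in which the program tests right-maximality. -/
theorem isInternal_iff_length_kids {T : List ℕ} {σ : ℕ} (hT : ∀ x ∈ T, x ≤ σ) {p : List ℕ} :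
    IsInternal T p ↔ 2 ≤ (kids T σ p).length := by
  have hnd : ((kids T σ p).map Prod.fst).Nodup := (kids_sorted T σ p).imp fun h => ne_of_lt h
  rw [← List.length_map (f := Prod.fst), ← List.toFinset_card_of_nodup hnd, ← Nat.lt_iff_add_one_le,
    Finset.one_lt_card]
  have : ∀ a, a ∈ ((kids T σ p).map Prod.fst).toFinset ↔ Occurs T (p ++ [a]) := by
    intro a
    rw [List.mem_toFinset, map_fst_kids, List.mem_filter, List.mem_range, decide_eq_true_eq]
    exact ⟨And.right, fun h => ⟨Nat.lt_succ_of_le (h.le_sigma hT (by simp)), h⟩⟩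
  simp only [this]
  constructor
  · rintro ⟨a, b, hab, ha, hb⟩; exact ⟨a, ha, b, hb, hab⟩
  · rintro ⟨a, ha, b, hb, hab⟩; exact ⟨a, b, hab, ha, hb⟩

/-- A node begins where its first child begins. -/
theorem lo_eq_of_first {T p : List ℕ} (hp : p ∉ suffixes T) {d : ℕ}
    (hd : ∀ e < d, ¬ Occurs T (p ++ [e])) : lo T (p ++ [d]) = lo T p := by
  simp only [lo, add_left_inj]
  refine countP_congr_prop fun s hs => ?_
  rw [lt_append_singleton_iff]
  constructor
  · rintro (h | rfl | ⟨e, he, h⟩)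
    · exact h
    -- If `p` were itself a suffix, it would precede all its extensions and shift the bound by one.
    · exact absurd hs hp
    · exact absurd (occurs_of_prefix hs h) (hd e he)
  · exact Or.inl

/-- A node ends where its last child ends. -/
theorem hi_eq_of_last {T p : List ℕ} (hp : p ∉ suffixes T) {d : ℕ}
    (hd : ∀ e, Occurs T (p ++ [e]) → e ≤ d) : hi T (p ++ [d]) = hi T p := by
  refine countP_congr_prop fun s hs => ?_
  rw [lt_append_singleton_iff, prefix_iff_eq_or_append (p := p)]
  constructor
  · rintro ((h | rfl | ⟨e, he, h⟩) | h)
    · exact .inl h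
    · exact .inr (.inl rfl)
    · exact .inr (.inr ⟨e, h⟩)
    · exact .inr (.inr ⟨d, h⟩)
  · rintro (h | rfl | ⟨e, h⟩)
    · exact .inl (.inl h)
    · exact absurd hs hp
    · rcases Nat.eq_or_lt_of_le (hd e (occurs_of_prefix hs h)) with rfl | he
      · exact .inr h
      · exact .inl (.inr (.inr ⟨e, he, h⟩))

/-- With `hi_last_kids`, this lets the program store only the children of a node and recover its
interval from them. -/
theorem lo_head_kids {T : List ℕ} {σ : ℕ} (hT : ∀ x ∈ T, x ≤ σ) {p : List ℕ} (hp : p ∉ suffixes T)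
    {t : ℕ × ℕ × ℕ} {L : List (ℕ × ℕ × ℕ)} (h : kids T σ p = t :: L) : t.2.1 = lo T p := by
  have ht := (mem_kids hT (i := t.2.1) (j := t.2.2) (d := t.1) (p := p)).1 (by rw [h]; simp)
  rw [ht.2.1]
  refine lo_eq_of_first hp fun e he hoc => ?_
  have hs := kids_sorted T σ p
  have hmem := (mem_kids hT).2 ⟨hoc, rfl, rfl⟩
  rw [h] at hs hmem
  rcases List.mem_cons.1 hmem with rfl | hmem
  · exact lt_irrefl _ he
  · have := (List.pairwise_cons.1 hs).1 e (List.mem_map.2 ⟨_, hmem, rfl⟩)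
    omega

theorem hi_last_kids {T : List ℕ} {σ : ℕ} (hT : ∀ x ∈ T, x ≤ σ) {p : List ℕ} (hp : p ∉ suffixes T)
    {t : ℕ × ℕ × ℕ} {L : List (ℕ × ℕ × ℕ)} (h : kids T σ p = L ++ [t]) : t.2.2 = hi T p := by
  have ht := (mem_kids hT (i := t.2.1) (j := t.2.2) (d := t.1) (p := p)).1 (by rw [h]; simp)
  rw [ht.2.2]
  refine hi_eq_of_last hp fun e hoc => ?_
  have hs := kids_sorted T σ p
  have hmem := (mem_kids hT).2 ⟨hoc, rfl, rfl⟩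
  rw [h] at hs hmem
  rcases List.mem_append.1 hmem with hmem | hmem
  · rw [List.map_append, List.pairwise_append] at hs
    exact (hs.2.2 e (List.mem_map.2 ⟨_, hmem, rfl⟩) t.1 (by simp)).le
  · rw [← List.mem_singleton.1 hmem]

/-! ### Ranks in the suffix array -/

theorem suffixArray_perm (T : List ℕ) : (suffixArray T).Perm (List.range' 1 (size T)) :=
  List.mergeSort_perm _ _

@[simp] theorem length_suffixArray (T : List ℕ) : (suffixArray T).length = size T := by
  simpa using (suffixArray_perm T).length_eq

theorem suffixArray_sorted (T : List ℕ) :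
    (suffixArray T).Pairwise fun a b => suffixFrom T a ≤ suffixFrom T b := by
  have := List.pairwise_mergeSort (le := fun a b => decide (suffixFrom T a ≤ suffixFrom T b))
    (by simpa using fun a b c h₁ h₂ => le_trans h₁ h₂) (by simpa using fun a b => le_total _ _)
    (List.range' 1 (size T))
  simpa [suffixArray] using this

theorem countP_suffixArray (T : List ℕ) (P : List ℕ → Prop) [DecidablePred P] :
    (suffixArray T).countP (fun k => P (suffixFrom T k)) = (suffixes T).countP (P ·) := by
  rw [suffixes, List.countP_map, (suffixArray_perm T).countP_eq]
  rfl

theorem suffixFrom_entry_mem {T : List ℕ} {r : ℕ} (h₁ : 1 ≤ r) (h₂ : r ≤ size T) :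
    suffixFrom T (entry (suffixArray T) r) ∈ suffixes T := by
  have hr : r - 1 < (suffixArray T).length := by simp; omega
  refine List.mem_map.2 ⟨_, (suffixArray_perm T).mem_iff.1 ?_, rfl⟩
  rw [entry, List.getD_eq_getElem _ _ hr]
  exact List.getElem_mem hr

section Sorted

variable {α : Type*} {R : α → α → Prop} {P : α → Prop} [DecidablePred P]

theorem countP_eq_zero_of_head {a : α} {l : List α} (hl : (a :: l).Pairwise R)
    (hP : ∀ a b, R a b → P b → P a) (ha : ¬ P a) : (a :: l).countP (P ·) = 0 := by
  rw [List.countP_eq_zero]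
  intro b hb
  rcases List.mem_cons.1 hb with rfl | hb
  · simpa using ha
  · simpa using fun h => ha (hP a b ((List.pairwise_cons.1 hl).1 b hb) h)

/-- In a sorted list, the members with a property that is closed downwards come first. -/
theorem getElem_iff_lt_countP {l : List α} (hl : l.Pairwise R) (hP : ∀ a b, R a b → P b → P a)
    {i : ℕ} (hi : i < l.length) : P l[i] ↔ i < l.countP (P ·) := by
  induction l generalizing i with
  | nil => simp at hi
  | cons a l ih =>
    by_cases ha : P a
    · cases i with
      | zero => simp [ha]
      | succ i => simpa [List.countP_cons, ha] using ih hl.of_cons (by simpa using hi)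
    · rw [countP_eq_zero_of_head hl hP ha]
      refine iff_of_false ?_ (by omega)
      have := List.countP_eq_zero.1 (countP_eq_zero_of_head hl hP ha) _ (List.getElem_mem hi)
      simpa using this

/-- The prefix of that length consists exactly of the members with `P`. It turns a rank in the
transform, which counts in a prefix, into a count over all positions. -/
theorem countP_take_countP {l : List α} (hl : l.Pairwise R) (hP : ∀ a b, R a b → P b → P a)
    (Q : α → Prop) [DecidablePred Q] :
    (l.take (l.countP (P ·))).countP (Q ·) = l.countP (fun a => Q a ∧ P a) := by
  induction l with
  | nil => rfl
  | cons a l ih =>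
    by_cases ha : P a
    · have := ih hl.of_cons
      simp only [List.countP_cons, ha, decide_true, if_true, List.take_succ_cons, this, and_true]
    · have h0 := countP_eq_zero_of_head hl hP ha
      rw [h0, List.take_zero, List.countP_nil, eq_comm, List.countP_eq_zero]
      intro b hb
      have := List.countP_eq_zero.1 h0 b hb
      simp at this ⊢
      exact fun _ => this

end Sorted

theorem down_lt {T q : List ℕ} : ∀ a b, suffixFrom T a ≤ suffixFrom T b → suffixFrom T b < q →
    suffixFrom T a < q := fun _ _ => lt_of_le_of_lt

theorem down_lt_or_prefix {T q : List ℕ} : ∀ a b, suffixFrom T a ≤ suffixFrom T b →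
    (suffixFrom T b < q ∨ q <+: suffixFrom T b) → suffixFrom T a < q ∨ q <+: suffixFrom T a := by
  rintro a b hab (h | ⟨x, hx⟩)
  · exact .inl (hab.trans_lt h)
  · rcases lt_or_ge (suffixFrom T a) q with h | h
    · exact .inl h
    · exact .inr (prefix_of_le_of_le h (hx ▸ hab))

/-- Being below `q`, and being below or prefixed by `q`, are both closed downwards along the suffix
array. So each holds on an initial segment of ranks, whose length is the count. -/
theorem isInterval_lo_hi {T q : List ℕ} (hq : Occurs T q) : IsInterval T q (lo T q) (hi T q) := by
  refine ⟨by simp [lo], hq.lo_le_hi, hi_le_size T q, fun r h₁ h₂ => ?_⟩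
  have hr : r - 1 < (suffixArray T).length := by simp; omega
  have e₁ := getElem_iff_lt_countP (suffixArray_sorted T) (down_lt (q := q)) hr
  have e₂ := getElem_iff_lt_countP (suffixArray_sorted T) (down_lt_or_prefix (q := q)) hr
  rw [countP_suffixArray T (fun s => s < q)] at e₁
  rw [countP_suffixArray T (fun s => s < q ∨ q <+: s)] at e₂
  rw [entry, List.getD_eq_getElem _ _ hr, lo, hi]
  have h3 : r - 1 < (suffixes T).countP (fun s => s < q ∨ q <+: s) ↔
      r ≤ (suffixes T).countP (fun s => s < q ∨ q <+: s) := by omega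
  rw [← h3, ← e₂]
  constructor
  · rintro ⟨h, h' | h'⟩
    · have := e₁.1 h'; omega
    · exact h'
  · intro h
    refine ⟨?_, .inr h⟩
    have := mt e₁.2 (not_lt_of_prefix h)
    omega

/-- It allows an edge to be cut down to its first character without changing the interval. -/
theorem IsInterval.congr {T p q : List ℕ} {i j : ℕ}
    (h : ∀ s ∈ suffixes T, p <+: s ↔ q <+: s) : IsInterval T p i j ↔ IsInterval T q i j := by
  simp only [IsInterval]
  refine and_congr_right fun _ => and_congr_right fun _ => and_congr_right fun _ =>
    forall_congr' fun r => forall_congr' fun h₁ => forall_congr' fun h₂ => ?_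
  rw [h _ (suffixFrom_entry_mem h₁ h₂)]

theorem IsInterval.unique {T q : List ℕ} {i j i' j' : ℕ} (h : IsInterval T q i j)
    (h' : IsInterval T q i' j') : i = i' ∧ j = j' := by
  obtain ⟨a, b, c, d⟩ := h
  obtain ⟨a', b', c', d'⟩ := h'
  have key : ∀ r, 1 ≤ r → r ≤ size T → ((i ≤ r ∧ r ≤ j) ↔ (i' ≤ r ∧ r ≤ j')) :=
    fun r h₁ h₂ => (d r h₁ h₂).trans (d' r h₁ h₂).symm
  have k₁ := key i (by omega) (by omega)
  have k₂ := key j (by omega) (by omega)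
  have k₃ := key i' (by omega) (by omega)
  have k₄ := key j' (by omega) (by omega)
  omega

/-! ### Children in the suffix tree -/

/-- A string strictly inside the edge is not a node. Being no leaf, it is not the whole suffix `s`;
not being right-maximal, it has only one continuation. So `s` is forced along the edge, character by
character. -/
theorem prefix_iff_of_isChild {T p q : List ℕ} {c : ℕ} (h : IsChild T p (p ++ c :: q)) :
    ∀ s ∈ suffixes T, p ++ c :: q <+: s ↔ p ++ [c] <+: s := by
  intro s hs
  have hpre : p ++ [c] <+: p ++ c :: q := ⟨q, by simp⟩
  refine ⟨fun h' => hpre.trans h', fun h' => ?_⟩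
  have hocc : Occurs T (p ++ c :: q) := by
    rcases h.1 with h | h
    · exact h.occurs
    · exact h.2.isInfix
  suffices H : ∀ m ≤ q.length, p ++ c :: q.take m <+: s by simpa using H q.length le_rfl
  intro m
  induction m with
  | zero => intro _; simpa using h'
  | succ m ih =>
    intro hm
    have ih := ih (by omega)
    have hz : ¬ IsNode T (p ++ c :: q.take m) := by
      intro hn
      have hlen := congrArg List.length (h.2.2.2 _ hn (List.prefix_append _ _) (by simp)
        ⟨q.drop m, by simp⟩)
      simp at hlen
      omega
    have htake : q.take (m + 1) = q.take m ++ [q[m]] := by simp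
    have e : p ++ c :: q.take (m + 1) = (p ++ c :: q.take m) ++ [q[m]] := by rw [htake]; simp
    rcases prefix_iff_eq_or_append.1 ih with rfl | ⟨a, ha⟩
    · exact absurd (.inr (mem_suffixes.1 hs)) hz
    · rw [e]
      by_cases haq : a = q[m]
      · rwa [← haq]
      · refine absurd (.inl ⟨a, q[m], haq, occurs_of_prefix hs ha, ?_⟩) hz
        rw [← e]
        exact List.IsInfix.trans (List.IsPrefix.isInfix
          ⟨q.drop (m + 1), by simp⟩) hocc

/-- The child is the shortest node that extends `p ++ [c]`; there is one, because a suffix with this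
prefix is a leaf. -/
theorem exists_isChild {T p : List ℕ} {c : ℕ} (h : Occurs T (p ++ [c])) :
    ∃ q, IsChild T p (p ++ c :: q) := by
  classical
  have hex : ∃ m, ∃ q : List ℕ, q.length = m ∧ IsNode T (p ++ c :: q) := by
    obtain ⟨s, hs, t, ht⟩ := h.exists_suffix
    refine ⟨t.length, t, rfl, .inr ?_⟩
    rw [← mem_suffixes]
    simpa [← ht] using hs
  obtain ⟨q, hq, hn⟩ := Nat.find_spec hex
  refine ⟨q, hn, List.prefix_append _ _, by simp, ?_⟩
  rintro z hz ⟨t, rfl⟩ hne hzy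
  cases t with
  | nil => simp at hne
  | cons e t =>
    have hzy' := (List.prefix_append_right_inj p).1 hzy
    obtain ⟨rfl, ht⟩ := List.cons_prefix_cons.1 hzy'
    have hmin := Nat.find_min' hex ⟨t, rfl, hz⟩
    rw [← hq] at hmin
    rw [ht.eq_of_length (le_antisymm ht.length_le hmin)]

theorem isChildEntry_iff {T p : List ℕ} {σ : ℕ} (hT : ∀ x ∈ T, x ≤ σ) {c i j : ℕ} :
    IsChildEntry T p c i j ↔ (c, i, j) ∈ kids T σ p := by
  rw [mem_kids hT]
  constructor
  · rintro ⟨q, hc, hi⟩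
    have hocc : Occurs T (p ++ [c]) := by
      have hpre : p ++ [c] <+: p ++ c :: q := ⟨q, by simp⟩
      rcases hc.1 with h | h
      · exact hpre.isInfix.trans h.occurs
      · exact hpre.isInfix.trans h.2.isInfix
    have := ((IsInterval.congr (prefix_iff_of_isChild hc)).1 hi).unique (isInterval_lo_hi hocc)
    exact ⟨hocc, this⟩
  · rintro ⟨hocc, rfl, rfl⟩
    obtain ⟨q, hq⟩ := exists_isChild hocc
    exact ⟨q, hq, (IsInterval.congr (prefix_iff_of_isChild hq)).2 (isInterval_lo_hi hocc)⟩

/-! ### The transform -/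

/-- The character before position `k`. -/
def charBefore (T : List ℕ) (k : ℕ) : ℕ := if 1 < k then entry (withEnd T) (k - 1) else 0

theorem bwt_eq (T : List ℕ) : bwt T = (suffixArray T).map (charBefore T) := rfl

@[simp] theorem length_bwt (T : List ℕ) : (bwt T).length = size T := by simp [bwt_eq]

theorem length_withEnd (T : List ℕ) : (withEnd T).length = size T := by simp [withEnd, size]

theorem map_charBefore (T : List ℕ) : (List.range' 1 (size T)).map (charBefore T) = 0 :: T := by
  apply List.ext_getElem
  · simp [size]
  · intro i h₁ h₂
    simp only [List.getElem_map, List.getElem_range', charBefore, entry]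
    cases i with
    | zero => simp
    | succ i =>
      have : i < T.length := by simpa using h₂
      have h3 : i < (withEnd T).length := by simp [withEnd]; omega
      rw [if_pos (by omega), show 1 + 1 * (i + 1) - 1 - 1 = i by omega,
        List.getD_eq_getElem _ _ h3]
      simp [withEnd, this]

theorem bwt_perm (T : List ℕ) : (bwt T).Perm (withEnd T) := by
  rw [bwt_eq]
  refine ((suffixArray_perm T).map _).trans ?_
  rw [map_charBefore, withEnd]
  exact (List.perm_append_comm (l₁ := T) (l₂ := [0])).symm

/-- The number of characters (with the end marker) that are smaller than `c`. -/
def smaller (T : List ℕ) (c : ℕ) : ℕ := (withEnd T).countP (fun x => x < c)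

theorem map_head_suffixes (T : List ℕ) : (suffixes T).map (·.headD 0) = withEnd T := by
  apply List.ext_getElem
  · simp [length_withEnd]
  · intro i h₁ h₂
    simp only [List.getElem_map, suffixes, List.getElem_range', suffixFrom]
    rw [show 1 + 1 * i - 1 = i by omega, List.drop_eq_getElem_cons h₂]
    rfl

theorem smaller_eq (T : List ℕ) (c : ℕ) :
    smaller T c = (suffixes T).countP (fun s => s.headD 0 < c) := by
  rw [smaller, ← map_head_suffixes, List.countP_map]
  rfl

theorem smaller_succ (T : List ℕ) (c : ℕ) :
    smaller T (c + 1) = smaller T c + (bwt T).count c := by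
  rw [(bwt_perm T).count_eq, smaller, List.count]
  have := countP_eq_add (l := withEnd T) (R := fun x => x < c + 1) (P := fun x => x < c)
    (Q := fun x => x = c) (fun x _ => by omega) (fun x _ => by omega)
  rw [this, smaller]
  congr 1

theorem lo_singleton (T : List ℕ) (c : ℕ) : lo T [c] = smaller T c + 1 := by
  rw [lo, smaller_eq]
  congr 1
  refine countP_congr_prop fun s hs => ?_
  have hne := (mem_suffixes.1 hs).1
  cases s with
  | nil => simp at hne
  | cons b s => simp [List.cons_lt_cons_iff]

theorem hi_singleton (T : List ℕ) (c : ℕ) : hi T [c] = smaller T (c + 1) := by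
  rw [hi, smaller_eq]
  refine countP_congr_prop fun s hs => ?_
  have hne := (mem_suffixes.1 hs).1
  cases s with
  | nil => simp at hne
  | cons b s => simp [List.cons_lt_cons_iff, List.cons_prefix_cons]; omega

theorem cons_suffixFrom {T : List ℕ} {k : ℕ} (h : k < size T) (hk : 1 ≤ k) :
    suffixFrom T k = charBefore T (k + 1) :: suffixFrom T (k + 1) := by
  have h' : k - 1 < (withEnd T).length := by rw [length_withEnd]; omega
  rw [suffixFrom, suffixFrom, charBefore, if_pos (by omega), entry, Nat.add_sub_cancel,
    List.drop_eq_getElem_cons h', List.getD_eq_getElem _ _ h', Nat.sub_add_cancel hk]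

/-- The suffixes that start with `c` correspond to the positions preceded by `c`. -/
theorem countP_suffixes_cons (T : List ℕ) {c : ℕ} (hc : 1 ≤ c) (P : List ℕ → Prop)
    [DecidablePred P] :
    (suffixes T).countP (fun s => s.headD 0 = c ∧ P s.tail) =
      (List.range' 1 (size T)).countP (fun k => charBefore T k = c ∧ P (suffixFrom T k)) := by
  rw [suffixes, List.countP_map]
  -- The suffix at `k` is matched with the position `k + 1`. Left over are the suffix `[0]` and the
  -- position `1`, whose preceding character is set to `0`; neither counts for `c ≥ 1`.
  have e₁ : List.range' 1 (size T) = List.range' 1 T.length ++ [size T] := by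
    rw [size, List.range'_concat]; simp [Nat.add_comm]
  have e₂ : List.range' 1 (size T) = 1 :: (List.range' 1 T.length).map (· + 1) := by
    have h : (fun k => k + 1) = fun k => 1 + k := funext fun k => Nat.add_comm k 1
    rw [size, List.range'_succ, h, List.map_add_range']
  conv_lhs => rw [e₁]
  conv_rhs => rw [e₂]
  have hlast : suffixFrom T (size T) = [0] := by simp [suffixFrom, size, withEnd]
  rw [List.countP_append, List.countP_cons, List.countP_cons, List.countP_map]
  have h1 : charBefore T 1 = 0 := rfl
  have hc' : ¬ 0 = c := by omega
  simp only [List.countP_nil, Function.comp_apply, hlast, h1, hc',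
    List.headD_cons, false_and, decide_false, add_zero, Bool.false_eq_true, if_false]
  refine List.countP_congr fun k hk => ?_
  rw [List.mem_range'_1] at hk
  have hlt : k < size T := by unfold size; omega
  simp [cons_suffixFrom hlt hk.1]

theorem rank_eq (T : List ℕ) (c m : ℕ) :
    rank (bwt T) c m = ((suffixArray T).take m).countP (fun k => charBefore T k = c) := by
  rw [rank, bwt_eq, ← List.map_take, List.count, List.countP_map]
  rfl

/-- Backward search: a suffix below `c :: q` starts with a smaller character, or it starts with `c`
and goes on with a suffix below `q`. The latter correspond to the occurrences of `c` in the
transform before the interval of `q`. -/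
theorem lo_cons {T : List ℕ} {c : ℕ} (hc : 1 ≤ c) (q : List ℕ) :
    lo T (c :: q) = smaller T c + rank (bwt T) c (lo T q - 1) + 1 := by
  have e : lo T q - 1 = (suffixArray T).countP (fun k => suffixFrom T k < q) := by
    rw [countP_suffixArray T (fun s => s < q)]; rfl
  rw [rank_eq, e, countP_take_countP (suffixArray_sorted T) down_lt (charBefore T · = c),
    (suffixArray_perm T).countP_eq, ← countP_suffixes_cons T hc (fun s => s < q), smaller_eq, lo,
    ← countP_eq_add (R := fun s => s < c :: q)]
  · intro s hs
    have hne := (mem_suffixes.1 hs).1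
    cases s with
    | nil => simp at hne
    | cons b s => simp [List.cons_lt_cons_iff]
  · intro s _ h₁ h₂
    omega

theorem hi_cons {T : List ℕ} {c : ℕ} (hc : 1 ≤ c) (q : List ℕ) :
    hi T (c :: q) = smaller T c + rank (bwt T) c (hi T q) := by
  have e : hi T q =
      (suffixArray T).countP (fun k => suffixFrom T k < q ∨ q <+: suffixFrom T k) := by
    rw [countP_suffixArray T (fun s => s < q ∨ q <+: s)]; rfl
  rw [rank_eq, e, countP_take_countP (suffixArray_sorted T) down_lt_or_prefix
    (charBefore T · = c), (suffixArray_perm T).countP_eq,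
    ← countP_suffixes_cons T hc (fun s => s < q ∨ q <+: s), smaller_eq, hi,
    ← countP_eq_add (R := fun s => s < c :: q ∨ c :: q <+: s)]
  · intro s hs
    have hne := (mem_suffixes.1 hs).1
    cases s with
    | nil => simp at hne
    | cons b s =>
      simp only [List.cons_lt_cons_iff, List.cons_prefix_cons, List.headD_cons, List.tail_cons]
      constructor
      · rintro ((h | h) | ⟨rfl, h⟩)
        · exact .inl h
        · exact .inr ⟨h.1, .inl h.2⟩
        · exact .inr ⟨rfl, .inr h⟩
      · rintro (h | ⟨rfl, h | h⟩)
        · exact .inl (.inl h)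
        · exact .inl (.inr ⟨rfl, h⟩)
        · exact .inr ⟨rfl, h⟩
  · intro s _ h₁ h₂
    omega

/-! ### Answers to queries -/

theorem rank_succ {B : List ℕ} (c : ℕ) {m : ℕ} (hm : m < B.length) :
    rank B c (m + 1) = rank B c m + if entry B (m + 1) = c then 1 else 0 := by
  rw [rank, rank, List.take_succ_eq_append_getElem hm, List.count_append, List.count_singleton,
    entry, Nat.add_sub_cancel, List.getD_eq_getElem _ _ hm]
  simp

theorem rank_mono {B : List ℕ} (c : ℕ) {l m : ℕ} (h : l ≤ m) : rank B c l ≤ rank B c m :=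
  (List.take_sublist_take_left h).count_le c

theorem rank_eq_of_forall_ne {B : List ℕ} {c l m : ℕ} (hlm : l ≤ m) (hm : m ≤ B.length)
    (h : ∀ k, l < k → k ≤ m → entry B k ≠ c) : rank B c m = rank B c l := by
  induction m, hlm using Nat.le_induction with
  | base => rfl
  | succ m hlm ih =>
    rw [rank_succ c (by omega), if_neg (h _ (by omega) le_rfl),
      ih (by omega) fun k h₁ h₂ => h k h₁ (by omega)]
    rfl

/-- There is no `c` in `B[i..l-1]`. With the counterpart for the right end, an answer determines the
ranks at `i - 1` and `j`, which backward search needs. -/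
theorem IsLeftmost.rank_eq {B : List ℕ} {c i j l : ℕ} (hi : 1 ≤ i) (hj : j ≤ B.length)
    (h : IsLeftmost B c i j l) : rank B c l = rank B c (i - 1) + 1 := by
  obtain ⟨h₁, h₂, h₃, h₄⟩ := h
  obtain ⟨l, rfl⟩ : ∃ m, l = m + 1 := ⟨l - 1, by omega⟩
  rw [rank_succ c (by omega), if_pos h₃, rank_eq_of_forall_ne (l := i - 1) (by omega) (by omega)]
  intro k hk hk' he
  have := h₄ k (by omega) (by omega) he
  omega

theorem IsRightmost.rank_eq {B : List ℕ} {c i j r : ℕ} (hj : j ≤ B.length)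
    (h : IsRightmost B c i j r) : rank B c r = rank B c j := by
  obtain ⟨h₁, h₂, h₃, h₄⟩ := h
  refine (rank_eq_of_forall_ne h₂ hj ?_).symm
  intro k hk hk' he
  have := h₄ k (by omega) (by omega) he
  omega

theorem exists_leftmost_rightmost {B : List ℕ} {c i j : ℕ}
    (h : ∃ k, i ≤ k ∧ k ≤ j ∧ entry B k = c) :
    ∃ l r, IsLeftmost B c i j l ∧ IsRightmost B c i j r := by
  obtain ⟨k, hk⟩ := h
  set S := (Finset.Icc i j).filter fun k => entry B k = c
  have hS : ∀ m, m ∈ S ↔ (i ≤ m ∧ m ≤ j) ∧ entry B m = c := by simp [S]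
  have hne : S.Nonempty := ⟨k, (hS k).2 ⟨⟨hk.1, hk.2.1⟩, hk.2.2⟩⟩
  have h₁ := (hS _).1 (S.min'_mem hne)
  have h₂ := (hS _).1 (S.max'_mem hne)
  exact ⟨S.min' hne, S.max' hne,
    ⟨h₁.1.1, h₁.1.2, h₁.2, fun m a b e => S.min'_le _ ((hS m).2 ⟨⟨a, b⟩, e⟩)⟩,
    ⟨h₂.1.1, h₂.1.2, h₂.2, fun m a b e => S.le_max' _ ((hS m).2 ⟨⟨a, b⟩, e⟩)⟩⟩

theorem exists_entry_iff {B : List ℕ} {c i j : ℕ} (hi : 1 ≤ i) (hij : i ≤ j) (hj : j ≤ B.length) :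
    (∃ k, i ≤ k ∧ k ≤ j ∧ entry B k = c) ↔ rank B c (i - 1) < rank B c j := by
  constructor
  · intro h
    obtain ⟨l, r, hl, -⟩ := exists_leftmost_rightmost h
    have := hl.rank_eq hi hj
    have := rank_mono (B := B) c hl.2.1
    omega
  · intro h
    by_contra! hne
    have := rank_eq_of_forall_ne (B := B) (c := c) (l := i - 1) (m := j) (by omega) hj
      fun k h₁ h₂ => hne k (by omega) h₂
    omega

section Reporter

variable {T : List ℕ} {σ : ℕ} {report : ℕ → ℕ → List (ℕ × ℕ × ℕ)}

theorem IsRangeReporter.mem_iff (hR : IsRangeReporter (bwt T) report) {i j : ℕ} (hi : 1 ≤ i)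
    (hij : i ≤ j) (hj : j ≤ size T) {c a b : ℕ} :
    (c, a, b) ∈ report i j ↔ rank (bwt T) c (i - 1) < rank (bwt T) c j ∧
      a = rank (bwt T) c (i - 1) + 1 ∧ b = rank (bwt T) c j := by
  have hj' : j ≤ (bwt T).length := by simpa using hj
  rw [(hR i j hi hij hj').2 c a b, ← exists_entry_iff hi hij hj']
  constructor
  · rintro ⟨l, r, hl, hr, rfl, rfl⟩
    exact ⟨⟨l, hl.1, hl.2.1, hl.2.2.1⟩, hl.rank_eq hi hj', hr.rank_eq hj'⟩
  · rintro ⟨h, rfl, rfl⟩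
    obtain ⟨l, r, hl, hr⟩ := exists_leftmost_rightmost h
    exact ⟨l, r, hl, hr, (hl.rank_eq hi hj').symm, (hr.rank_eq hj').symm⟩

theorem IsRangeReporter.nodup (hR : IsRangeReporter (bwt T) report) {i j : ℕ} (hi : 1 ≤ i)
    (hij : i ≤ j) (hj : j ≤ size T) : ((report i j).map Prod.fst).Nodup :=
  (hR i j hi hij (by simpa using hj)).1

theorem occurs_cons_iff {q : List ℕ} {c : ℕ} (hc : 1 ≤ c) :
    Occurs T (c :: q) ↔ rank (bwt T) c (lo T q - 1) < rank (bwt T) c (hi T q) := by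
  have h₁ := lo_cons (T := T) hc q
  have h₂ := hi_cons (T := T) hc q
  constructor
  · intro h
    have := h.lo_le_hi
    omega
  · intro h
    have h₃ := hi_eq T (c :: q)
    have h₄ : 0 < occ T (c :: q) := by omega
    obtain ⟨s, hs, hp⟩ := List.countP_pos_iff.1 h₄
    exact occurs_of_prefix hs (by simpa using hp)

/-- One query is a backward search step for all the characters at once. The character `0` of the
transform only records that nothing precedes position `1`, so it yields no left extension. -/
theorem IsRangeReporter.mem_iff_of_pos (hR : IsRangeReporter (bwt T) report) {q : List ℕ}
    (hq : Occurs T q) {c a b : ℕ} (hc : 1 ≤ c) :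
    (c, a, b) ∈ report (lo T q) (hi T q) ↔ Occurs T (c :: q) ∧
      smaller T c + a = lo T (c :: q) ∧ smaller T c + b = hi T (c :: q) := by
  rw [hR.mem_iff (by simp [lo]) hq.lo_le_hi (hi_le_size T q), occurs_cons_iff hc, lo_cons hc,
    hi_cons hc]
  refine and_congr_right fun _ => ?_
  omega

theorem IsRangeReporter.le_sigma (hT : ∀ x ∈ T, x ≤ σ) (hR : IsRangeReporter (bwt T) report)
    {i j : ℕ} (hi : 1 ≤ i) (hij : i ≤ j) (hj : j ≤ size T) {t : ℕ × ℕ × ℕ} (ht : t ∈ report i j) :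
    t.1 ≤ σ := by
  have h := ((hR.mem_iff hi hij hj (c := t.1) (a := t.2.1) (b := t.2.2)).1 ht).1
  have : 0 < rank (bwt T) t.1 j := by omega
  have hm : t.1 ∈ withEnd T := (bwt_perm T).mem_iff.1
    (List.mem_of_mem_take (List.count_pos_iff.1 this))
  rcases List.mem_append.1 hm with hm | hm
  · exact hT _ hm
  · rw [List.mem_singleton.1 hm]; exact Nat.zero_le _

theorem IsRangeReporter.length_le (hT : ∀ x ∈ T, x ≤ σ) (hR : IsRangeReporter (bwt T) report)
    {i j : ℕ} (hi : 1 ≤ i) (hij : i ≤ j) (hj : j ≤ size T) : (report i j).length ≤ σ + 1 := by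
  have h : ((report i j).map Prod.fst).toFinset ⊆ Finset.range (σ + 1) := by
    intro c hc
    obtain ⟨t, ht, rfl⟩ := List.mem_map.1 (List.mem_toFinset.1 hc)
    exact Finset.mem_range.2 (Nat.lt_succ_of_le (hR.le_sigma hT hi hij hj ht))
  simpa [List.toFinset_card_of_nodup (hR.nodup hi hij hj)] using Finset.card_le_card h

theorem IsRangeReporter.mem_root (hR : IsRangeReporter (bwt T) report) {c a b : ℕ} :
    (c, a, b) ∈ report 1 (size T) ↔
      0 < (bwt T).count c ∧ a = 1 ∧ b = (bwt T).count c := by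
  have h0 : rank (bwt T) c 0 = 0 := by simp [rank]
  have h1 : rank (bwt T) c (size T) = (bwt T).count c := by
    rw [rank, List.take_of_length_le (by simp)]
  rw [hR.mem_iff le_rfl (by simp [size]) le_rfl, Nat.sub_self, h0, h1]

end Reporter

theorem occurs_singleton_iff {T : List ℕ} {c : ℕ} : Occurs T [c] ↔ 0 < (bwt T).count c := by
  rw [List.count_pos_iff, (bwt_perm T).mem_iff]
  exact List.singleton_infix_iff c (withEnd T)

/-! ### The total work -/

/-- A suffix with prefix `q` cannot be below `q'`, as it would then count for `lo T q'` but not for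
`lo T q`. So `q'` lies between `q` and an extension of `q`. -/
theorem prefix_of_lo_eq {T q q' : List ℕ} (hq : Occurs T q) (hle : q ≤ q')
    (h : lo T q = lo T q') : q <+: q' := by
  obtain ⟨s, hs, x, hx⟩ := hq.exists_suffix
  by_cases hsq : s < q'
  · have := countP_lt_of_imp (P := (· < q)) (Q := (· < q')) (fun s _ hs => lt_of_lt_of_le hs hle)
      hs (not_lt_of_prefix ⟨x, hx⟩) hsq
    simp only [lo] at h
    omega
  · exact prefix_of_le_of_le hle (hx ▸ not_lt.1 hsq)

/-- If `p ++ [d]` were a prefix of `p'`, the suffixes under the smaller sibling `p' ++ [e']` would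
separate the two lower bounds. Hence children that are not first children have distinct lower
bounds. -/
theorem eq_of_lo_eq_of_le {T p p' : List ℕ} {d d' e' : ℕ} (h : Occurs T (p ++ [d]))
    (he' : e' < d') (h' : Occurs T (p' ++ [e'])) (hlo : lo T (p ++ [d]) = lo T (p' ++ [d']))
    (hle : p ++ [d] ≤ p' ++ [d']) : p ++ [d] = p' ++ [d'] := by
  rcases List.prefix_concat_iff.1 (prefix_of_lo_eq h hle hlo) with heq | hpre
  · exact heq
  · obtain ⟨s, hs, hp⟩ := h'.exists_suffix
    have hp' : p ++ [d] <+: s := hpre.trans ((List.prefix_append _ _).trans hp)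
    have := countP_lt_of_imp (P := (· < p ++ [d])) (Q := (· < p' ++ [d']))
      (fun s _ hs => lt_of_lt_of_le hs hle) hs (not_lt_of_prefix hp')
      (lt_append_singleton_iff.2 (.inr (.inr ⟨e', he', hp⟩)))
    simp only [lo] at hlo
    omega

theorem length_kids (T : List ℕ) (σ : ℕ) (p : List ℕ) : (kids T σ p).length =
    ((Finset.range (σ + 1)).filter fun d => Occurs T (p ++ [d])).card := by
  rw [kids, List.length_map, ← List.toFinset_card_of_nodup (List.nodup_range.filter _),
    List.toFinset_filter, List.toFinset_range]
  simp

/-- The branching of the suffix tree is at most the number of its leaves. -/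
theorem sum_length_kids_sub_one_le (T : List ℕ) (σ : ℕ) (S : Finset (List ℕ)) :
    ∑ p ∈ S, ((kids T σ p).length - 1) ≤ size T := by
  classical
  -- The labels of all the children of `p` but the first; the lower bound of the interval will be
  -- injective on them.
  set U : List ℕ → Finset ℕ := fun p => (Finset.range (σ + 1)).filter fun d =>
    Occurs T (p ++ [d]) ∧ ∃ e < d, Occurs T (p ++ [e]) with hU
  have h₁ : ∀ p, (kids T σ p).length - 1 ≤ (U p).card := by
    intro p
    rw [length_kids]
    set V := (Finset.range (σ + 1)).filter fun d => Occurs T (p ++ [d]) with hV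
    rcases V.eq_empty_or_nonempty with he | hne
    · simp [he]
    · have : V ⊆ insert (V.min' hne) (U p) := by
        intro d hd
        rw [Finset.mem_insert]
        by_cases hdm : d = V.min' hne
        · exact .inl hdm
        · have hd' := Finset.mem_filter.1 hd
          exact .inr (Finset.mem_filter.2 ⟨hd'.1, hd'.2, V.min' hne,
            lt_of_le_of_ne (V.min'_le _ hd) (Ne.symm hdm),
            (Finset.mem_filter.1 (V.min'_mem hne)).2⟩)
      have := (Finset.card_le_card this).trans (Finset.card_insert_le _ _)
      omega
  refine (Finset.sum_le_sum fun p _ => h₁ p).trans ?_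
  rw [← Finset.card_sigma]
  have h₂ : (S.sigma U).card ≤ (Finset.Icc 1 (size T)).card := by
    refine Finset.card_le_card_of_injOn (fun x => lo T (x.1 ++ [x.2])) ?_ ?_
    · rintro ⟨p, d⟩ hx
      have hx := (Finset.mem_sigma.1 (Finset.mem_coe.1 hx)).2
      have ho := (Finset.mem_filter.1 hx).2.1
      exact Finset.mem_coe.2 (Finset.mem_Icc.2
        ⟨by simp [lo], Occurs.lo_le_hi ho |>.trans (hi_le_size _ _)⟩)
    · rintro ⟨p, d⟩ hx ⟨p', d'⟩ hx' heq
      obtain ⟨ho, e, he, hoe⟩ :=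
        (Finset.mem_filter.1 (Finset.mem_sigma.1 (Finset.mem_coe.1 hx)).2).2
      obtain ⟨ho', e', he', hoe'⟩ :=
        (Finset.mem_filter.1 (Finset.mem_sigma.1 (Finset.mem_coe.1 hx')).2).2
      have : p ++ [d] = p' ++ [d'] := by
        rcases le_total (p ++ [d]) (p' ++ [d']) with hle | hle
        · exact eq_of_lo_eq_of_le ho he' hoe' heq hle
        · exact (eq_of_lo_eq_of_le ho' he hoe heq.symm hle).symm
      obtain ⟨rfl, h⟩ := List.append_inj' this rfl
      simpa using h
  simpa using h₂

theorem sum_length_kids_le {T : List ℕ} {σ : ℕ} (hT : ∀ x ∈ T, x ≤ σ) {S : Finset (List ℕ)}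
    (hS : ∀ p ∈ S, IsInternal T p) : ∑ p ∈ S, (kids T σ p).length ≤ 2 * size T := by
  have h := sum_length_kids_sub_one_le T σ S
  -- An internal node has `k ≥ 2` children, and then `k ≤ 2 * (k - 1)`.
  calc ∑ p ∈ S, (kids T σ p).length ≤ ∑ p ∈ S, 2 * ((kids T σ p).length - 1) := by
        refine Finset.sum_le_sum fun p hp => ?_
        have := (isInternal_iff_length_kids hT).1 (hS p hp)
        omega
    _ ≤ 2 * size T := by rw [← Finset.mul_sum]; omega

/-- Strings that are not right-maximal, but become right-maximal when their first character is
deleted, have different ends in the text. -/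
theorem card_nonInternal_le {T : List ℕ} {V : Finset (List ℕ)} (hocc : ∀ x ∈ V, Occurs T x)
    (hV : ∀ x ∈ V, ¬ IsInternal T x) (htail : ∀ x ∈ V, x ≠ [] ∧ IsInternal T x.tail) :
    V.card ≤ size T := by
  classical
  choose! u v huv using hocc
  have h : V.card ≤ (Finset.Icc 1 (size T)).card := by
    refine Finset.card_le_card_of_injOn (fun x => (u x ++ x).length) ?_ ?_
    · intro x hx
      have hl := congrArg List.length (huv x hx)
      have := List.length_pos_iff.2 (htail x hx).1
      rw [length_withEnd] at hl
      simp only [List.length_append, Finset.coe_Icc, Set.mem_Icc] at hl ⊢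
      omega
    -- Of two strings with the same end, one is a suffix of the other. A proper suffix of `y` is a
    -- suffix of the internal node `y.tail`, so it would be internal.
    · have key : ∀ x ∈ V, ∀ y ∈ V, x <:+ y → x = y := by
        intro x hx y hy hxy
        obtain ⟨c, y', rfl⟩ := List.exists_cons_of_ne_nil (htail y hy).1
        rcases List.suffix_cons_iff.1 hxy with h | h
        · exact h
        · exact absurd ((htail _ hy).2.of_suffix h) (hV x hx)
      intro x hx y hy hxy
      have h₁ : u x ++ x <+: withEnd T := ⟨v x, huv x hx⟩
      have h₂ : u y ++ y <+: withEnd T := ⟨v y, huv y hy⟩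
      have heq : u x ++ x = u y ++ y :=
        (List.prefix_of_prefix_length_le h₁ h₂ (le_of_eq hxy)).eq_of_length hxy
      rcases List.suffix_or_suffix_of_suffix (List.suffix_append (u x) x)
        (heq ▸ List.suffix_append (u y) y) with h | h
      · exact key x hx y hy h
      · exact (key y hy x hx h).symm
  simpa using h

/-- The number of the children of `p` and of its extensions to the left. -/
def weight (T : List ℕ) (σ : ℕ) (p : List ℕ) : ℕ :=
  (kids T σ p).length + ∑ c ∈ Finset.Icc 1 σ, (kids T σ (c :: p)).length

/-- `5 = 2 + 2 + 1`: the children of the nodes in `S`, those of the left extensions that are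
internal, and those of the other left extensions, which have at most one child each. -/
theorem sum_weight_le {T : List ℕ} {σ : ℕ} (hT : ∀ x ∈ T, x ≤ σ) {S : Finset (List ℕ)}
    (hS : ∀ p ∈ S, IsInternal T p) : ∑ p ∈ S, weight T σ p ≤ 5 * size T := by
  classical
  simp only [weight]
  rw [Finset.sum_add_distrib]
  have h₁ := sum_length_kids_le hT hS
  set U := (S ×ˢ Finset.Icc 1 σ).image fun x => x.2 :: x.1 with hU
  have h₂ : ∑ p ∈ S, ∑ c ∈ Finset.Icc 1 σ, (kids T σ (c :: p)).length =
      ∑ x ∈ U, (kids T σ x).length := by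
    rw [hU, Finset.sum_image, Finset.sum_product]
    rintro ⟨p, c⟩ - ⟨p', c'⟩ - h
    simpa [and_comm] using h
  have hUS : ∀ x ∈ U, x ≠ [] ∧ IsInternal T x.tail := by
    intro x hx
    obtain ⟨⟨p, c⟩, hpc, rfl⟩ := Finset.mem_image.1 hx
    exact ⟨by simp, hS p (Finset.mem_product.1 hpc).1⟩
  rw [h₂, ← Finset.sum_filter_add_sum_filter_not U (IsInternal T)]
  have h₃ := sum_length_kids_le hT (S := U.filter fun x => IsInternal T x)
    fun p hp => (Finset.mem_filter.1 hp).2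
  have h₄ : ∑ x ∈ U.filter (¬ IsInternal T ·), (kids T σ x).length ≤
      ((U.filter (¬ IsInternal T ·)).filter (Occurs T ·)).card := by
    rw [Finset.card_filter]
    refine Finset.sum_le_sum fun x hx => ?_
    have hx := (Finset.mem_filter.1 hx).2
    rw [isInternal_iff_length_kids hT] at hx
    split_ifs with ho
    · omega
    · rw [length_kids, Nat.le_zero, Finset.card_eq_zero, Finset.filter_eq_empty_iff]
      intro d _ hd
      exact ho ((List.prefix_append _ _).isInfix.trans hd)
  have h₅ := card_nonInternal_le (T := T)
    (V := (U.filter (¬ IsInternal T ·)).filter (Occurs T ·))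
    (fun x hx => (Finset.mem_filter.1 hx).2)
    (fun x hx => (Finset.mem_filter.1 (Finset.mem_filter.1 hx).1).2)
    (fun x hx => hUS x (Finset.mem_filter.1 (Finset.mem_filter.1 hx).1).1)
  omega

theorem sum_card_filter_eq {α β : Type*} (P : α → β → Prop) [∀ a b, Decidable (P a b)]
    (S : Finset α) (l : List β) :
    (l.map fun b => (S.filter (P · b)).card).sum = ∑ a ∈ S, l.countP (P a ·) := by
  induction l with
  | nil => simp
  | cons b l ih =>
    rw [List.map_cons, List.sum_cons, ih]
    simp only [List.countP_cons, Finset.sum_add_distrib, Finset.card_filter, decide_eq_true_eq]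
    omega

/-- If `cpd` occurs, so does `pd`; the labels below `cp` are among those below `p`. -/
theorem length_kids_cons (T : List ℕ) (σ : ℕ) (p : List ℕ) (c : ℕ) :
    (kids T σ (c :: p)).length =
      (kids T σ p).countP (fun t => Occurs T (c :: (p ++ [t.1]))) := by
  rw [kids, kids, List.length_map, List.countP_map, List.countP_filter,
    ← List.countP_eq_length_filter]
  refine List.countP_congr fun d _ => ?_
  simp only [List.cons_append, decide_eq_true_eq, Function.comp_apply, Bool.and_eq_true,
    iff_self_and]
  exact fun h => (List.suffix_cons _ _).isInfix.trans h

/-- For the child with label `d`, the reported characters are the `c` for which `cpd` occurs, and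
perhaps `0`. The possible zeros account for the number of children of `p`, the rest for the children
of the `cp`. -/
theorem sum_length_report_le {T : List ℕ} {σ : ℕ} {report : ℕ → ℕ → List (ℕ × ℕ × ℕ)}
    (hT : ∀ x ∈ T, x ≤ σ) (hR : IsRangeReporter (bwt T) report) (p : List ℕ) :
    ((kids T σ p).map fun t => (report t.2.1 t.2.2).length).sum ≤ weight T σ p := by
  have h₁ : ∀ t ∈ kids T σ p, (report t.2.1 t.2.2).length ≤
      1 + ((Finset.Icc 1 σ).filter fun c => Occurs T (c :: (p ++ [t.1]))).card := by
    rintro ⟨d, i, j⟩ ht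
    obtain ⟨ho, rfl, rfl⟩ := (mem_kids hT).1 ht
    have hnd := hR.nodup (i := lo T (p ++ [d])) (by simp [lo]) ho.lo_le_hi (hi_le_size _ _)
    rw [← List.length_map (f := Prod.fst), ← List.toFinset_card_of_nodup hnd]
    refine (Finset.card_le_card (t := insert 0 ((Finset.Icc 1 σ).filter
      fun c => Occurs T (c :: (p ++ [d])))) ?_).trans
      ((Finset.card_insert_le _ _).trans (by rw [Nat.add_comm]))
    intro c hc
    obtain ⟨⟨c', a, b⟩, hm, rfl⟩ := List.mem_map.1 (List.mem_toFinset.1 hc)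
    rw [Finset.mem_insert]
    rcases Nat.eq_zero_or_pos c' with rfl | hpos
    · exact .inl rfl
    · refine .inr (Finset.mem_filter.2 ⟨Finset.mem_Icc.2 ⟨hpos, ?_⟩, ?_⟩)
      · exact hR.le_sigma hT (by simp [lo]) ho.lo_le_hi (hi_le_size _ _) hm
      · exact ((hR.mem_iff_of_pos ho hpos).1 hm).1
  calc ((kids T σ p).map fun t => (report t.2.1 t.2.2).length).sum
      ≤ ((kids T σ p).map fun t =>
        1 + ((Finset.Icc 1 σ).filter fun c => Occurs T (c :: (p ++ [t.1]))).card).sum :=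
        List.sum_le_sum h₁
    _ = weight T σ p := by
        rw [List.sum_map_add, sum_card_filter_eq (fun c (t : ℕ × ℕ × ℕ) =>
          Occurs T (c :: (p ++ [t.1])))]
        simp [weight, length_kids_cons]

/-! ### The number of occurrences -/

/-- An occurrence of `p` has only one preceding character. So of two left extensions the less
frequent one has at most half of the occurrences of `p`. -/
theorem occ_cons_add_le {T p : List ℕ} {c c' : ℕ} (hc : 1 ≤ c) (hc' : 1 ≤ c') (hne : c ≠ c') :
    occ T (c :: p) + occ T (c' :: p) ≤ occ T p := by
  have key : ∀ {c}, 1 ≤ c → occ T (c :: p) =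
      (List.range' 1 (size T)).countP fun k => charBefore T k = c ∧ p <+: suffixFrom T k := by
    intro c hc
    rw [← countP_suffixes_cons T hc (fun s => p <+: s), occ]
    refine countP_congr_prop fun s hs => ?_
    have hne := (mem_suffixes.1 hs).1
    cases s with
    | nil => simp at hne
    | cons b s => simp [List.cons_prefix_cons, eq_comm]
  rw [key hc, key hc', occ, suffixes, List.countP_map, ← countP_eq_add (R := fun k =>
    (charBefore T k = c ∧ p <+: suffixFrom T k) ∨ (charBefore T k = c' ∧ p <+: suffixFrom T k))
    (fun _ _ => Iff.rfl) (fun k _ h h' => hne (h.1.symm.trans h'.1))]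
  refine List.countP_mono_left fun k _ h => ?_
  simp only [decide_eq_true_eq, Function.comp_apply] at h ⊢
  rcases h with h | h <;> exact h.2

theorem IsInternal.two_le_occ {T p : List ℕ} (h : IsInternal T p) : 2 ≤ occ T p := by
  obtain ⟨a, b, hab, ha, hb⟩ := h
  have h₁ := Occurs.occ_pos ha
  have h₂ := Occurs.occ_pos hb
  have h₃ : occ T (p ++ [a]) + occ T (p ++ [b]) ≤ occ T p := by
    rw [occ, occ, ← countP_eq_add (R := fun s => p ++ [a] <+: s ∨ p ++ [b] <+: s)
      (fun _ _ => Iff.rfl) (fun s _ h h' => hab (append_singleton_prefix_unique h h'))]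
    refine countP_le_of_imp fun s _ h => ?_
    rcases h with h | h <;> exact (List.prefix_append _ _).trans h
  omega

theorem not_mem_suffixes_of_zero_not_mem {T p : List ℕ} (h : 0 ∉ p) : p ∉ suffixes T := by
  intro hp
  obtain ⟨t, rfl⟩ := zero_mem_of_mem_suffixes hp
  simp at h

/-! ### Symbolic execution -/

namespace VState

variable (v : VState) (x y : Var) (a t i j : ℕ)

@[simp] theorem get_set : (v.set x a).get y = if y = x then a else v.get y :=
  Function.update_apply ..

@[simp] theorem get_tick : (v.tick t).get y = v.get y := rfl
@[simp] theorem get_write : (v.write i j a).get y = v.get y := rfl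
@[simp] theorem M_set : (v.set x a).M = v.M := rfl
@[simp] theorem M_tick : (v.tick t).M = v.M := rfl
@[simp] theorem M_write : (v.write i j a).M =
  Function.update v.M i (Function.update (v.M i) j a) := rfl
@[simp] theorem out_set : (v.set x a).out = v.out := rfl
@[simp] theorem out_tick : (v.tick t).out = v.out := rfl
@[simp] theorem out_write : (v.write i j a).out = v.out := rfl
@[simp] theorem time_set : (v.set x a).time = v.time := rfl
@[simp] theorem time_tick : (v.tick t).time = v.time + t := rfl
@[simp] theorem time_write : (v.write i j a).time = v.time := rfl
@[simp] theorem get_setRow (f : ℕ → ℕ) : (v.setRow i f).get y = v.get y := rfl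
@[simp] theorem M_setRow (f : ℕ → ℕ) : (v.setRow i f).M = Function.update v.M i f := rfl
@[simp] theorem out_setRow (f : ℕ → ℕ) : (v.setRow i f).out = v.out := rfl
@[simp] theorem time_setRow (f : ℕ → ℕ) : (v.setRow i f).time = v.time := rfl


end VState

@[simp] theorem Opd.val_var (v : VState) (x : Var) : (Opd.var x).val v = v.get x := rfl

@[simp] theorem Opd.val_ofNat (v : VState) (k : ℕ) :
    (no_index (@OfNat.ofNat Opd k _)).val v = @OfNat.ofNat ℕ k _ := rfl

@[simp] theorem Opd.small_var (x : Var) : (Opd.var x).Small := trivial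

@[simp] theorem Opd.small_ofNat (k : ℕ) : (no_index (@OfNat.ofNat Opd k _)).Small ↔ k < 256 := Iff.rfl

notation:60 p:61 "⨾" q:60 => Cmd.seq p q

/-! ### Lists in memory -/

/-- The words of the triples of `L` are stored from position `a` on. -/
def Seg (f : ℕ → ℕ) : ℕ → List (ℕ × ℕ × ℕ) → Prop
  | _, [] => True
  | a, t :: L => f a = t.1 ∧ f (a + 1) = t.2.1 ∧ f (a + 2) = t.2.2 ∧ Seg f (a + 3) L

/-- The words of `L` are stored from position `a` on. -/
def Arr (f : ℕ → ℕ) : ℕ → List ℕ → Prop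
  | _, [] => True
  | a, x :: L => f a = x ∧ Arr f (a + 1) L

theorem Seg.congr {f g : ℕ → ℕ} {a : ℕ} {L : List (ℕ × ℕ × ℕ)} (h : Seg f a L)
    (hfg : ∀ j, a ≤ j → j < a + 3 * L.length → g j = f j) : Seg g a L := by
  induction L generalizing a with
  | nil => trivial
  | cons t L ih =>
    simp only [List.length_cons] at hfg
    obtain ⟨h₁, h₂, h₃, h₄⟩ := h
    exact ⟨(hfg _ (by omega) (by omega)).trans h₁, (hfg _ (by omega) (by omega)).trans h₂,
      (hfg _ (by omega) (by omega)).trans h₃,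
      ih h₄ fun j h₁ h₂ => hfg j (by omega) (by omega)⟩

theorem seg_append {f : ℕ → ℕ} {a : ℕ} {L L' : List (ℕ × ℕ × ℕ)} :
    Seg f a (L ++ L') ↔ Seg f a L ∧ Seg f (a + 3 * L.length) L' := by
  induction L generalizing a with
  | nil => simp [Seg]
  | cons t L ih =>
    simp only [List.cons_append, Seg, ih, List.length_cons, and_assoc,
      show a + 3 + 3 * L.length = a + 3 * (L.length + 1) by ring]

theorem Arr.congr {f g : ℕ → ℕ} {a : ℕ} {L : List ℕ} (h : Arr f a L)
    (hfg : ∀ j, a ≤ j → j < a + L.length → g j = f j) : Arr g a L := by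
  induction L generalizing a with
  | nil => trivial
  | cons t L ih =>
    simp only [List.length_cons] at hfg
    exact ⟨(hfg _ (by omega) (by omega)).trans h.1,
      ih h.2 fun j h₁ h₂ => hfg j (by omega) (by omega)⟩

theorem arr_append {f : ℕ → ℕ} {a : ℕ} {L L' : List ℕ} :
    Arr f a (L ++ L') ↔ Arr f a L ∧ Arr f (a + L.length) L' := by
  induction L generalizing a with
  | nil => simp [Arr]
  | cons t L ih =>
    simp only [List.cons_append, Arr, ih, List.length_cons, and_assoc,
      show a + 1 + L.length = a + (L.length + 1) by ring]

theorem seg_getD (L : List (ℕ × ℕ × ℕ)) (f : ℕ → ℕ) :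
    Seg (fun j => (flattenTriples L).getD j (f j)) 0 L := by
  suffices H : ∀ (L : List (ℕ × ℕ × ℕ)) (pre : List ℕ),
      Seg (fun j => (pre ++ flattenTriples L).getD j (f j)) pre.length L from H L []
  intro L
  induction L with
  | nil => intro _; trivial
  | cons t L ih =>
    intro pre
    have := ih (pre ++ [t.1, t.2.1, t.2.2])
    have e : pre ++ flattenTriples (t :: L) =
        pre ++ [t.1, t.2.1, t.2.2] ++ flattenTriples L := by
      simp [flattenTriples]
    rw [← e] at this
    refine ⟨?_, ?_, ?_, by simpa using this⟩ <;> rw [e] <;> simp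

/-! ### The table of left extensions, and how one reported character changes it. -/

/-- `M` holds the lists `tab c` in the rows for the characters `c`, and in row `1` from cell `1` on
the `m` characters with nonempty lists. -/
structure TableRep (σ : ℕ) (M : ℕ → ℕ → ℕ) (m : ℕ) (tab : ℕ → List (ℕ × ℕ × ℕ)) : Prop where
  count : ∀ c ≤ σ, M (c + 3) 0 = (tab c).length
  seg : ∀ c ≤ σ, Seg (M (c + 3)) 1 (tab c)
  zero : tab 0 = []
  large : ∀ c, σ < c → tab c = []
  touched : ∃ l : List ℕ, l.Nodup ∧ (∀ c, c ∈ l ↔ tab c ≠ []) ∧ m = l.length ∧ Arr (M 1) 1 l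

theorem TableRep.le {σ m : ℕ} {M : ℕ → ℕ → ℕ} {tab : ℕ → List (ℕ × ℕ × ℕ)}
    (h : TableRep σ M m tab) : m ≤ σ := by
  obtain ⟨l, hnd, hl, rfl, -⟩ := h.touched
  have : l.toFinset ⊆ Finset.Icc 1 σ := by
    intro c hc
    have hc := (hl c).1 (List.mem_toFinset.1 hc)
    rw [Finset.mem_Icc]
    refine ⟨Nat.pos_of_ne_zero ?_, ?_⟩
    · rintro rfl; exact hc h.zero
    · by_contra hlt; exact hc (h.large c (by omega))
  simpa [List.toFinset_card_of_nodup hnd] using Finset.card_le_card this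

theorem TableRep.congr {σ m : ℕ} {M M' : ℕ → ℕ → ℕ} {tab : ℕ → List (ℕ × ℕ × ℕ)}
    (h : TableRep σ M m tab) (h₁ : M' 1 = M 1) (h₃ : ∀ c ≤ σ, M' (c + 3) = M (c + 3)) :
    TableRep σ M' m tab where
  count c hc := by rw [h₃ c hc]; exact h.count c hc
  seg c hc := by rw [h₃ c hc]; exact h.seg c hc
  zero := h.zero
  large := h.large
  touched := by rw [h₁]; exact h.touched

/-- The character is always written behind the list of touched ones, but `m` grows only if the list
of `c` was empty. Otherwise the extra entry lies outside the represented list and does no harm. -/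
theorem TableRep.append {σ m m' : ℕ} {M M' : ℕ → ℕ → ℕ} {tab : ℕ → List (ℕ × ℕ × ℕ)}
    (h : TableRep σ M m tab) {c : ℕ} (hc : c ≠ 0) (hcσ : c ≤ σ) {t : ℕ × ℕ × ℕ}
    (hrow : ∀ e ≤ σ, e ≠ c → M' (e + 3) = M (e + 3))
    (hsame : ∀ j, 1 ≤ j → j < 3 * (tab c).length + 1 → M' (c + 3) j = M (c + 3) j)
    (hcount : M' (c + 3) 0 = (tab c).length + 1)
    (hseg : Seg (M' (c + 3)) (3 * (tab c).length + 1) [t])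
    (htouch : ∀ j, 1 ≤ j → j ≤ m → M' 1 j = M 1 j) (hnew : M' 1 (m + 1) = c)
    (hm : m' = m + if (tab c).length < 1 then 1 else 0) :
    TableRep σ M' m' (Function.update tab c (tab c ++ [t])) where
  count e he := by
    rcases eq_or_ne e c with rfl | hne
    · simp [hcount]
    · simp [hne, hrow e he hne, h.count e he]
  seg e he := by
    rcases eq_or_ne e c with rfl | hne
    · rw [Function.update_self, seg_append]
      exact ⟨(h.seg e he).congr fun j h₁ h₂ => hsame j h₁ (by omega), by rwa [Nat.add_comm 1]⟩
    · simp [hne, hrow e he hne, h.seg e he]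
  zero := by simp [Ne.symm hc, h.zero]
  large e he := by simp [show e ≠ c by omega, h.large e he]
  touched := by
    obtain ⟨l, hnd, hl, hml, harr⟩ := h.touched
    have harr' : Arr (M' 1) 1 l := harr.congr fun j h₁ h₂ => htouch j h₁ (by omega)
    by_cases h0 : tab c = []
    · refine ⟨l ++ [c], ?_, ?_, ?_, ?_⟩
      · rw [List.nodup_append]
        refine ⟨hnd, List.nodup_singleton c, ?_⟩
        rintro e he f hf rfl
        rw [List.mem_singleton] at hf
        subst hf
        exact (hl e).1 he h0
      · intro e
        rcases eq_or_ne e c with rfl | hne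
        · simp
        · simp [hne, hl]
      · simp [hm, h0, hml]
      · rw [arr_append]
        exact ⟨harr', by rw [Nat.add_comm, ← hml]; exact hnew, trivial⟩
    · refine ⟨l, hnd, ?_, ?_, harr'⟩
      · intro e
        rcases eq_or_ne e c with rfl | hne
        · simp [hl, h0]
        · simp [hne, hl]
      · have := List.length_pos_iff.2 h0
        rw [hm, if_neg (by omega), hml]
        rfl

open Var in
/-- Handle one reported character: append the child with label `d` to the list of `c`. -/
def reportBody : Cmd :=
  ld c 2 y ⨾ bin .add y y 1 ⨾ ld a 2 y ⨾ bin .add y y 1 ⨾ ld b 2 y ⨾ bin .add y y 1 ⨾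
  bin .sub rem rem 1 ⨾
  .ite c.idx
    (ld base 0 c ⨾ bin .add a a base ⨾ bin .add b b base ⨾
      bin .add row c 3 ⨾ ld cnt row 0 ⨾
      bin .add z m 1 ⨾ st 1 z c ⨾ bin .lt flag cnt 1 ⨾ bin .add m m flag ⨾
      bin .add z cnt cnt ⨾ bin .add z z cnt ⨾ bin .add z z 1 ⨾
      st row z d ⨾ bin .add z z 1 ⨾ st row z a ⨾ bin .add z z 1 ⨾
      st row z b ⨾ bin .add cnt cnt 1 ⨾ st row 0 cnt)
    skip

/-- The table after the reported triples `L` were handled for the label `d`. -/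
def absorb (C : ℕ → ℕ) (d : ℕ) (tab : ℕ → List (ℕ × ℕ × ℕ)) (L : List (ℕ × ℕ × ℕ)) (c : ℕ) :
    List (ℕ × ℕ × ℕ) :=
  if c = 0 then tab c
  else tab c ++ (L.filter (·.1 = c)).map fun t => (d, C c + t.2.1, C c + t.2.2)

theorem absorb_zero (C : ℕ → ℕ) (d : ℕ) (tab : ℕ → List (ℕ × ℕ × ℕ)) (L : List (ℕ × ℕ × ℕ))
    {t : ℕ × ℕ × ℕ} (ht : t.1 = 0) : absorb C d tab (L ++ [t]) = absorb C d tab L := by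
  funext c
  by_cases hc : c = 0
  · simp [absorb, hc]
  · simp [absorb, hc, List.filter_append, ht, Ne.symm hc]

theorem absorb_append (C : ℕ → ℕ) (d : ℕ) (tab : ℕ → List (ℕ × ℕ × ℕ)) (L : List (ℕ × ℕ × ℕ))
    {t : ℕ × ℕ × ℕ} (ht : t.1 ≠ 0) : absorb C d tab (L ++ [t]) =
      Function.update (absorb C d tab L) t.1
        (absorb C d tab L t.1 ++ [(d, C t.1 + t.2.1, C t.1 + t.2.2)]) := by
  funext c
  by_cases hc : c = t.1
  · subst hc
    simp [absorb, ht, List.filter_append]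
  · simp [absorb, hc, List.filter_append, Ne.symm hc]

theorem absorb_of_not_mem (C : ℕ → ℕ) (d : ℕ) (tab : ℕ → List (ℕ × ℕ × ℕ))
    (L : List (ℕ × ℕ × ℕ)) {c : ℕ} (hc : c ∉ L.map Prod.fst) : absorb C d tab L c = tab c := by
  have : L.filter (·.1 = c) = [] := by
    rw [List.filter_eq_nil_iff]
    intro t ht
    simpa using fun h => hc (List.mem_map.2 ⟨t, ht, h⟩)
  simp [absorb, this]

/-- The parameters of a run for the alphabet `[1..σ]`. -/
structure Setup (σ : ℕ) extends Machine where
  C : ℕ → ℕ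
  -- One cell for the count and three cells for each of the `σ + 1` labels.
  F_eq : F = 3 * σ + 4
  R_ge : σ + 4 < R
  n_lt : n + 1 < 2 ^ w

theorem Machine.w_ne_zero (A : Machine) : A.w ≠ 0 := by
  intro h
  have := A.consts_fit
  rw [h] at this
  omega

theorem Setup.F_lt {σ : ℕ} (A : Setup σ) : A.F + A.R < 2 ^ A.w := by
  have h₁ := A.mem_fit
  have h₂ := A.F_eq
  have h₃ := A.R_ge
  have : A.R * 4 ≤ A.R * A.F := Nat.mul_le_mul_left _ (by omega)
  have : 4 * A.F ≤ A.R * A.F := Nat.mul_le_mul_right _ (by omega)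
  omega

open Var in
theorem runs_reportBody {σ : ℕ} (A : Setup σ) {v : VState} {tab : ℕ → List (ℕ × ℕ × ℕ)}
    {t : ℕ × ℕ × ℕ} {r : List (ℕ × ℕ × ℕ)} (hC : ∀ c ≤ σ, v.M 0 c = A.C c)
    (ht : t.1 ≤ σ) (hta : t.1 ≠ 0 → A.C t.1 + t.2.1 < 2 ^ A.w)
    (htb : t.1 ≠ 0 → A.C t.1 + t.2.2 < 2 ^ A.w)
    (htab : TableRep σ v.M (v.get m) tab) (hlen : (tab t.1).length ≤ σ)
    (hseg : Seg (v.M 2) (v.get y) (t :: r)) (hrem : v.get rem = r.length + 1)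
    (hy : v.get y + 3 * r.length + 3 < A.F) :
    Runs A.toMachine reportBody (v.tick 1) fun v' =>
      v'.get rem = r.length ∧ v'.get y = v.get y + 3 ∧ Seg (v'.M 2) (v'.get y) r ∧
      (∀ x ∉ [c, y, a, b, base, row, cnt, z, m, flag, rem], v'.get x = v.get x) ∧
      (∀ i, i = 0 ∨ σ + 3 < i → v'.M i = v.M i) ∧
      v'.out = v.out ∧ v'.time ≤ v.time + 120 ∧
      TableRep σ v'.M (v'.get m) (if t.1 = 0 then tab else
        Function.update tab t.1 (tab t.1 ++ [(v.get d, A.C t.1 + t.2.1, A.C t.1 + t.2.2)])) := by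
  have hF := A.F_eq
  have hR := A.R_ge
  have hFR := A.F_lt
  obtain ⟨h₁, h₂, h₃, h₄⟩ := hseg
  have hm := htab.le
  have hcnt := htab.count _ ht
  have hCc := hC _ ht
  generalize hQ : (fun v' : VState => v'.get rem = r.length ∧ _) = Q
  unfold reportBody
  by_cases h0 : t.1 = 0
  · repeat' first
      | apply Runs.seq
      | (first
          | apply Runs.ld
          | apply Runs.add
          | apply Runs.sub
          | apply Runs.skip
          | apply Runs.ite) <;> try simp [h₁, h₂, h₃, hrem, h0]
    all_goals try omega
    subst hQ
    simp [h0, htab, h₄]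
    grind
  · have hta := hta h0
    have htb := htb h0
    repeat' first
      | apply Runs.seq
      | (first
          | apply Runs.ld
          | apply Runs.st
          | apply Runs.add
          | apply Runs.sub
          | apply Runs.lt
          | apply Runs.ite) <;> try simp [h₁, h₂, h₃, hCc, hcnt, hrem, h0]
    all_goals try omega
    · split_ifs <;> omega
    · subst hQ
      have hrow : ∀ e, e ≠ t.1 → e + 3 ≠ t.1 + 3 := fun e he => by omega
      refine ⟨by simp, by simp, by simpa using h₄, ?_, ?_, by simp, by simp, ?_⟩
      · intro x hx
        simp only [List.mem_cons, List.not_mem_nil, or_false, not_or] at hx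
        simp [hx]
      · intro i hi
        have : i ≠ t.1 + 3 := by omega
        have : i ≠ 1 := by omega
        simp [*]
      · rw [if_neg h0]
        refine htab.append h0 ht ?_ ?_ (by simp) ?_ ?_ (by simp) (by simp)
        · intro e he hne
          simp [hne]
        · intro j h1 h2
          simp [show j ≠ 0 by omega, show j ≠ (tab t.1).length + (tab t.1).length +
            (tab t.1).length + 1 by omega, show j ≠ (tab t.1).length + (tab t.1).length +
            (tab t.1).length + 1 + 1 by omega, show j ≠ (tab t.1).length + (tab t.1).length +
            (tab t.1).length + 1 + 1 + 1 by omega]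
        · have e : (tab t.1).length + (tab t.1).length + (tab t.1).length =
            3 * (tab t.1).length := by omega
          simp [Seg, e, Nat.add_comm (A.C t.1)]
        · intro j h1 h2
          simp [show j ≠ v.get m + 1 by omega]

/-- The parameters of a run for the text `T`. -/
structure TextSetup (T : List ℕ) (σ : ℕ) extends Setup σ where
  C_eq : C = smaller T
  n_eq : n = size T
  one_le : ∀ x ∈ T, 1 ≤ x
  le_sigma : ∀ x ∈ T, x ≤ σ
  isRangeReporter : IsRangeReporter (bwt T) report
  one_le_te : 1 ≤ te
  -- The stack begins at row `σ + 4` and never has more than `σ * log n` entries.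
  room : σ + 4 + σ * Nat.log 2 (size T) ≤ R
  sigma_le : σ ≤ size T

open Var in
theorem runs_reportLoop {σ : ℕ} (A : Setup σ) {v : VState} {tab : ℕ → List (ℕ × ℕ × ℕ)}
    {L : List (ℕ × ℕ × ℕ)} (hC : ∀ c ≤ σ, v.M 0 c = A.C c) (hnd : (L.map Prod.fst).Nodup)
    (hle : ∀ t ∈ L, t.1 ≤ σ) (hlt : ∀ t ∈ L, t.1 ≠ 0 → A.C t.1 + t.2.1 < 2 ^ A.w ∧
      A.C t.1 + t.2.2 < 2 ^ A.w)
    (htab : TableRep σ v.M (v.get m) tab) (hlen : ∀ c, (tab c).length ≤ σ)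
    (hseg : Seg (v.M 2) (v.get y) L) (hrem : v.get rem = L.length)
    (hy : v.get y + 3 * L.length < A.F) :
    Runs A.toMachine (.loop rem.idx reportBody) v fun v' =>
      (∀ x ∉ [c, y, a, b, base, row, cnt, z, m, flag, rem], v'.get x = v.get x) ∧
      (∀ i, i = 0 ∨ σ + 3 < i → v'.M i = v.M i) ∧
      v'.out = v.out ∧ v'.time ≤ v.time + 120 * L.length + 1 ∧
      TableRep σ v'.M (v'.get m) (absorb A.C (v.get d) tab L) := by
  refine Runs.forEach (L := L) (fun l r v' => L = l ++ r ∧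
    v'.get y + 3 * r.length < A.F ∧ Seg (v'.M 2) (v'.get y) r ∧
    (∀ x ∉ [c, y, a, b, base, row, cnt, z, m, flag, rem], v'.get x = v.get x) ∧
    (∀ i, i = 0 ∨ σ + 3 < i → v'.M i = v.M i) ∧
    v'.out = v.out ∧ v'.time ≤ v.time + 120 * l.length ∧
    TableRep σ v'.M (v'.get m) (absorb A.C (v.get d) tab l)) ?_ ?_ ?_ hrem
  · rintro l t r v' ⟨rfl, h₁, h₂, h₃, h₄, h₅, h₆, h₇⟩ hrem
    have hd : v'.get d = v.get d := h₃ d (by decide)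
    -- A query reports a character once, so the list for `t.1` has not grown since the query began
    -- and its row has room for one more triple.
    have hnot : t.1 ∉ l.map Prod.fst := by
      rw [List.map_append, List.nodup_append] at hnd
      intro hmem
      exact hnd.2.2 _ hmem _ (by simp) rfl
    simp only [List.length_cons] at h₁
    refine (runs_reportBody A (v := v') (by simpa [h₄] using hC) (hle t (by simp))
      (fun h => (hlt t (by simp) h).1) (fun h => (hlt t (by simp) h).2) h₇
      (by rw [absorb_of_not_mem _ _ _ _ hnot]; exact hlen _) h₂ hrem (by omega)).mono ?_
    rintro v'' ⟨g₀, g₁, g₂, g₃, g₄, g₅, g₆, g₇⟩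
    refine ⟨g₀, by simp, by omega, g₂, fun x hx => (g₃ x hx).trans (h₃ x hx),
      fun i hi => (g₄ i hi).trans (h₄ i hi), g₅.trans h₅, by simp; omega, ?_⟩
    by_cases h0 : t.1 = 0
    · rw [absorb_zero _ _ _ _ h0]
      simpa [h0] using g₇
    · rw [absorb_append _ _ _ _ h0]
      simpa [h0, hd] using g₇
  · rintro v' ⟨-, -, -, h₃, h₄, h₅, h₆, h₇⟩
    exact ⟨h₃, h₄, h₅, by simpa using h₆, h₇⟩
  · refine ⟨rfl, hy, hseg, fun _ _ => rfl, fun _ _ => rfl, rfl, by simp, ?_⟩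
    have : absorb A.C (v.get d) tab [] = tab := by funext c; simp [absorb]
    rwa [this]

/-! ### Expansion of a node. -/

/-- The table while the node `p` is expanded: the lists of children, restricted to the labels in
`l`, of the strings `c :: p`. -/
def partialTable (T : List ℕ) (σ : ℕ) (p : List ℕ) (l : List (ℕ × ℕ × ℕ)) (c : ℕ) :
    List (ℕ × ℕ × ℕ) :=
  if 1 ≤ c ∧ c ≤ σ then
    (l.filter fun t => Occurs T (c :: (p ++ [t.1]))).map
      fun t => (t.1, lo T (c :: (p ++ [t.1])), hi T (c :: (p ++ [t.1])))
  else []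

/-- The lists of children of the strings `c :: p`. -/
def leftTable (T : List ℕ) (σ : ℕ) (p : List ℕ) (c : ℕ) : List (ℕ × ℕ × ℕ) :=
  if 1 ≤ c ∧ c ≤ σ then kids T σ (c :: p) else []

/-- No child of `cp` is missed by looking only at the labels below `p`, since every label below `cp`
is among them. -/
theorem partialTable_kids (T : List ℕ) (σ : ℕ) (p : List ℕ) :
    partialTable T σ p (kids T σ p) = leftTable T σ p := by
  funext c
  unfold partialTable leftTable
  split_ifs
  · rw [kids, kids, List.filter_map, List.map_map, List.filter_filter]
    congr 1
    refine List.filter_congr fun d _ => ?_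
    rw [Bool.eq_iff_iff]
    simp only [Function.comp_apply, Bool.and_eq_true, decide_eq_true_eq, List.cons_append]
    exact ⟨And.left, fun h => ⟨h, (List.suffix_cons _ _).isInfix.trans h⟩⟩
  · rfl

theorem filter_fst_eq {L : List (ℕ × ℕ × ℕ)} (hnd : (L.map Prod.fst).Nodup) {t : ℕ × ℕ × ℕ}
    (ht : t ∈ L) : L.filter (·.1 = t.1) = [t] := by
  obtain ⟨l₁, l₂, rfl⟩ := List.append_of_mem ht
  simp only [List.map_append, List.map_cons, List.nodup_append, List.nodup_cons] at hnd
  have h₁ : l₁.filter (·.1 = t.1) = [] := by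
    rw [List.filter_eq_nil_iff]
    intro a ha
    simpa using hnd.2.2 a.1 (List.mem_map.2 ⟨a, ha, rfl⟩) t.1 (by simp)
  have h₂ : l₂.filter (·.1 = t.1) = [] := by
    rw [List.filter_eq_nil_iff]
    intro a ha
    simpa using fun h => hnd.2.1.1 (List.mem_map.2 ⟨a, ha, h⟩)
  simp [List.filter_append, h₁, h₂]

/-- The query for `pd` adds at most one triple to the list of `c`, and does so exactly if `cpd`
occurs. Since the children of `p` come in increasing order of labels, all the lists stay sorted
without any sorting. -/
theorem absorb_partialTable {T : List ℕ} {σ : ℕ} {report : ℕ → ℕ → List (ℕ × ℕ × ℕ)}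
    (hT : ∀ x ∈ T, x ≤ σ) (hR : IsRangeReporter (bwt T) report) (p : List ℕ)
    (l : List (ℕ × ℕ × ℕ)) {t : ℕ × ℕ × ℕ} (ht : t ∈ kids T σ p) :
    absorb (smaller T) t.1 (partialTable T σ p l) (report t.2.1 t.2.2) =
      partialTable T σ p (l ++ [t]) := by
  obtain ⟨d, i, j⟩ := t
  obtain ⟨ho, rfl, rfl⟩ := (mem_kids hT).1 ht
  have hnd := hR.nodup (i := lo T (p ++ [d])) (by simp [lo]) ho.lo_le_hi (hi_le_size _ _)
  funext c
  unfold absorb partialTable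
  rcases Nat.eq_zero_or_pos c with rfl | hc
  · simp
  rw [if_neg (by omega)]
  by_cases hcσ : c ≤ σ
  · rw [if_pos ⟨hc, hcσ⟩, if_pos ⟨hc, hcσ⟩, List.filter_append, List.map_append]
    congr 1
    by_cases hoc : Occurs T (c :: (p ++ [d]))
    · have e₁ := lo_cons (T := T) hc (p ++ [d])
      have e₂ := hi_cons (T := T) hc (p ++ [d])
      have hm := (hR.mem_iff_of_pos ho hc (a := rank (bwt T) c (lo T (p ++ [d]) - 1) + 1)
        (b := rank (bwt T) c (hi T (p ++ [d])))).2 ⟨hoc, by omega, by omega⟩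
      have := filter_fst_eq hnd hm
      simp only at this
      simp [this, hoc, e₁, e₂, Nat.add_assoc]
    · have : (report (lo T (p ++ [d])) (hi T (p ++ [d]))).filter (·.1 = c) = [] := by
        rw [List.filter_eq_nil_iff]
        rintro ⟨c', a, b⟩ hm
        simp only [decide_eq_true_eq]
        rintro rfl
        exact hoc ((hR.mem_iff_of_pos ho hc).1 hm).1
      simp [this, hoc]
  · have : (report (lo T (p ++ [d])) (hi T (p ++ [d]))).filter (·.1 = c) = [] := by
      rw [List.filter_eq_nil_iff]
      intro t ht
      have := hR.le_sigma hT (by simp [lo]) ho.lo_le_hi (hi_le_size _ _) ht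
      simp only [decide_eq_true_eq]
      omega
    simp [this, hcσ]

theorem length_partialTable_le (T : List ℕ) (σ : ℕ) (p : List ℕ) (l : List (ℕ × ℕ × ℕ)) (c : ℕ) :
    (partialTable T σ p l c).length ≤ l.length := by
  unfold partialTable
  split_ifs
  · simpa using List.length_filter_le _ _
  · simp

open Var in
/-- Handle one child of the node in row `top`. -/
def expandBody : Cmd :=
  ld d top x ⨾ bin .add x x 1 ⨾ ld i top x ⨾ bin .add x x 1 ⨾ ld j top x ⨾ bin .add x x 1 ⨾
  bin .sub k k 1 ⨾ ask i j rem ⨾ bin .sub y y y ⨾ .loop rem.idx reportBody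

open Var in
theorem runs_expandBody {T : List ℕ} {σ : ℕ} (A : TextSetup T σ) {v : VState} {p : List ℕ}
    {l r : List (ℕ × ℕ × ℕ)} {t : ℕ × ℕ × ℕ} (hp : kids T σ p = l ++ t :: r)
    (hC : ∀ c ≤ σ, v.M 0 c = A.C c) (htop : v.get top < A.R) (htop' : σ + 3 < v.get top)
    (htab : TableRep σ v.M (v.get m) (partialTable T σ p l))
    (hseg : Seg (v.M (v.get top)) (v.get x) (t :: r)) (hk : v.get k = r.length + 1)
    (hx : v.get x + 3 * r.length + 3 ≤ A.F) :
    Runs A.toMachine expandBody (v.tick 1) fun v' =>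
      v'.get k = r.length ∧ v'.get x = v.get x + 3 ∧
      v'.get top = v.get top ∧ v'.get fb = v.get fb ∧ v'.get sp = v.get sp ∧
      (∀ i, i = 0 ∨ σ + 3 < i → v'.M i = v.M i) ∧ v'.out = v.out ∧
      v'.time ≤ v.time + 50 + (A.te + 120) * (A.report t.2.1 t.2.2).length ∧
      TableRep σ v'.M (v'.get m) (partialTable T σ p (l ++ [t])) := by
  obtain ⟨h₁, h₂, h₃, h₄⟩ := hseg
  have hF := A.F_eq
  have hFR := A.F_lt
  have ht : t ∈ kids T σ p := by simp [hp]
  obtain ⟨ho, hi, hj⟩ := (mem_kids A.le_sigma (d := t.1) (i := t.2.1) (j := t.2.2)).1 ht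
  have hlo : 1 ≤ t.2.1 := by rw [hi]; simp [lo]
  have hle : t.2.1 ≤ t.2.2 := by rw [hi, hj]; exact ho.lo_le_hi
  have hn : t.2.2 ≤ size T := by rw [hj]; exact hi_le_size _ _
  have hlen := A.isRangeReporter.length_le A.le_sigma hlo hle hn
  have hll : l.length ≤ σ := by
    have := length_kids_le T σ p
    rw [hp] at this
    simp at this
    omega
  generalize hQ : (fun v' : VState => v'.get k = r.length ∧ _) = Q
  unfold expandBody
  repeat' first
    | apply Runs.seq
    | (first
        | apply Runs.ld
        | apply Runs.add
        | apply Runs.sub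
        | apply Runs.ask rfl) <;> try simp [h₁, h₂, h₃, hk]
  all_goals try omega
  · exact A.n_eq ▸ hn
  · refine (runs_reportLoop A.toSetup (L := A.report t.2.1 t.2.2) (by simpa using hC)
      (A.isRangeReporter.nodup hlo hle hn)
      (fun u hu => A.isRangeReporter.le_sigma A.le_sigma hlo hle hn hu) ?_
      (tab := partialTable T σ p l) (by simpa using htab.congr (by simp) (by simp))
      (fun c => (length_partialTable_le T σ p l c).trans hll)
      (by simpa using seg_getD (A.report t.2.1 t.2.2) (v.M 2)) (by simp) (by simp; omega)).mono ?_
    · rintro ⟨c, a, b⟩ hu h0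
      rw [hi, hj] at hu
      have h0 : c ≠ 0 := h0
      have := (A.isRangeReporter.mem_iff_of_pos ho (Nat.pos_of_ne_zero h0)).1 hu
      have h₅ := this.1.lo_le_hi
      have h₆ := hi_le_size T (c :: (p ++ [t.1]))
      have h₇ := A.n_lt
      rw [A.n_eq] at h₇
      simp only [A.C_eq]
      omega
    · rintro v' ⟨g₁, g₂, g₃, g₄, g₅⟩
      subst hQ
      refine ⟨?_, ?_, ?_, ?_, ?_, ?_, ?_, ?_, ?_⟩
      · rw [g₁ _ (by decide)]; simp
      · rw [g₁ _ (by decide)]; simp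
      · rw [g₁ _ (by decide)]; simp
      · rw [g₁ _ (by decide)]; simp
      · rw [g₁ _ (by decide)]; simp
      · intro i hi
        rw [g₂ i hi]
        simp [show i ≠ 2 by omega]
      · rw [g₃]; simp
      · simp only [VState.time_tick, VState.time_set, VState.time_setRow] at g₄
        have : (A.te + 120) * (A.report t.2.1 t.2.2).length =
          A.te * (A.report t.2.1 t.2.2).length + 120 * (A.report t.2.1 t.2.2).length := by ring
        omega
      · rw [← absorb_partialTable A.le_sigma A.isRangeReporter p l ht]
        simpa [A.C_eq] using g₅

open Var in
/-- Handle all the children of the node in row `top`. -/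
def expand : Cmd :=
  bin .sub m m m ⨾ bin .sub x x x ⨾ bin .add x x 1 ⨾ ld k top 0 ⨾ .loop k.idx expandBody

open Var in
theorem runs_expand {T : List ℕ} {σ : ℕ} (A : TextSetup T σ) {v : VState} {p : List ℕ}
    (hC : ∀ c ≤ σ, v.M 0 c = smaller T c) (htop : v.get top < A.R) (htop' : σ + 3 < v.get top)
    (hzero : ∀ c ≤ σ, v.M (c + 3) 0 = 0)
    (hcount : v.M (v.get top) 0 = (kids T σ p).length)
    (hseg : Seg (v.M (v.get top)) 1 (kids T σ p)) :
    Runs A.toMachine expand v fun v' =>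
      v'.get top = v.get top ∧ v'.get fb = v.get fb ∧ v'.get sp = v.get sp ∧
      (∀ i, i = 0 ∨ σ + 3 < i → v'.M i = v.M i) ∧ v'.out = v.out ∧
      v'.time ≤ v.time + 20 + 50 * (kids T σ p).length + (A.te + 120) * weight T σ p ∧
      TableRep σ v'.M (v'.get m) (leftTable T σ p) := by
  have hF := A.F_eq
  have hFR := A.F_lt
  have hlen := length_kids_le T σ p
  have hw := A.w_ne_zero
  generalize hQ : (fun v' : VState => v'.get top = v.get top ∧ _) = Q
  unfold expand
  repeat' first
    | apply Runs.seq
    | (first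
        | apply Runs.ld
        | apply Runs.add
        | apply Runs.sub) <;> try simp [hcount]
  all_goals try omega
  refine Runs.forEach (L := kids T σ p) (fun l r v' => kids T σ p = l ++ r ∧
    v'.get top = v.get top ∧ v'.get fb = v.get fb ∧ v'.get sp = v.get sp ∧
    (∀ i, i = 0 ∨ σ + 3 < i → v'.M i = v.M i) ∧ v'.out = v.out ∧
    Seg (v'.M (v'.get top)) (v'.get x) r ∧ v'.get x = 3 * l.length + 1 ∧
    v'.time ≤ v.time + 19 + 50 * l.length +
      (A.te + 120) * (l.map fun t => (A.report t.2.1 t.2.2).length).sum ∧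
    TableRep σ v'.M (v'.get m) (partialTable T σ p l)) ?_ ?_ ?_ ?_
  · rintro l t r v' ⟨h₁, h₂, h₃, h₄, h₅, h₆, h₇, h₈, h₉, h₁₀⟩ hk
    have hl := congrArg List.length h₁
    simp only [List.length_append, List.length_cons] at hl
    refine (runs_expandBody A h₁ (v := v') (by simpa [h₅, A.C_eq] using hC) (by omega) (by omega)
      h₁₀ h₇ hk (by omega)).mono ?_
    rintro v'' ⟨g₁, g₂, g₃, g₄, g₅, g₆, g₇, g₈, g₉⟩
    refine ⟨g₁, by simpa using h₁, g₃.trans h₂, g₄.trans h₃, g₅.trans h₄,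
      fun i hi => (g₆ i hi).trans (h₅ i hi), g₇.trans h₆, ?_, ?_, ?_, g₉⟩
    · rw [g₂, g₃, g₆ _ (by omega)]
      exact h₇.2.2.2
    · simp; omega
    · simp only [List.length_append, List.length_singleton, List.map_append, List.sum_append,
        List.map_cons, List.map_nil, List.sum_singleton, mul_add]
      omega
  · rintro v' ⟨h₁, h₂, h₃, h₄, h₅, h₆, h₇, h₈, h₉, h₁₀⟩
    subst hQ
    rw [partialTable_kids] at h₁₀
    have hw := Nat.mul_le_mul_left (A.te + 120)
      (sum_length_report_le A.le_sigma A.isRangeReporter p)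
    refine ⟨h₂, h₃, h₄, h₅, h₆, ?_, h₁₀⟩
    simp only [VState.time_tick]
    omega
  · refine ⟨rfl, by simp, by simp, by simp, by simp, by simp, by simpa using hseg, by simp,
      by simp, ?_⟩
    have hnil : ∀ c, partialTable T σ p [] c = [] := fun c => by simp [partialTable]
    refine ⟨by simpa [hnil] using hzero, by simp [hnil, Seg], hnil 0, fun c _ => hnil c,
      [], by simp, by simp [hnil], by simp, trivial⟩
  · simp

/-! ### Output of a node -/

/-- The triples begin in cell `1`, behind the count. So the first lower bound is in cell `2` and the
last upper bound in cell `3 * length`. -/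
theorem seg_kids_bounds {T p : List ℕ} {σ : ℕ} (hT : ∀ x ∈ T, x ≤ σ) (hp : p ∉ suffixes T)
    (hne : kids T σ p ≠ []) {f : ℕ → ℕ} (hf : Seg f 1 (kids T σ p)) :
    f 2 = lo T p ∧ f (3 * (kids T σ p).length) = hi T p := by
  constructor
  · obtain ⟨t, L, h⟩ := List.exists_cons_of_ne_nil hne
    rw [h] at hf
    rw [← lo_head_kids hT hp h]
    exact hf.2.1
  · obtain ⟨L, t, h⟩ := (List.eq_nil_or_concat' (kids T σ p)).resolve_left hne
    rw [h, seg_append] at hf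
    rw [← hi_last_kids hT hp h, h]
    have := hf.2.2.2.1
    rw [← this]
    congr 1
    simp only [List.length_append, List.length_singleton]
    omega

open Var in
/-- Output the triple in the row `top` from cell `x` on. -/
def printBody : Cmd :=
  ld a top x ⨾ put a ⨾ bin .add x x 1 ⨾ ld a top x ⨾ put a ⨾ bin .add x x 1 ⨾
  ld a top x ⨾ put a ⨾ bin .add x x 1 ⨾ bin .sub k k 1

open Var in
/-- Output the node in the row `top`. -/
def print : Cmd :=
  ld kk top 0 ⨾ ld a top 2 ⨾ put a ⨾ bin .add y kk kk ⨾ bin .add y y kk ⨾ ld a top y ⨾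
  put a ⨾ put kk ⨾ bin .sub x x x ⨾ bin .add x x 1 ⨾ bin .add k kk 0 ⨾ .loop k.idx printBody

def VState.print (v : VState) (l : List ℕ) : VState := { v with out := v.out ++ l }

namespace VState

variable (v : VState) (l : List ℕ) (x : Var)

@[simp] theorem get_print : (v.print l).get x = v.get x := rfl
@[simp] theorem M_print : (v.print l).M = v.M := rfl
@[simp] theorem out_print : (v.print l).out = v.out ++ l := rfl
@[simp] theorem time_print : (v.print l).time = v.time := rfl

end VState

open Var in
theorem runs_print {σ : ℕ} (A : Setup σ) {v : VState} {L : List (ℕ × ℕ × ℕ)} {lb ub : ℕ}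
    (htop : v.get top < A.R) (hcount : v.M (v.get top) 0 = L.length)
    (hseg : Seg (v.M (v.get top)) 1 L) (hlb : v.M (v.get top) 2 = lb)
    (hub : v.M (v.get top) (3 * L.length) = ub) (hL : L.length ≤ σ + 1) :
    Runs A.toMachine print v fun v' =>
      v'.get top = v.get top ∧ v'.get fb = v.get fb ∧ v'.get sp = v.get sp ∧ v'.M = v.M ∧
      v'.out = v.out ++ NodeRecord.encode ⟨lb, ub, L⟩ ∧
      v'.time ≤ v.time + 50 + 50 * L.length := by
  have hF := A.F_eq
  have hFR := A.F_lt
  have hw := A.w_ne_zero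
  have e : L.length + L.length + L.length = 3 * L.length := by omega
  have hput : ∀ {v : VState} {Q : VState → Prop} {x : Opd}, x.Small →
    Q ((v.print [x.val v]).tick 2) → Runs A.toMachine (put x) v Q := fun hx => Runs.put hx
  generalize hQ : (fun v' : VState => v'.get top = v.get top ∧ _) = Q
  unfold print
  repeat' first
    | apply Runs.seq
    | (first
        | apply Runs.ld
        | apply Runs.add
        | apply Runs.sub
        | apply hput) <;> try simp [hcount, e, hlb, hub]
  all_goals try omega
  refine Runs.forEach (L := L) (fun l r v' => L = l ++ r ∧
    v'.get top = v.get top ∧ v'.get fb = v.get fb ∧ v'.get sp = v.get sp ∧ v'.M = v.M ∧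
    v'.get x = 3 * l.length + 1 ∧ Seg (v'.M (v'.get top)) (v'.get x) r ∧
    v'.out = v.out ++ (lb :: ub :: L.length :: flattenTriples l) ∧
    v'.time ≤ v.time + 49 + 50 * l.length) ?_ ?_ ?_ ?_
  · rintro l t r v' ⟨h₁, h₂, h₃, h₄, h₅, h₆, ⟨s₁, s₂, s₃, s₄⟩, h₈, h₉⟩ hk
    have hl := congrArg List.length h₁
    simp only [List.length_append, List.length_cons] at hl
    generalize hQ' : (fun v'' : VState => v''.get k = r.length ∧ _) = Q'
    unfold printBody
    repeat' first
      | apply Runs.seq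
      | (first
          | apply Runs.ld
          | apply Runs.add
          | apply Runs.sub
          | apply hput) <;> try simp [s₁, s₂, s₃, hk]
    all_goals try omega
    subst hQ'
    refine ⟨by simp, by simpa using h₁, by simpa using h₂, by simpa using h₃, by simpa using h₄,
      by simpa using h₅, by simp; omega, by simpa using s₄, ?_, by simp; omega⟩
    simp [h₈, flattenTriples]
  · rintro v' ⟨h₁, h₂, h₃, h₄, h₅, h₆, h₇, h₈, h₉⟩
    subst hQ
    exact ⟨h₂, h₃, h₄, h₅, h₈, by simp; omega⟩
  · exact ⟨rfl, by simp, by simp, by simp, by simp, by simp, by simpa using hseg,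
      by simp [flattenTriples], by simp⟩
  · simp

/-! ### The largest left extension -/

open Var in
def bestBody : Cmd :=
  ld c 1 x ⨾ bin .add x x 1 ⨾ bin .sub k k 1 ⨾ bin .add row c 3 ⨾ ld cnt row 0 ⨾
  bin .add y cnt cnt ⨾ bin .add y y cnt ⨾ ld b row y ⨾ ld a row 2 ⨾ bin .add b b 1 ⨾
  bin .sub b b a ⨾ bin .lt flag base b ⨾
  .ite flag.idx (bin .add base b 0 ⨾ bin .add best c 0) skip

open Var in
/-- Set `best` to the character of the left extension with the most occurrences. -/
def findBest : Cmd :=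
  bin .sub best best best ⨾ bin .sub base base base ⨾ bin .sub x x x ⨾ bin .add x x 1 ⨾
  bin .add k m 0 ⨾ .loop k.idx bestBody

theorem leftTable_ne_nil {T p : List ℕ} {σ c : ℕ} (h : leftTable T σ p c ≠ []) :
    1 ≤ c ∧ c ≤ σ ∧ leftTable T σ p c = kids T σ (c :: p) ∧ kids T σ (c :: p) ≠ [] := by
  unfold leftTable at h ⊢
  split_ifs at h ⊢ with hc
  · exact ⟨hc.1, hc.2, rfl, h⟩
  · exact absurd rfl h

open Var in
-- The number of occurrences is the length of the interval, read off the list of children. The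
-- maximum is taken over all the left extensions that occur, internal or not; it serves only to
-- bound the others.
theorem runs_findBest {T : List ℕ} {σ : ℕ} (A : TextSetup T σ) {v : VState} {p l : List ℕ}
    (hp : 0 ∉ p) (htab : TableRep σ v.M (v.get m) (leftTable T σ p))
    (hl : ∀ c ∈ l, leftTable T σ p c ≠ []) (hm : v.get m = l.length) (harr : Arr (v.M 1) 1 l) :
    Runs A.toMachine findBest v fun v' =>
      v'.get fb = v.get fb ∧ v'.get sp = v.get sp ∧ v'.get m = v.get m ∧ v'.M = v.M ∧
      v'.out = v.out ∧ v'.time ≤ v.time + 20 + 80 * l.length ∧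
      (v'.get best ∈ l ∨ l = [] ∧ v'.get best = 0) ∧
      ∀ c ∈ l, occ T (c :: p) ≤ occ T (v'.get best :: p) := by
  have hF := A.F_eq
  have hR := A.R_ge
  have hFR := A.F_lt
  have hw := A.w_ne_zero
  have hmσ := htab.le
  have hnw := A.n_lt
  have hn := A.n_eq
  generalize hQ : (fun v' : VState => v'.get fb = v.get fb ∧ _) = Q
  unfold findBest
  repeat' first
    | apply Runs.seq
    | (first
        | apply Runs.ld
        | apply Runs.add
        | apply Runs.sub) <;> try simp
  all_goals try omega
  refine Runs.forEach (L := l) (fun l₁ l₂ v' => l = l₁ ++ l₂ ∧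
    v'.get fb = v.get fb ∧ v'.get sp = v.get sp ∧ v'.get m = v.get m ∧ v'.M = v.M ∧
    v'.out = v.out ∧ v'.time ≤ v.time + 19 + 80 * l₁.length ∧
    (v'.get best ∈ l₁ ∨ l₁ = [] ∧ v'.get best = 0) ∧
    (v'.get base = if l₁ = [] then 0 else occ T (v'.get best :: p)) ∧
    (∀ c ∈ l₁, occ T (c :: p) ≤ v'.get base) ∧
    v'.get x = l₁.length + 1 ∧ Arr (v.M 1) (v'.get x) l₂) ?_ ?_ ?_ ?_
  · rintro l₁ e l₂ v' ⟨h₁, h₂, h₃, h₄, h₅, h₆, h₇, h₈, h₉, h₁₀, h₁₁, hc, h₁₂⟩ hk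
    have hlen := congrArg List.length h₁
    simp only [List.length_append, List.length_cons] at hlen
    obtain ⟨he1, heσ, htabe, hne⟩ := leftTable_ne_nil (hl e (by simp [h₁]))
    have hcnt := htab.count e heσ
    have hseg := htab.seg e heσ
    rw [htabe] at hcnt hseg
    have hsuf : (e :: p) ∉ suffixes T := not_mem_suffixes_of_zero_not_mem (by
      simp only [List.mem_cons, not_or]; exact ⟨by omega, hp⟩)
    obtain ⟨hlo, hhi⟩ := seg_kids_bounds A.le_sigma hsuf hne hseg
    have hkl := length_kids_le T σ (e :: p)
    have e3 : (kids T σ (e :: p)).length + (kids T σ (e :: p)).length +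
      (kids T σ (e :: p)).length = 3 * (kids T σ (e :: p)).length := by omega
    have hocc : BWTEnum.hi T (e :: p) + 1 - lo T (e :: p) = occ T (e :: p) := by
      have := hi_eq T (e :: p); omega
    have hhi' := hi_le_size T (e :: p)
    have hpos : 0 < occ T (e :: p) := by
      obtain ⟨⟨d, i, j⟩, L, hL⟩ := List.exists_cons_of_ne_nil hne
      have := ((mem_kids A.le_sigma (p := e :: p) (d := d) (i := i) (j := j)).1
        (by rw [hL]; simp)).1
      exact Occurs.occ_pos (List.IsInfix.trans (List.prefix_append _ _).isInfix this)
    have hol := occ_le_size T (e :: p)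
    generalize hQ' : (fun v'' : VState => v''.get k = l₂.length ∧ _) = Q'
    unfold bestBody
    by_cases hlt : v'.get base < occ T (e :: p)
    · repeat' first
        | apply Runs.seq
        | (first
            | apply Runs.ld
            | apply Runs.add
            | apply Runs.sub
            | apply Runs.lt
            | apply Runs.ite
            | apply Runs.skip) <;> try simp [hk, h₅, hc, hcnt, e3, hhi, hlo, hocc, hlt]
      all_goals try omega
      subst hQ'
      refine ⟨by simp, by simpa using h₁, by simpa using h₂, by simpa using h₃,
        by simpa using h₄, by simpa using h₅, by simpa using h₆, by simp; omega, by simp,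
        by simp, ?_, by simp; omega, by simpa using h₁₂⟩
      intro c hc'
      rcases List.mem_append.1 hc' with hc' | hc'
      · simpa using (h₁₀ c hc').trans hlt.le
      · rw [List.mem_singleton.1 hc']; simp
    -- The maximum so far starts at `0` and `e :: p` occurs, so the first candidate is always taken.
    · have hl₁ : l₁ ≠ [] := by
        rintro rfl
        simp at h₉
        omega
      repeat' first
        | apply Runs.seq
        | (first
            | apply Runs.ld
            | apply Runs.add
            | apply Runs.sub
            | apply Runs.lt
            | apply Runs.ite
            | apply Runs.skip) <;> try simp [hk, h₅, hc, hcnt, e3, hhi, hlo, hocc, hlt]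
      all_goals try omega
      subst hQ'
      refine ⟨by simp, by simpa using h₁, by simpa using h₂, by simpa using h₃,
        by simpa using h₄, by simpa using h₅, by simpa using h₆, by simp; omega, ?_,
        by simpa [hl₁] using h₉, ?_, by simp; omega, by simpa using h₁₂⟩
      · left
        simpa [hl₁] using Or.inl (h₈.resolve_right (by simp [hl₁]))
      · intro c hc'
        rcases List.mem_append.1 hc' with hc' | hc'
        · simpa using h₁₀ c hc'
        · rw [List.mem_singleton.1 hc']; simpa using hlt
  · rintro v' ⟨h₁, h₂, h₃, h₄, h₅, h₆, h₇, h₈, h₉, h₁₀, h₁₁, h₁₂⟩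
    subst hQ
    refine ⟨h₂, h₃, h₄, h₅, h₆, by simp; omega, by simpa using h₈, fun c hc => ?_⟩
    have := h₁₀ c hc
    rwa [h₉, if_neg (List.ne_nil_of_mem hc)] at this
  · exact ⟨rfl, by simp, by simp, by simp, by simp, by simp, by simp, by simp, by simp, by simp,
      by simp, by simpa using harr⟩
  · simpa using hm

/-! ### The stack -/

open Var in
def copyBody : Cmd :=
  ld a row i ⨾ st dst i a ⨾ bin .add i i 1 ⨾ bin .sub y y 1

open Var in
theorem runs_copy {σ : ℕ} (A : Setup σ) {v : VState} {N : ℕ} (hN : N < A.F) (hy : v.get y = N)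
    (hi : v.get i = 1) (hrow : v.get row < A.R) (hdst : v.get dst < A.R)
    (hne : v.get row ≠ v.get dst) :
    Runs A.toMachine (.loop y.idx copyBody) v fun v' =>
      (∀ x ∉ [a, i, y], v'.get x = v.get x) ∧ (∀ i ≠ v.get dst, v'.M i = v.M i) ∧
      v'.M (v.get dst) 0 = v.M (v.get dst) 0 ∧
      (∀ j, 1 ≤ j → j ≤ N → v'.M (v.get dst) j = v.M (v.get row) j) ∧
      v'.out = v.out ∧ v'.time ≤ v.time + 1 + 20 * N := by
  have hFR := A.F_lt
  refine Runs.loop (N := N) (fun r v' => r ≤ N ∧ v'.get y = r ∧ v'.get i = N - r + 1 ∧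
    (∀ x ∉ [a, i, y], v'.get x = v.get x) ∧ (∀ i ≠ v.get dst, v'.M i = v.M i) ∧
    v'.M (v.get dst) 0 = v.M (v.get dst) 0 ∧
    (∀ j, 1 ≤ j → j ≤ N - r → v'.M (v.get dst) j = v.M (v.get row) j) ∧
    v'.out = v.out ∧ v'.time ≤ v.time + 20 * (N - r)) ?_ ?_ ?_
  · rintro r v' ⟨h₁, h₂, h₃, h₄, h₅, h₆, h₇, h₈, h₉⟩ h0
    have e₁ := h₄ row (by decide)
    have e₂ := h₄ dst (by decide)
    have e₃ := h₅ _ hne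
    generalize hQ : (fun v' : VState => ∃ N' < r, _) = Q
    unfold copyBody
    repeat' first
      | apply Runs.seq
      | (first
          | apply Runs.ld
          | apply Runs.st
          | apply Runs.add
          | apply Runs.sub) <;> try simp [h₂, h₃, e₁, e₂, e₃]
    all_goals try omega
    subst hQ
    refine ⟨r - 1, by omega, by omega, by simp, by simp; omega, ?_, ?_, ?_, ?_, by simpa using h₈,
      by simp; omega⟩
    · intro x hx
      simp only [List.mem_cons, List.not_mem_nil, or_false, not_or] at hx
      simp [hx, h₄]
    · intro i hi
      simp [hi, h₅]
    · simp [h₆]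
    · intro j hj hj'
      by_cases hjr : j = N - r + 1
      · simp [hjr]
      · simp [hjr, h₇ j hj (by omega)]
  · rintro r v' ⟨h₁, h₂, h₃, h₄, h₅, h₆, h₇, h₈, h₉⟩ h0
    obtain rfl : r = 0 := by omega
    exact ⟨h₄, h₅, h₆, h₇, h₈, by simp; omega⟩
  · exact ⟨le_rfl, hy, by omega, fun _ _ => rfl, fun _ _ => rfl, rfl, fun j _ _ => by omega, rfl,
      by simp⟩

open Var in
/-- Clear the list of the next touched character; if it describes a node, push it. -/
def pushBody : Cmd :=
  ld c 1 x ⨾ bin .add x x 1 ⨾ bin .sub k k 1 ⨾ bin .add row c 3 ⨾ ld cnt row 0 ⨾ st row 0 0 ⨾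
  bin .lt flag 1 cnt ⨾
  .ite flag.idx
    (bin .add dst fb sp ⨾ st dst 0 cnt ⨾ bin .add y cnt cnt ⨾ bin .add y y cnt ⨾
      bin .sub i i i ⨾ bin .add i i 1 ⨾ bin .add sp sp 1 ⨾ .loop y.idx copyBody)
    skip

open Var in
theorem runs_pushBody {σ : ℕ} (A : Setup σ) {v : VState} {e N r : ℕ}
    (hc : v.M 1 (v.get x) = e) (he : e ≤ σ) (hN : v.M (e + 3) 0 = N) (hNσ : N ≤ σ + 1)
    (hx : v.get x < σ + 1) (hk : v.get k = r + 1) (hr : r < A.F) (hfb : v.get fb = σ + 4)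
    (hsp : 1 < N → σ + 4 + v.get sp < A.R) :
    Runs A.toMachine pushBody (v.tick 1) fun v' =>
      v'.get k = r ∧ v'.get x = v.get x + 1 ∧ v'.get fb = v.get fb ∧
      v'.get sp = v.get sp + (if 1 < N then 1 else 0) ∧
      (∀ i, i ≠ e + 3 → i ≠ σ + 4 + v.get sp → v'.M i = v.M i) ∧
      v'.M (e + 3) 0 = 0 ∧ (∀ j, 1 ≤ j → v'.M (e + 3) j = v.M (e + 3) j) ∧
      (1 < N → v'.M (σ + 4 + v.get sp) 0 = N ∧
        ∀ j, 1 ≤ j → j ≤ 3 * N → v'.M (σ + 4 + v.get sp) j = v.M (e + 3) j) ∧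
      v'.out = v.out ∧ v'.time ≤ v.time + 70 + 60 * N := by
  have hF := A.F_eq
  have hR := A.R_ge
  have hFR := A.F_lt
  have hw := A.w_ne_zero
  have e3 : N + N + N = 3 * N := by omega
  generalize hQ : (fun v' : VState => v'.get k = r ∧ _) = Q
  unfold pushBody
  by_cases h1 : 1 < N
  · have hsp := hsp h1
    repeat' first
      | apply Runs.seq
      | (first
          | apply Runs.ld
          | apply Runs.st
          | apply Runs.add
          | apply Runs.sub
          | apply Runs.lt
          | apply Runs.ite
          | apply Runs.skip) <;> try simp [hc, hN, hk, hfb, h1, e3]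
    all_goals try omega
    refine (runs_copy A (N := 3 * N) (by omega) (by simp) (by simp) (by simp; omega)
      (by simp; omega) (by simp; omega)).mono ?_
    rintro v' ⟨g₁, g₂, g₃, g₄, g₅, g₆⟩
    subst hQ
    simp [show ¬ σ + 4 + v.get sp = e + 3 by omega, show ¬ e + 3 = σ + 4 + v.get sp by omega]
      at g₁ g₂ g₃ g₄ g₅ g₆
    refine ⟨?_, ?_, ?_, ?_, ?_, ?_, ?_, ?_, g₅, by omega⟩
    · rw [g₁ _ (by decide) (by decide) (by decide)]; simp
    · rw [g₁ _ (by decide) (by decide) (by decide)]; simp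
    · rw [g₁ _ (by decide) (by decide) (by decide)]; simp [hfb]
    · rw [g₁ _ (by decide) (by decide) (by decide)]; simp [h1]
    · intro i h h'
      rw [g₂ i h']
      simp [h, h']
    · rw [g₂ _ (by omega)]
      simp [show ¬ e + 3 = σ + 4 + v.get sp by omega]
    · intro j hj
      rw [g₂ _ (by omega)]
      simp [show ¬ e + 3 = σ + 4 + v.get sp by omega, show j ≠ 0 by omega]
    · intro _
      refine ⟨g₃, fun j h h' => ?_⟩
      rw [g₄ j h h']
      simp [show j ≠ 0 by omega]
  · repeat' first
      | apply Runs.seq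
      | (first
          | apply Runs.ld
          | apply Runs.st
          | apply Runs.add
          | apply Runs.sub
          | apply Runs.lt
          | apply Runs.ite
          | apply Runs.skip) <;> try simp [hc, hN, hk, h1]
    all_goals try omega
    subst hQ
    refine ⟨by simp, by simp, by simp [hfb], by simp [h1], ?_, by simp, ?_, fun h => absurd h h1,
      by simp, by simp; omega⟩
    · intro i h _
      simp [h]
    · intro j hj
      simp [show j ≠ 0 by omega]

/-- The rows from `σ + 4` on hold the lists of children of the nodes in `S`. -/
def StackRep (T : List ℕ) (σ : ℕ) (M : ℕ → ℕ → ℕ) (S : List (List ℕ)) : Prop :=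
  ∀ i q, S[i]? = some q →
    M (σ + 4 + i) 0 = (kids T σ q).length ∧ Seg (M (σ + 4 + i)) 1 (kids T σ q)

theorem StackRep.congr {T : List ℕ} {σ : ℕ} {M M' : ℕ → ℕ → ℕ} {S : List (List ℕ)}
    (h : StackRep T σ M S) (hM : ∀ i < S.length, M' (σ + 4 + i) = M (σ + 4 + i)) :
    StackRep T σ M' S := by
  intro i q hq
  rw [hM i (List.getElem?_eq_some_iff.1 hq).1]
  exact h i q hq

theorem StackRep.append {T : List ℕ} {σ : ℕ} {M : ℕ → ℕ → ℕ} {S : List (List ℕ)} {q : List ℕ}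
    (h : StackRep T σ M S) (h₁ : M (σ + 4 + S.length) 0 = (kids T σ q).length)
    (h₂ : Seg (M (σ + 4 + S.length)) 1 (kids T σ q)) : StackRep T σ M (S ++ [q]) := by
  intro i q' hq
  rcases lt_trichotomy i S.length with hi | rfl | hi
  · rw [List.getElem?_append_left hi] at hq
    exact h i q' hq
  · simp only [List.getElem?_append_right le_rfl, Nat.sub_self, List.getElem?_cons_zero,
      Option.some.injEq] at hq
    subst hq
    exact ⟨h₁, h₂⟩
  · have := (List.getElem?_eq_some_iff.1 hq).1
    simp only [List.length_append, List.length_singleton] at this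
    omega

/-- `P` is a list of the characters `c` in `l` for which `c :: p` is an internal node; if `b` is one
of them, it comes first. -/
structure IsPushList (T : List ℕ) (σ : ℕ) (p : List ℕ) (b : ℕ) (l P : List ℕ) : Prop where
  nodup : P.Nodup
  mem : ∀ c, c ∈ P ↔ c ∈ l ∧ 1 < (leftTable T σ p c).length
  head : b ∈ P → P.head? = some b

open Var in
/-- Push the left extensions that are internal nodes, the largest one first, and clear the table. -/
def pushAll : Cmd :=
  st 1 0 best ⨾ bin .sub x x x ⨾ bin .add k m 1 ⨾ .loop k.idx pushBody

open Var in
-- Cell `0` of row `1` gets `best`, so it is handled ahead of the touched characters; when it comes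
-- up again, its list has been cleared. If nothing was touched, `best` is `0`, whose list is empty.
-- `hcap` speaks of all candidate lists because room is needed at every single push.
theorem runs_pushAll {T : List ℕ} {σ : ℕ} (A : TextSetup T σ) {v : VState} {p l : List ℕ}
    {S : List (List ℕ)} (hmσ : v.get m ≤ σ) (hcount : ∀ c ≤ σ, v.M (c + 3) 0 = (leftTable T σ p c).length)
    (htseg : ∀ c ≤ σ, Seg (v.M (c + 3)) 1 (leftTable T σ p c))
    (hl : ∀ c, c ∈ l ↔ leftTable T σ p c ≠ []) (hm : v.get m = l.length)
    (harr : Arr (v.M 1) 1 l) (hbest : v.get best ∈ l ∨ l = [] ∧ v.get best = 0)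
    (hfb : v.get fb = σ + 4) (hS : StackRep T σ v.M S) (hsp : v.get sp = S.length)
    (hcap : ∀ P : List ℕ, P.Nodup → (∀ c ∈ P, 1 < (leftTable T σ p c).length) →
      (v.get best ∈ P → P.head? = some (v.get best)) →
      S.length + P.length ≤ σ * Nat.log 2 (size T)) :
    Runs A.toMachine pushAll v fun v' =>
      v'.get fb = σ + 4 ∧ (∀ c ≤ σ, v'.M (c + 3) 0 = 0) ∧ v'.M 0 = v.M 0 ∧ v'.out = v.out ∧
      v'.time ≤ v.time + 100 + 70 * l.length +
        60 * ((v.get best :: l).map fun c => (leftTable T σ p c).length).sum ∧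
      ∃ P, IsPushList T σ p (v.get best) (v.get best :: l) P ∧
        StackRep T σ v'.M (S ++ P.map (· :: p)) ∧ v'.get sp = S.length + P.length := by
  have hF := A.F_eq
  have hR := A.R_ge
  have hFR := A.F_lt
  have hw := A.w_ne_zero
  have hroom := A.room
  generalize hQ : (fun v' : VState => v'.get fb = σ + 4 ∧ _) = Q
  unfold pushAll
  repeat' first
    | apply Runs.seq
    | (first
        | apply Runs.st
        | apply Runs.add
        | apply Runs.sub) <;> try simp
  all_goals try omega
  refine Runs.forEach (L := v.get best :: l) (fun l₁ l₂ v' => v.get best :: l = l₁ ++ l₂ ∧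
    v'.get fb = σ + 4 ∧ v'.get x = l₁.length ∧
    v'.M 1 = Function.update (v.M 1) 0 (v.get best) ∧ Arr (v'.M 1) (v'.get x) l₂ ∧
    v'.M 0 = v.M 0 ∧ v'.out = v.out ∧
    v'.time ≤ v.time + 29 + 70 * l₁.length +
      60 * (l₁.map fun c => (leftTable T σ p c).length).sum ∧
    (∀ c ≤ σ, v'.M (c + 3) 0 = if c ∈ l₁ then 0 else (leftTable T σ p c).length) ∧
    (∀ c ≤ σ, Seg (v'.M (c + 3)) 1 (leftTable T σ p c)) ∧
    ∃ P, IsPushList T σ p (v.get best) l₁ P ∧ StackRep T σ v'.M (S ++ P.map (· :: p)) ∧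
      v'.get sp = S.length + P.length) ?_ ?_ ?_ ?_
  · rintro l₁ e l₂ v' ⟨h₁, h₂, h₃, h₄, ⟨h₅, h₅'⟩, h₆, h₇, h₈, h₉, h₁₀, P, hP, hSP, hspP⟩ hk
    have hlen := congrArg List.length h₁
    simp only [List.length_append, List.length_cons] at hlen
    have hmem : e ∈ v.get best :: l := by rw [h₁]; simp
    have heσ : e ≤ σ := by
      have key : ∀ c ∈ l, c ≤ σ := fun c hc => (leftTable_ne_nil ((hl c).1 hc)).2.1
      rcases List.mem_cons.1 hmem with rfl | h
      · rcases hbest with h | ⟨-, h⟩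
        · exact key _ h
        · omega
      · exact key _ h
    have htlen : (leftTable T σ p e).length ≤ σ + 1 := by
      unfold leftTable
      split_ifs
      · exact length_kids_le _ _ _
      · simp
    -- A count above `1` shows that `e` was not handled before. Since `best` is the first character
    -- handled, it can only be pushed onto an empty `P`.
    have hpush : ∀ hN : 1 < (if e ∈ l₁ then 0 else (leftTable T σ p e).length),
        e ∉ l₁ ∧ IsPushList T σ p (v.get best) (l₁ ++ [e]) (P ++ [e]) := by
      intro hN
      by_cases hel : e ∈ l₁
      · simp [hel] at hN
      · rw [if_neg hel] at hN
        refine ⟨hel, ?_, ?_, ?_⟩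
        · rw [List.nodup_append]
          refine ⟨hP.nodup, List.nodup_singleton e, ?_⟩
          rintro c hc f hf rfl
          rw [List.mem_singleton] at hf
          subst hf
          exact hel ((hP.mem c).1 hc).1
        · intro c
          rw [List.mem_append, List.mem_append, hP.mem, List.mem_singleton]
          constructor
          · rintro (h | rfl)
            · exact ⟨.inl h.1, h.2⟩
            · exact ⟨.inr rfl, hN⟩
          · rintro ⟨h | rfl, h'⟩
            · exact .inl ⟨h, h'⟩
            · exact .inr rfl
        · intro hb
          cases l₁ with
          | nil =>
            have hP0 : P = [] := List.eq_nil_iff_forall_not_mem.2 fun c hc => by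
              simpa using ((hP.mem c).1 hc).1
            have : v.get best = e := by simpa using (List.cons.inj h₁).1
            simp [hP0, this]
          | cons b l₁ =>
            have hbe : v.get best = b := (List.cons.inj h₁).1
            rcases List.mem_append.1 hb with hb | hb
            · have := hP.head hb
              rw [List.head?_append, this]
              rfl
            · rw [List.mem_singleton] at hb
              exact absurd (by rw [← hb, hbe]; simp) hel
    refine (runs_pushBody A.toSetup (v := v') (N := if e ∈ l₁ then 0 else
      (leftTable T σ p e).length) h₅ heσ (h₉ e heσ) (by split_ifs <;> omega) (by omega) hk
      (by omega) h₂ ?_).mono ?_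
    · intro hN
      obtain ⟨hel, hP'⟩ := hpush hN
      have := hcap (P ++ [e]) hP'.nodup (fun c hc => ((hP'.mem c).1 hc).2) hP'.head
      simp only [List.length_append, List.length_singleton] at this
      omega
    rintro v'' ⟨g₁, g₂, g₃, g₄, g₅, g₆, g₇, g₈, g₉, g₁₀⟩
    have hrow1 : v''.M 1 = v'.M 1 := g₅ 1 (by omega) (by omega)
    have hseg' : ∀ c ≤ σ, Seg (v''.M (c + 3)) 1 (leftTable T σ p c) := by
      intro c hc
      rcases eq_or_ne c e with rfl | hce
      · exact (h₁₀ c hc).congr fun j hj _ => g₇ j hj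
      · rw [g₅ _ (by omega) (by omega)]
        exact h₁₀ c hc
    refine ⟨g₁, by simpa using h₁, g₃.trans h₂, by simp [g₂, h₃], hrow1.trans h₄, ?_,
      (g₅ 0 (by omega) (by omega)).trans h₆, g₉.trans h₇, ?_, ?_, hseg', ?_⟩
    · rw [hrow1, g₂]; exact h₅'
    · simp only [List.length_append, List.length_singleton, List.map_append, List.sum_append,
        List.map_cons, List.map_nil, List.sum_cons, List.sum_nil]
      split_ifs at g₁₀ <;> omega
    · intro c hc
      rcases eq_or_ne c e with rfl | hce
      · simp [g₆]
      · rw [g₅ _ (by omega) (by omega), h₉ c hc]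
        simp [hce]
    · have hSlen : (S ++ P.map (· :: p)).length = v'.get sp := by simp [hspP]
      have hcongr : StackRep T σ v''.M (S ++ P.map (· :: p)) :=
        hSP.congr fun i hi => g₅ _ (by omega) (by omega)
      by_cases hN : 1 < (if e ∈ l₁ then 0 else (leftTable T σ p e).length)
      · obtain ⟨hel, hP'⟩ := hpush hN
        refine ⟨P ++ [e], hP', ?_, ?_⟩
        · obtain ⟨k₁, k₂⟩ := g₈ hN
          rw [if_neg hel] at hN k₁ k₂
          have hne : leftTable T σ p e ≠ [] := by rintro h; simp [h] at hN
          obtain ⟨-, -, htab, -⟩ := leftTable_ne_nil hne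
          rw [List.map_append, ← List.append_assoc]
          refine hcongr.append ?_ ?_
          · rw [hSlen, k₁, htab]
          · rw [hSlen, ← htab]
            exact (h₁₀ e heσ).congr fun j hj hj' => k₂ j hj (by omega)
        · rw [g₄, if_pos hN, hspP]
          simp [Nat.add_assoc]
      · refine ⟨P, ⟨hP.nodup, ?_, hP.head⟩, hcongr, by rw [g₄, if_neg hN, hspP]; rfl⟩
        intro c
        rw [hP.mem, List.mem_append, List.mem_singleton]
        constructor
        · rintro ⟨h, h'⟩; exact ⟨.inl h, h'⟩
        · rintro ⟨h | rfl, h'⟩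
          · exact ⟨h, h'⟩
          · by_contra hcon
            rw [if_neg (fun h => hcon ⟨h, h'⟩)] at hN
            exact hN h'
  · rintro v' ⟨h₁, h₂, h₃, h₄, h₅, h₆, h₇, h₈, h₉, h₁₀, P, hP, hSP, hspP⟩
    subst hQ
    refine ⟨h₂, fun c hc => ?_, h₆, h₇, ?_, P, hP, hSP, hspP⟩
    · rw [VState.M_tick, h₉ c hc]
      split_ifs with h
      · rfl
      · have : leftTable T σ p c = [] := by
          by_contra hne
          exact h (List.mem_cons_of_mem _ ((hl c).2 hne))
        simp [this]
    · simp only [List.length_cons] at h₈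
      simp only [VState.time_tick]
      omega
  · refine ⟨rfl, by simpa using hfb, by simp, by simp, ?_, by simp, by simp, by simp, by simpa using hcount,
      by simpa using htseg, [], ⟨by simp, by simp, by simp⟩, ?_, by simpa using hsp⟩
    · simp only [VState.M_tick, VState.M_set, VState.M_write, Function.update_self, VState.get_tick,
        VState.get_set]
      refine ⟨by simp, harr.congr fun j hj _ => by simp [show j ≠ 0 by omega]⟩
    · simpa using hS.congr fun i hi => by simp [show σ + 4 + i ≠ 1 by omega]
  · simp [hm]

/-! ### The height of the stack -/

/-- A stack that is the concatenation of `t` groups.  The number of occurrences of the nodes in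
each group is at most half of the bound for the group below, except perhaps for the first one. -/
inductive Good (T : List ℕ) (σ : ℕ) : ℕ → List (List ℕ) → Prop
  | nil : Good T σ 0 []
  | group {t : ℕ} {S g : List (List ℕ)} (h : Good T σ t S) (hne : g ≠ []) (hlen : g.length ≤ σ)
      (hall : ∀ q ∈ g, occ T q * 2 ^ t ≤ size T)
      (htail : ∀ q ∈ g.tail, occ T q * 2 ^ (t + 1) ≤ size T) : Good T σ (t + 1) (S ++ g)

/-- If `p` is alone in the top group, the group disappears and `p` keeps its weaker bound. Otherwise
`p` is in the tail of the group, which stays, and `p` has the bound that is better by a factor of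
two. -/
theorem Good.pop {T : List ℕ} {σ t : ℕ} {S : List (List ℕ)} {p : List ℕ}
    (h : Good T σ t (S ++ [p])) : ∃ t', Good T σ t' S ∧ occ T p * 2 ^ t' ≤ size T := by
  generalize hS : S ++ [p] = S' at h
  cases h with
  | nil => simp at hS
  | @group t S₀ g h hne hlen hall htail =>
    obtain ⟨g', q, rfl⟩ := (List.eq_nil_or_concat' g).resolve_left hne
    rw [← List.append_assoc] at hS
    obtain ⟨rfl, hq⟩ := List.append_inj' hS rfl
    obtain rfl : p = q := by simpa using hq
    cases g' with
    | nil => exact ⟨t, by simpa using h, hall p (by simp)⟩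
    | cons r g' =>
      refine ⟨t + 1, h.group (by simp) (by simp at hlen ⊢; omega)
        (fun q hq => hall q (List.mem_append_left _ hq)) (fun q hq => htail q ?_), htail p ?_⟩
      · simp only [List.cons_append, List.tail_cons] at hq ⊢
        exact List.mem_append_left _ hq
      · simp

theorem Good.length_le {T : List ℕ} {σ t : ℕ} {S : List (List ℕ)} (h : Good T σ t S) :
    S.length ≤ σ * t := by
  induction h with
  | nil => simp
  | group h hne hlen hall htail ih =>
    rw [List.length_append, mul_add, mul_one]
    omega

/-- With `t + 1` groups, a node of the top group occurs at least twice and at most `n / 2 ^ t`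
times, so `2 ^ (t + 1) ≤ n`. -/
theorem Good.length_le_log {T : List ℕ} {σ t : ℕ} {S : List (List ℕ)} (h : Good T σ t S)
    (hS : ∀ q ∈ S, IsInternal T q) : S.length ≤ σ * Nat.log 2 (size T) := by
  refine h.length_le.trans (Nat.mul_le_mul_left _ ?_)
  cases h with
  | nil => simp
  | @group t S₀ g h hne hlen hall htail =>
    obtain ⟨q, g', rfl⟩ := List.exists_cons_of_ne_nil hne
    have h₁ := (hS q (by simp)).two_le_occ
    have h₂ := hall q (by simp)
    refine Nat.le_log_of_pow_le (by omega) ?_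
    calc 2 ^ (t + 1) = 2 * 2 ^ t := by ring
      _ ≤ occ T q * 2 ^ t := Nat.mul_le_mul_right _ h₁
      _ ≤ size T := h₂

theorem isInternal_of_length_leftTable {T p : List ℕ} {σ c : ℕ} (hT : ∀ x ∈ T, x ≤ σ)
    (h : 1 < (leftTable T σ p c).length) : IsInternal T (c :: p) := by
  have hne : leftTable T σ p c ≠ [] := by rintro h'; simp [h'] at h
  rw [(leftTable_ne_nil hne).2.2.1] at h
  exact (isInternal_iff_length_kids hT).2 h

theorem occ_cons_le {T p : List ℕ} {c : ℕ} (hc : 1 ≤ c) : occ T (c :: p) ≤ occ T p :=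
  (Nat.le_add_right _ _).trans (occ_cons_add_le (c' := c + 1) hc (by omega) (by omega))

/-- Here `b` is the most frequent left extension; if it is not internal, it is not in `P`. In either
case a character in the tail of `P` differs from `b`, so its extension has at most half of the
occurrences of `p`. -/
theorem Good.push {T p : List ℕ} {σ t b : ℕ} {S : List (List ℕ)} {P : List ℕ}
    (h : Good T σ t S) (hp : occ T p * 2 ^ t ≤ size T)
    (hnd : P.Nodup) (hmem : ∀ c ∈ P, 1 < (leftTable T σ p c).length)
    (hhead : b ∈ P → P.head? = some b)
    (hb : ∀ c, leftTable T σ p c ≠ [] → 1 ≤ b ∧ occ T (c :: p) ≤ occ T (b :: p)) :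
    ∃ t', Good T σ t' (S ++ P.map (· :: p)) := by
  by_cases hP : P = []
  · exact ⟨t, by simpa [hP] using h⟩
  have hne : ∀ c ∈ P, leftTable T σ p c ≠ [] := fun c hc h' => by
    have := hmem c hc
    simp [h'] at this
  refine ⟨t + 1, h.group (by simpa using hP) ?_ ?_ ?_⟩
  · have : P.toFinset ⊆ Finset.Icc 1 σ := by
      intro c hc
      have := leftTable_ne_nil (hne c (List.mem_toFinset.1 hc))
      exact Finset.mem_Icc.2 ⟨this.1, this.2.1⟩
    simpa [List.toFinset_card_of_nodup hnd] using Finset.card_le_card this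
  · intro q hq
    obtain ⟨c, hc, rfl⟩ := List.mem_map.1 hq
    exact (Nat.mul_le_mul_right _ (occ_cons_le (leftTable_ne_nil (hne c hc)).1)).trans hp
  · intro q hq
    rw [← List.map_tail] at hq
    obtain ⟨c, hc, rfl⟩ := List.mem_map.1 hq
    have hcP := List.mem_of_mem_tail hc
    have hcb : c ≠ b := by
      rintro rfl
      obtain ⟨a, P', rfl⟩ := List.exists_cons_of_ne_nil hP
      have := hhead hcP
      simp only [List.head?_cons, Option.some.injEq] at this
      subst this
      exact (List.nodup_cons.1 hnd).1 hc
    obtain ⟨hb1, hle⟩ := hb c (hne c hcP)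
    have := occ_cons_add_le (T := T) (p := p) (leftTable_ne_nil (hne c hcP)).1 hb1 hcb
    calc occ T (c :: p) * 2 ^ (t + 1) = (2 * occ T (c :: p)) * 2 ^ t := by ring
      _ ≤ occ T p * 2 ^ t := Nat.mul_le_mul_right _ (by omega)
      _ ≤ size T := hp

/-! ### The main loop -/

open Var in
/-- Pop a node, output it, and push its left extensions. -/
def visitNode : Cmd :=
  bin .sub sp sp 1 ⨾ bin .add top fb sp ⨾ print ⨾ expand ⨾ findBest ⨾ pushAll

def nodeRecord (T : List ℕ) (σ : ℕ) (p : List ℕ) : NodeRecord := ⟨lo T p, hi T p, kids T σ p⟩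

theorem sum_leftTable_le {T p l : List ℕ} {σ : ℕ} (hnd : l.Nodup) :
    (l.map fun c => (leftTable T σ p c).length).sum ≤
      ∑ c ∈ Finset.Icc 1 σ, (kids T σ (c :: p)).length := by
  rw [← List.sum_toFinset _ hnd, ← Finset.sum_filter_ne_zero]
  refine (Finset.sum_le_sum_of_subset (t := Finset.Icc 1 σ) ?_).trans
    (Finset.sum_le_sum fun c hc => ?_)
  · intro c hc
    have := leftTable_ne_nil (T := T) (σ := σ) (p := p) (c := c) fun h =>
      (Finset.mem_filter.1 hc).2 (by simp [h])
    exact Finset.mem_Icc.2 ⟨this.1, this.2.1⟩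
  · rw [leftTable, if_pos (Finset.mem_Icc.1 hc)]

theorem length_le_sum_leftTable {T p l : List ℕ} {σ : ℕ} (h : ∀ c ∈ l, leftTable T σ p c ≠ []) :
    l.length ≤ (l.map fun c => (leftTable T σ p c).length).sum := by
  have := List.length_le_sum_of_one_le (l.map fun c => (leftTable T σ p c).length) (by
    intro i hi
    obtain ⟨c, hc, rfl⟩ := List.mem_map.1 hi
    exact List.length_pos_iff.2 (h c hc))
  simpa using this

/-- The configurations between two rounds of the main loop, with the nodes in `S` on the stack. -/
structure Between (T : List ℕ) (σ : ℕ) (S : List (List ℕ)) (v : VState) : Prop where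
  fb : v.get .fb = σ + 4
  sp : v.get .sp = S.length
  C : ∀ c ≤ σ, v.M 0 c = smaller T c
  zero : ∀ c ≤ σ, v.M (c + 3) 0 = 0
  stack : StackRep T σ v.M S

open Var in
theorem runs_visitNode {T : List ℕ} {σ : ℕ} (A : TextSetup T σ) {v : VState} {p : List ℕ}
    {S : List (List ℕ)} {t : ℕ} (hv : Between T σ (S ++ [p]) v) (hS : Good T σ t (S ++ [p]))
    (hint : ∀ q ∈ S ++ [p], IsInternal T q) :
    Runs A.toMachine visitNode (v.tick 1) fun v' =>
      v'.out = v.out ++ (nodeRecord T σ p).encode ∧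
      v'.time ≤ v.time + 900 * (A.te * weight T σ p) ∧
      ∃ (P : List ℕ) (t' : ℕ), P.Nodup ∧ (∀ c, c ∈ P ↔ IsInternal T (c :: p)) ∧
        Good T σ t' (S ++ P.map (· :: p)) ∧ Between T σ (S ++ P.map (· :: p)) v' := by
  have hF := A.F_eq
  have hR := A.R_ge
  have hFR := A.F_lt
  have hw := A.w_ne_zero
  have hroom := A.room
  have hp : IsInternal T p := hint p (by simp)
  have hp0 : 0 ∉ p := by
    obtain ⟨a, b, -, ha, -⟩ := hp
    exact Occurs.zero_not_mem A.one_le ha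
  have hpsuf : p ∉ suffixes T := not_mem_suffixes_of_zero_not_mem hp0
  have hlog := hS.length_le_log hint
  have hsp := hv.sp
  simp only [List.length_append, List.length_singleton] at hlog hsp
  have hfb := hv.fb
  obtain ⟨hcount, hseg⟩ := hv.stack S.length p (by simp)
  have hk2 := (isInternal_iff_length_kids A.le_sigma).1 hp
  have hkne : kids T σ p ≠ [] := by rintro h; simp [h] at hk2
  obtain ⟨hlo, hhi⟩ := seg_kids_bounds A.le_sigma hpsuf hkne hseg
  obtain ⟨t', hgood, hocc⟩ := hS.pop
  generalize hQ : (fun v' : VState => v'.out = v.out ++ _ ∧ _) = Q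
  unfold visitNode
  repeat' first
    | with_reducible apply Runs.seq
    | (first
        | apply Runs.add
        | apply Runs.sub) <;> try simp [hsp, hfb]
  all_goals try omega
  refine (runs_print A.toSetup (L := kids T σ p) (lb := lo T p) (ub := BWTEnum.hi T p)
    ?_ ?_ ?_ ?_ ?_ (length_kids_le T σ p)).mono ?_
  · simp; omega
  · simpa using hcount
  · simpa using hseg
  · simpa using hlo
  · simpa using hhi
  rintro v₁ ⟨a₁, a₂, a₃, a₄, a₅, a₆⟩
  simp at a₁ a₂ a₃ a₄ a₅ a₆
  apply Runs.seq
  refine (runs_expand A (p := p) (by rw [a₄]; exact hv.C) (by omega) (by omega)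
    (by rw [a₄]; exact hv.zero) (by rw [a₁, a₄]; exact hcount)
    (by rw [a₁, a₄]; exact hseg)).mono ?_
  rintro v₂ ⟨b₁, b₂, b₃, b₄, b₅, b₆, b₇⟩
  apply Runs.seq
  obtain ⟨l, hlnd, hl, hlm, hlarr⟩ := b₇.touched
  refine (runs_findBest A hp0 b₇ (fun c hc => (hl c).1 hc) hlm hlarr).mono ?_
  rintro v₃ ⟨c₁, c₂, c₃, c₄, c₅, c₆, c₇, c₈⟩
  have hbest : ∀ c, leftTable T σ p c ≠ [] →
      1 ≤ v₃.get best ∧ occ T (c :: p) ≤ occ T (v₃.get best :: p) := by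
    intro c hc
    have hcl := (hl c).2 hc
    refine ⟨?_, c₈ c hcl⟩
    rcases c₇ with h | ⟨h, -⟩
    · exact (leftTable_ne_nil ((hl _).1 h)).1
    · simp [h] at hcl
  have hpush : ∀ P : List ℕ, P.Nodup → (∀ c ∈ P, 1 < (leftTable T σ p c).length) →
      (v₃.get best ∈ P → P.head? = some (v₃.get best)) →
      ∃ t', Good T σ t' (S ++ P.map (· :: p)) := fun P h₁ h₂ h₃ =>
    hgood.push hocc h₁ h₂ h₃ hbest
  have hstack : StackRep T σ v₃.M S := by
    have h1 : StackRep T σ v.M S := fun i q hq => hv.stack i q (by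
      rw [List.getElem?_append_left (List.getElem?_eq_some_iff.1 hq).1, hq])
    refine h1.congr fun i hi => ?_
    rw [c₄, b₄ _ (.inr (by omega)), a₄]
  refine (runs_pushAll A (p := p) (l := l) (S := S) (by rw [c₃]; exact b₇.le)
    (by rw [c₄]; exact b₇.count) (by rw [c₄]; exact b₇.seg) hl (by rw [c₃]; exact hlm)
    (by rw [c₄]; exact hlarr) c₇ (by rw [c₁, b₂, a₂, hfb]) hstack (by rw [c₂, b₃, a₃]) ?_).mono ?_
  · intro P h₁ h₂ h₃
    obtain ⟨t'', hg⟩ := hpush P h₁ h₂ h₃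
    have hall : ∀ q ∈ S ++ P.map (· :: p), IsInternal T q := by
      intro q hq
      rcases List.mem_append.1 hq with hq | hq
      · exact hint q (List.mem_append_left _ hq)
      · obtain ⟨c, hc, rfl⟩ := List.mem_map.1 hq
        exact isInternal_of_length_leftTable A.le_sigma (h₂ c hc)
    simpa using hg.length_le_log hall
  rintro v₄ ⟨d₁, d₂, d₃, d₄, d₅, P, hP, d₆, d₇⟩
  subst hQ
  obtain ⟨t'', hg⟩ := hpush P hP.nodup (fun c hc => ((hP.mem c).1 hc).2) hP.head
  refine ⟨?_, ?_, P, t'', hP.nodup, ?_, hg, ⟨d₁, by simp [d₇], ?_, d₂, d₆⟩⟩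
  · rw [d₄, c₅, b₅, a₅]; rfl
  -- The costs are multiples of the parts of the weight plus constants, which the weight absorbs,
  -- being at least `2`. The factor `2` in `e₃` is there because `best` is handled twice.
  · have hte := A.one_le_te
    have e₁ := length_le_sum_leftTable fun c hc => (hl c).1 hc
    have e₂ := sum_leftTable_le (T := T) (p := p) (σ := σ) hlnd
    have e₃ : ((v₃.get best :: l).map fun c => (leftTable T σ p c).length).sum ≤
        2 * ∑ c ∈ Finset.Icc 1 σ, (kids T σ (c :: p)).length := by
      rw [List.map_cons, List.sum_cons]
      have : (leftTable T σ p (v₃.get best)).length ≤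
          ∑ c ∈ Finset.Icc 1 σ, (kids T σ (c :: p)).length := by
        have := sum_leftTable_le (T := T) (p := p) (σ := σ) (List.nodup_singleton (v₃.get best))
        simpa using this
      omega
    have e₄ : weight T σ p = (kids T σ p).length +
      ∑ c ∈ Finset.Icc 1 σ, (kids T σ (c :: p)).length := rfl
    have e₅ : weight T σ p ≤ A.te * weight T σ p := Nat.le_mul_of_pos_left _ hte
    rw [add_mul] at b₆
    omega
  · intro c
    rw [hP.mem]
    constructor
    · exact fun h => isInternal_of_length_leftTable A.le_sigma h.2
    · intro h
      have h2 := (isInternal_iff_length_kids A.le_sigma).1 h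
      have hc1 : 1 ≤ c := by
        obtain ⟨a, b, -, ha, -⟩ := h
        have := Occurs.zero_not_mem A.one_le ha
        simp only [List.mem_cons, not_or] at this
        omega
      have hcσ : c ≤ σ := h.occurs.le_sigma A.le_sigma (by simp)
      have h3 : 1 < (leftTable T σ p c).length := by
        rw [leftTable, if_pos ⟨hc1, hcσ⟩]; omega
      refine ⟨List.mem_cons_of_mem _ ((hl c).2 ?_), h3⟩
      rintro h'; simp [h'] at h3
  · intro c hc
    rw [d₃, c₄, b₄ 0 (.inl rfl), a₄]
    exact hv.C c hc

/-- The nodes that were output, `D`, and the nodes on the stack, `S`. -/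
structure Explored (T : List ℕ) (D S : List (List ℕ)) : Prop where
  nodup : (D ++ S).Nodup
  internal : ∀ q ∈ D ++ S, IsInternal T q
  root : IsInternal T [] → [] ∈ D ++ S
  closed : ∀ p ∈ D, ∀ c, IsInternal T (c :: p) → c :: p ∈ D ++ S
  parent : ∀ c p, c :: p ∈ D ++ S → p ∈ D

/-- No new node `c :: p` was met before: by `parent`, `p` would then have been output already, but
it was still on the stack. -/
theorem Explored.step {T p : List ℕ} {D S : List (List ℕ)} (h : Explored T D (S ++ [p]))
    {P : List ℕ} (hnd : P.Nodup) (hP : ∀ c, c ∈ P ↔ IsInternal T (c :: p)) :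
    Explored T (D ++ [p]) (S ++ P.map (· :: p)) := by
  have hmem : ∀ q, q ∈ D ++ [p] ++ (S ++ P.map (· :: p)) ↔
      q ∈ D ++ (S ++ [p]) ∨ q ∈ P.map (· :: p) := by
    intro q; simp only [List.mem_append]; tauto
  have hpD : p ∉ D := by
    intro hp
    exact (List.nodup_append.1 h.nodup).2.2 p hp p (by simp) rfl
  constructor
  · have hperm : (D ++ [p] ++ (S ++ P.map (· :: p))).Perm ((D ++ (S ++ [p])) ++ P.map (· :: p)) := by
      rw [← List.append_assoc, ← List.append_assoc D]
      refine List.Perm.append_right _ ?_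
      rw [List.append_assoc, List.append_assoc]
      exact List.Perm.append_left _ List.perm_append_comm
    rw [hperm.nodup_iff, List.nodup_append]
    refine ⟨h.nodup, hnd.map fun a b hab => (List.cons.inj hab).1, ?_⟩
    rintro q hq r hr rfl
    obtain ⟨c, hc, rfl⟩ := List.mem_map.1 hr
    exact hpD (h.parent c p hq)
  · intro q hq
    rcases (hmem q).1 hq with hq | hq
    · exact h.internal q hq
    · obtain ⟨c, hc, rfl⟩ := List.mem_map.1 hq
      exact (hP c).1 hc
  · exact fun hr => (hmem _).2 (.inl (h.root hr))
  · intro q hq c hc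
    rw [hmem]
    rcases List.mem_append.1 hq with hq | hq
    · exact .inl (h.closed q hq c hc)
    · rw [List.mem_singleton] at hq
      subst hq
      exact .inr (List.mem_map.2 ⟨c, (hP c).2 hc, rfl⟩)
  · intro c q hq
    rcases (hmem _).1 hq with hq | hq
    · exact List.mem_append_left _ (h.parent c q hq)
    · obtain ⟨c', hc, he⟩ := List.mem_map.1 hq
      obtain ⟨-, rfl⟩ := List.cons.inj he
      simp

/-- Induction on `p`, removing the first character: `of_cons` supplies the parent and `closed` leads
back. -/
theorem Explored.complete {T : List ℕ} {D : List (List ℕ)} (h : Explored T D []) (p : List ℕ) :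
    p ∈ D ↔ IsInternal T p := by
  have h' := h
  refine ⟨fun hp => h.internal p (by simpa using hp), fun hp => ?_⟩
  induction p with
  | nil => simpa using h.root hp
  | cons c p ih => simpa using h.closed p (ih hp.of_cons) c hp

theorem Explored.sum_weight_le {T : List ℕ} {σ : ℕ} (hT : ∀ x ∈ T, x ≤ σ) {D S : List (List ℕ)}
    (h : Explored T D S) :
    (D.map (weight T σ)).sum ≤ 5 * size T ∧ D.length ≤ (D.map (weight T σ)).sum := by
  have hD : ∀ q ∈ D, IsInternal T q := fun q hq => h.internal q (List.mem_append_left _ hq)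
  constructor
  · rw [← List.sum_toFinset _ (List.nodup_append.1 h.nodup).1]
    exact BWTEnum.sum_weight_le hT fun p hp => hD p (List.mem_toFinset.1 hp)
  · have := List.length_le_sum_of_one_le (D.map (weight T σ)) (by
      intro i hi
      obtain ⟨p, hp, rfl⟩ := List.mem_map.1 hi
      have := (isInternal_iff_length_kids hT).1 (hD p hp)
      unfold weight
      omega)
    simpa using this

open Var in
theorem runs_mainLoop {T : List ℕ} {σ : ℕ} (A : TextSetup T σ) {v : VState} {S : List (List ℕ)}
    {t : ℕ} (hv : Between T σ S v) (hS : Good T σ t S) (hexp : Explored T [] S)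
    (hout : v.out = []) :
    Runs A.toMachine (.loop sp.idx visitNode) v fun v' =>
      v'.time ≤ v.time + 1 + 4500 * (size T * A.te) ∧
      ∃ D, Explored T D [] ∧ v'.out = D.flatMap fun p => (nodeRecord T σ p).encode := by
  -- The variant is `5n` minus the number of nodes output. It stays nonnegative since each of these
  -- nodes has weight at least `1` and the weights add up to at most `5n`.
  refine Runs.loop (N := 5 * size T) (fun N v' => ∃ D S t, N + D.length = 5 * size T ∧
    Between T σ S v' ∧ Good T σ t S ∧ Explored T D S ∧
    v'.time ≤ v.time + 900 * (A.te * (D.map (weight T σ)).sum) ∧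
    v'.out = D.flatMap fun p => (nodeRecord T σ p).encode) ?_ ?_
    ⟨[], S, t, by simp, hv, hS, hexp, by simp, by simpa using hout⟩
  · rintro N v' ⟨D, S, t, hN, hb, hg, he, ht, ho⟩ h0
    have hne : S ≠ [] := by
      rintro rfl
      exact h0 hb.sp
    obtain ⟨S, p, rfl⟩ := (List.eq_nil_or_concat' S).resolve_left hne
    refine (runs_visitNode A hb hg fun q hq => he.internal q (List.mem_append_right _ hq)).mono ?_
    rintro v'' ⟨g₁, g₂, P, t', g₃, g₄, g₅, g₆⟩
    have he' := he.step g₃ g₄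
    have hle := he'.sum_weight_le A.le_sigma
    have hlen := hle.2.trans hle.1
    simp only [List.length_append, List.length_singleton] at hlen
    refine ⟨N - 1, by omega, D ++ [p], _, t', by simp; omega, g₆, g₅, he', ?_, ?_⟩
    · simp only [List.map_append, List.sum_append, List.map_cons, List.map_nil, List.sum_cons,
        List.sum_nil, mul_add, Nat.add_zero]
      omega
    · rw [g₁, ho]; simp
  · rintro N v' ⟨D, S, t, hN, hb, hg, he, ht, ho⟩ h0
    obtain rfl : S = [] := List.eq_nil_of_length_eq_zero (hb.sp.symm.trans h0)
    refine ⟨?_, D, he, ho⟩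
    have := Nat.mul_le_mul_left A.te (he.sum_weight_le A.le_sigma).1
    have e : A.te * (5 * size T) = 5 * (size T * A.te) := by ring
    simp only [VState.time_tick]
    omega

/-! ### Initialization -/

open Var in
-- In the answer for the interval `[1..n]` the rank of the rightmost `c` is the number of
-- occurrences of `c`; the other rank is always `1` and is skipped.
def countBody : Cmd :=
  ld c 2 y ⨾ bin .add y y 2 ⨾ ld b 2 y ⨾ bin .add y y 1 ⨾ st 0 c b ⨾ bin .sub rem rem 1

open Var in
theorem runs_countLoop {T : List ℕ} {σ : ℕ} (A : TextSetup T σ) {v : VState}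
    (hM : ∀ c, v.M 0 c = 0) (hseg : Seg (v.M 2) (v.get y) (A.report 1 (size T)))
    (hrem : v.get rem = (A.report 1 (size T)).length) (hy : v.get y = 0) :
    Runs A.toMachine (.loop rem.idx countBody) v fun v' =>
      (∀ x ∉ [c, y, b, rem], v'.get x = v.get x) ∧ (∀ i ≠ 0, v'.M i = v.M i) ∧
      (∀ c, v'.M 0 c = (bwt T).count c) ∧ v'.out = v.out ∧
      v'.time ≤ v.time + 40 * (A.report 1 (size T)).length + 1 := by
  have hF := A.F_eq
  have hR := A.R_ge
  have hFR := A.F_lt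
  have hw := A.w_ne_zero
  have hs : 1 ≤ size T := by simp [size]
  have hlen := A.isRangeReporter.length_le A.le_sigma le_rfl hs le_rfl
  have hσ : ∀ t ∈ A.report 1 (size T), t.1 ≤ σ := fun t ht =>
    A.isRangeReporter.le_sigma A.le_sigma le_rfl hs le_rfl ht
  have hnd := A.isRangeReporter.nodup (i := 1) le_rfl hs le_rfl
  have hroot : ∀ c a b, (c, a, b) ∈ A.report 1 (size T) ↔ _ := fun c a b =>
    A.isRangeReporter.mem_root
  generalize A.report 1 (size T) = L at *
  refine Runs.forEach (L := L) (fun l r v' => L = l ++ r ∧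
    v'.get y + 3 * r.length < A.F ∧ Seg (v'.M 2) (v'.get y) r ∧
    (∀ x ∉ [c, y, b, rem], v'.get x = v.get x) ∧ (∀ i ≠ 0, v'.M i = v.M i) ∧
    (∀ t ∈ l, v'.M 0 t.1 = t.2.2) ∧ (∀ c ∉ l.map Prod.fst, v'.M 0 c = 0) ∧
    v'.out = v.out ∧ v'.time ≤ v.time + 40 * l.length) ?_ ?_ ?_ hrem
  · rintro l t r v' ⟨rfl, h₁, ⟨s₁, s₂, s₃, s₄⟩, h₃, h₄, h₅, h₆, h₇, h₈⟩ hrem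
    have ht := hσ t (by simp)
    have hnot : ∀ u ∈ l, u.1 ≠ t.1 := by
      intro u hu he
      rw [List.map_append, List.nodup_append] at hnd
      exact hnd.2.2 _ (List.mem_map.2 ⟨u, hu, rfl⟩) _ (by simp) he
    simp only [List.length_cons] at h₁
    generalize hQ : (fun v'' : VState => v''.get rem = r.length ∧ _) = Q
    unfold countBody
    repeat' first
      | apply Runs.seq
      | (first
          | apply Runs.ld
          | apply Runs.st
          | apply Runs.add
          | apply Runs.sub) <;> try simp [s₁, s₃, hrem]
    all_goals try omega
    subst hQ
    refine ⟨by simp, by simp, by simp; omega, by simpa using s₄, ?_, ?_, ?_, ?_, by simpa using h₇,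
      by simp; omega⟩
    · intro x hx
      have hx' := hx
      simp only [List.mem_cons, List.not_mem_nil, or_false, not_or] at hx
      simp [hx, h₃ x hx']
    · intro i hi
      simp [hi, h₄ i hi]
    · intro u hu
      rcases List.mem_append.1 hu with hu | hu
      · simp [hnot u hu, h₅ u hu]
      · simp [List.mem_singleton.1 hu]
    · intro e he
      simp only [List.map_append, List.map_cons, List.map_nil, List.mem_append,
        List.mem_singleton, not_or] at he
      simp [he.2, h₆ e he.1]
  · rintro v' ⟨-, -, -, h₃, h₄, h₅, h₆, h₇, h₈⟩
    refine ⟨h₃, h₄, fun c => ?_, h₇, by simp; omega⟩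
    rcases Nat.eq_zero_or_pos ((bwt T).count c) with h0 | h0
    · refine (h₆ c fun hc => ?_).trans h0.symm
      obtain ⟨⟨c', a, b⟩, ht, rfl⟩ := List.mem_map.1 hc
      exact ((hroot _ _ _).1 ht).1.ne' h0
    · exact h₅ _ ((hroot c 1 ((bwt T).count c)).2 ⟨h0, rfl, rfl⟩)
  · exact ⟨rfl, by omega, hseg, fun _ _ => rfl, fun _ _ => rfl, by simp, fun c _ => hM c, rfl,
      by simp⟩

theorem smaller_le_size (T : List ℕ) (c : ℕ) : smaller T c ≤ size T :=
  List.countP_le_length.trans_eq (length_withEnd T)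

/-- The children of the root with labels less than `c`. -/
def rootKids (T : List ℕ) (c : ℕ) : List (ℕ × ℕ × ℕ) :=
  ((List.range c).filter fun d => Occurs T [d]).map fun d => (d, lo T [d], hi T [d])

theorem rootKids_succ (T : List ℕ) (c : ℕ) : rootKids T (c + 1) =
    rootKids T c ++ if (bwt T).count c = 0 then []
      else [(c, smaller T c + 1, smaller T c + (bwt T).count c)] := by
  have h := occurs_singleton_iff (T := T) (c := c)
  rw [rootKids, List.range_succ, List.filter_append, List.map_append, ← rootKids]
  congr 1
  split_ifs with h0
  · have : ¬ Occurs T [c] := by rw [h]; omega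
    simp [this]
  · have : Occurs T [c] := by rw [h]; omega
    simp [this, lo_singleton, hi_singleton, smaller_succ]

theorem length_rootKids_le (T : List ℕ) (c : ℕ) : (rootKids T c).length ≤ c := by
  rw [rootKids, List.length_map]
  exact (List.length_filter_le _ _).trans (by simp)

open Var in
-- Row `0` is turned in place from counts into sums over smaller characters. The same sums are the
-- bounds of the root's children, which are written to the bottom row of the stack.
def prefixBody : Cmd :=
  ld cnt 0 c ⨾ st 0 c base ⨾ bin .add d c 0 ⨾ bin .add c c 1 ⨾ bin .sub k k 1 ⨾
  .ite cnt.idx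
    (bin .add a base 1 ⨾ bin .add base base cnt ⨾ st fb y d ⨾ bin .add y y 1 ⨾ st fb y a ⨾
      bin .add y y 1 ⨾ st fb y base ⨾ bin .add y y 1 ⨾ bin .add m m 1)
    skip

open Var in
structure PrefixInv (T : List ℕ) (σ c₀ : ℕ) (v : VState) : Prop where
  c : v.get c = c₀
  base : v.get base = smaller T c₀
  fb : v.get fb = σ + 4
  m : v.get m = (rootKids T c₀).length
  y : v.get y = 3 * (rootKids T c₀).length + 1
  seg : Seg (v.M (σ + 4)) 1 (rootKids T c₀)
  old : ∀ e < c₀, v.M 0 e = smaller T e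
  new : ∀ e, c₀ ≤ e → v.M 0 e = (bwt T).count e

open Var in
theorem runs_prefixBody {T : List ℕ} {σ : ℕ} (A : TextSetup T σ) {v : VState} {c₀ : ℕ}
    (h : PrefixInv T σ c₀ v) (hc : c₀ ≤ σ) (hk : v.get k + c₀ = σ + 1) :
    Runs A.toMachine prefixBody (v.tick 1) fun v' =>
      v'.get k + (c₀ + 1) = σ + 1 ∧ PrefixInv T σ (c₀ + 1) v' ∧
      (∀ i, i ≠ 0 → i ≠ σ + 4 → v'.M i = v.M i) ∧ v'.out = v.out ∧ v'.time ≤ v.time + 100 := by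
  have hF := A.F_eq
  have hR := A.R_ge
  have hFR := A.F_lt
  have hw := A.w_ne_zero
  have hn := A.n_lt
  rw [A.n_eq] at hn
  have hlen := length_rootKids_le T c₀
  have h1 := smaller_le_size T (c₀ + 1)
  have h2 := smaller_succ T c₀
  have h3 := rootKids_succ T c₀
  obtain ⟨e₁, e₂, e₃, e₄, e₅, e₆, e₇, e₈⟩ := h
  have e₈' := e₈ c₀ le_rfl
  generalize hQ : (fun v' : VState => v'.get k + (c₀ + 1) = σ + 1 ∧ _) = Q
  unfold prefixBody
  by_cases h0 : (bwt T).count c₀ = 0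
  · rw [if_pos h0, List.append_nil] at h3
    repeat' first
      | apply Runs.seq
      | (first
          | apply Runs.ld
          | apply Runs.st
          | apply Runs.add
          | apply Runs.sub
          | apply Runs.skip
          | apply Runs.ite) <;> try simp [e₁, e₂, e₈', h0]
    all_goals try omega
    subst hQ
    refine ⟨by simp; omega, ⟨by simp, by simp; omega, by simpa using e₃, by simpa [h3] using e₄,
      by simpa [h3] using e₅, by simpa [h3] using e₆, ?_, ?_⟩, ?_, by simp, by simp⟩
    · intro e he
      rcases eq_or_ne e c₀ with rfl | hne
      · simp
      · simp [hne, e₇ e (by omega)]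
    · intro e he
      simp [show e ≠ c₀ by omega, e₈ e (by omega)]
    · intro i hi _
      simp [hi]
  · rw [if_neg h0] at h3
    repeat' first
      | apply Runs.seq
      | (first
          | apply Runs.ld
          | apply Runs.st
          | apply Runs.add
          | apply Runs.sub
          | apply Runs.ite) <;> try simp [e₁, e₂, e₃, e₄, e₅, e₈', h0]
    all_goals try omega
    subst hQ
    have hs : σ + 4 ≠ 0 := by omega
    refine ⟨by simp; omega, ⟨by simp, by simp; omega, by simpa using e₃, by simp [h3],
      by simp [h3]; omega, ?_, ?_, ?_⟩, ?_, by simp, by simp⟩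
    · rw [h3, seg_append]
      constructor
      · refine e₆.congr fun j hj₁ hj₂ => ?_
        simp [show j ≠ 3 * (rootKids T c₀).length + 1 by omega,
          show j ≠ 3 * (rootKids T c₀).length + 1 + 1 by omega,
          show j ≠ 3 * (rootKids T c₀).length + 1 + 1 + 1 by omega]
      · simp [Seg, Nat.add_comm 1]
    · intro e he
      rcases eq_or_ne e c₀ with rfl | hne
      · simp
      · simp [hne, e₇ e (by omega)]
    · intro e he
      simp [show e ≠ c₀ by omega, e₈ e (by omega)]
    · intro i hi hi'
      simp [hi, hi']

open Var in
theorem runs_prefixLoop {T : List ℕ} {σ : ℕ} (A : TextSetup T σ) {v : VState}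
    (h : PrefixInv T σ 0 v) (hk : v.get k = σ + 1) :
    Runs A.toMachine (.loop k.idx prefixBody) v fun v' => PrefixInv T σ (σ + 1) v' ∧
      (∀ i, i ≠ 0 → i ≠ σ + 4 → v'.M i = v.M i) ∧ v'.out = v.out ∧
      v'.time ≤ v.time + 100 * (σ + 1) + 1 := by
  refine Runs.loop (N := σ + 1) (fun N v' => ∃ c₀, v'.get k = N ∧ N + c₀ = σ + 1 ∧
    PrefixInv T σ c₀ v' ∧ (∀ i, i ≠ 0 → i ≠ σ + 4 → v'.M i = v.M i) ∧ v'.out = v.out ∧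
    v'.time ≤ v.time + 100 * c₀) ?_ ?_ ⟨0, hk, rfl, h, fun _ _ _ => rfl, rfl, by simp⟩
  · rintro N v' ⟨c₀, h₁, h₂, h₃, h₄, h₅, h₆⟩ h0
    refine (runs_prefixBody A h₃ (by omega) (by omega)).mono ?_
    rintro v'' ⟨g₁, g₂, g₃, g₄, g₅⟩
    exact ⟨v''.get k, by omega, c₀ + 1, rfl, g₁, g₂, fun i hi hi' => (g₃ i hi hi').trans (h₄ i hi hi'),
      g₄.trans h₅, by omega⟩
  · rintro N v' ⟨c₀, h₁, h₂, h₃, h₄, h₅, h₆⟩ h0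
    obtain rfl : c₀ = σ + 1 := by omega
    exact ⟨⟨h₃.c, h₃.base, h₃.fb, h₃.m, h₃.y, h₃.seg, h₃.old, h₃.new⟩, h₄, h₅, by simp; omega⟩

open Var in
/-- Compute the numbers of smaller characters, and push the root if it is an internal node. -/
def prepare : Cmd :=
  bin .add fb sigma 4 ⨾ bin .add i i 1 ⨾ bin .add j n 0 ⨾ ask i j rem ⨾
  .loop rem.idx countBody ⨾
  bin .sub y y y ⨾ bin .add y y 1 ⨾ bin .sub c c c ⨾ bin .add k sigma 1 ⨾
  .loop k.idx prefixBody ⨾ st fb 0 m ⨾ bin .lt sp 1 m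

def startState (n σ : ℕ) : VState where
  get x := if x = .n then n else if x = .sigma then σ else 0
  M _ _ := 0
  out := []
  time := 4

theorem good_root {T : List ℕ} {σ : ℕ} (hσ : 1 ≤ σ) : Good T σ 1 [[]] :=
  Good.nil.group (g := [[]]) (by simp) (by simpa using hσ) (by simpa using occ_le_size T [])
    (by simp)

theorem explored_root {T : List ℕ} (h : IsInternal T []) : Explored T [] [[]] where
  nodup := by simp
  internal := by simpa using h
  root _ := by simp
  closed := by simp
  parent := by simp

theorem explored_nil {T : List ℕ} (h : ¬ IsInternal T []) : Explored T [] [] where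
  nodup := by simp
  internal := by simp
  root h' := absurd h' h
  closed := by simp
  parent := by simp

open Var in
theorem runs_prepare {T : List ℕ} {σ : ℕ} (A : TextSetup T σ) :
    Runs A.toMachine prepare (startState (size T) σ) fun v' => v'.out = [] ∧
      v'.time ≤ 500 * (size T * A.te) ∧
      ∃ S t, Between T σ S v' ∧ Good T σ t S ∧ Explored T [] S := by
  have hF := A.F_eq
  have hR := A.R_ge
  have hFR := A.F_lt
  have hw := A.w_ne_zero
  have hn := A.n_lt
  rw [A.n_eq] at hn
  have hs : 1 ≤ size T := by simp [size]
  have hlen := A.isRangeReporter.length_le A.le_sigma le_rfl hs le_rfl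
  have hv : ∀ x, (startState (size T) σ).get x =
    if x = .n then size T else if x = .sigma then σ else 0 := fun _ => rfl
  have hM : (startState (size T) σ).M = fun _ _ => 0 := rfl
  have ho : (startState (size T) σ).out = [] := rfl
  have ht : (startState (size T) σ).time = 4 := rfl
  generalize startState (size T) σ = v at *
  generalize hQ : (fun v' : VState => v'.out = [] ∧ _) = Q
  unfold prepare
  repeat' first
    | with_reducible apply Runs.seq
    | (first
        | apply Runs.add
        | apply Runs.sub) <;> try simp [hv]
  all_goals try omega
  refine Runs.ask (L := A.report 1 (size T)) (by simp) (by simp) (by simp; omega)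
    (by simp [A.n_eq]) (by omega) (by omega) ?_
  apply Runs.seq
  refine (runs_countLoop A ?_ ?_ (by simp) (by simp [hv])).mono ?_
  · simp [hM]
  · simpa [hv] using seg_getD _ _
  rintro v₁ ⟨a₁, a₂, a₃, a₄, a₅⟩
  have b₁ := a₁ sigma (by decide)
  have b₂ := a₁ fb (by decide)
  have b₃ := a₁ base (by decide)
  have b₄ := a₁ m (by decide)
  simp [hv] at b₁ b₂ b₃ b₄
  simp [ht] at a₅
  repeat' first
    | with_reducible apply Runs.seq
    | (first
        | apply Runs.add
        | apply Runs.sub) <;> try simp [b₁]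
  all_goals try omega
  refine (runs_prefixLoop A ?_ (by simp)).mono ?_
  · exact ⟨by simp, by simp [b₃, smaller], by simp [b₂], by simp [b₄, rootKids],
      by simp [rootKids], trivial, by simp, by simpa using a₃⟩
  rintro v₂ ⟨c₁, c₂, c₃, c₄⟩
  simp at c₄
  have hfb := c₁.fb
  have hm : v₂.get m = (kids T σ []).length := c₁.m
  have hle := length_kids_le T σ []
  repeat' first
    | with_reducible apply Runs.seq
    | (first
        | apply Runs.st
        | apply Runs.lt) <;> try simp [hfb, hm]
  all_goals try omega
  subst hQ
  refine ⟨?_, ?_, ?_⟩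
  · simp [c₃, a₄, ho]
  · have hte := A.one_le_te
    have hσ := A.sigma_le
    have h1 : size T ≤ size T * A.te := Nat.le_mul_of_pos_right _ hte
    have h2 : A.te * (A.report 1 (size T)).length ≤ 2 * (size T * A.te) := by
      calc A.te * (A.report 1 (size T)).length ≤ A.te * (2 * size T) :=
            Nat.mul_le_mul_left _ (by omega)
        _ = 2 * (size T * A.te) := by ring
    simp
    omega
  · have hseg : Seg (v₂.M (σ + 4)) 1 (kids T σ []) := c₁.seg
    have hold : ∀ e ≤ σ, v₂.M 0 e = smaller T e := fun e he => c₁.old e (by omega)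
    have hzero : ∀ e ≤ σ, v₂.M (e + 3) 0 = 0 := by
      intro e he
      rw [c₂ _ (by omega) (by omega)]
      simp only [VState.M_tick, VState.M_set]
      rw [a₂ _ (by omega)]
      rcases eq_or_ne (e + 3) 2 with h | h
      · omega
      · simp [h, hM]
    have hne : ∀ e ≤ σ, e + 3 ≠ σ + 4 := fun e he => by omega
    have hint := isInternal_iff_length_kids A.le_sigma (p := [])
    by_cases h : IsInternal T []
    · have h2 := hint.1 h
      refine ⟨[[]], 1, ⟨by simpa using hfb, by simp; omega, ?_, ?_, ?_⟩, good_root (by omega),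
        explored_root h⟩
      · intro e he
        simp [hold e he]
      · intro e he
        simp [show e ≠ σ + 1 by omega, hzero e he]
      · refine StackRep.append (S := []) (by intro i q hq; simp at hq) (by simp) ?_
        refine hseg.congr fun j hj _ => ?_
        simp [show j ≠ 0 by omega]
    -- This is the empty text: there is no internal node, and the stack starts empty.
    · have h2 := mt hint.2 h
      refine ⟨[], 0, ⟨by simpa using hfb, by simp; omega, ?_, ?_, ?_⟩, .nil, explored_nil h⟩
      · intro e he
        simp [hold e he]
      · intro e he
        simp [show e ≠ σ + 1 by omega, hzero e he]
      · intro i q hq; simp at hq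

/-! ### Space -/

theorem succ_log_pow_three_le (L : ℕ) : (L + 1) ^ 3 ≤ 8 * 2 ^ L := by
  rcases Nat.lt_or_ge L 3 with h | h
  · interval_cases L <;> norm_num
  · induction L, h using Nat.le_induction with
    | base => norm_num
    | succ L h ih =>
      -- True from `L = 3` on, hence the separate check of the smaller values.
      have : (L + 1 + 1) ^ 3 ≤ 2 * (L + 1) ^ 3 := by
        obtain ⟨x, rfl⟩ := Nat.exists_eq_add_of_le h
        ring_nf
        nlinarith [sq_nonneg x]
      rw [pow_succ 2]
      omega

/-- The number of rows of the memory. -/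
def rows (n σ : ℕ) : ℕ := 4 + (σ + 1) * (Nat.log 2 n + 1)

theorem rows_mul_le (n σ : ℕ) :
    rows n σ * (3 * σ + 4) ≤ 20 * ((σ + 1) ^ 2 * (Nat.log 2 n + 1)) := by
  have h1 : rows n σ ≤ 5 * ((σ + 1) * (Nat.log 2 n + 1)) := by
    have : 1 * 1 ≤ (σ + 1) * (Nat.log 2 n + 1) := Nat.mul_le_mul (by omega) (by omega)
    unfold rows
    omega
  calc rows n σ * (3 * σ + 4) ≤ 5 * ((σ + 1) * (Nat.log 2 n + 1)) * (4 * (σ + 1)) :=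
        Nat.mul_le_mul h1 (by omega)
    _ = 20 * ((σ + 1) ^ 2 * (Nat.log 2 n + 1)) := by ring

/-- With `P = 2 ^ log n`, cubing avoids fractional exponents: `(σ + 1) ^ 3 ≤ 16 * P` and `(log n +
1) ^ 3 ≤ 8 * P` give `2048 * P ^ 3`, which is below `(13 * P) ^ 3`, and `20 * 13 ≤ 512`. -/
theorem memory_fits {n σ : ℕ} (hn : 1 ≤ n) (hσ : σ ^ 3 ≤ n) :
    rows n σ * (3 * σ + 4) ≤ 512 * 2 ^ Nat.log 2 n := by
  refine (rows_mul_le n σ).trans ?_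
  have hlog := succ_log_pow_three_le (Nat.log 2 n)
  have hlt : n < 2 ^ (Nat.log 2 n + 1) := Nat.lt_pow_succ_log_self (by omega) n
  rw [pow_succ] at hlt
  generalize Nat.log 2 n + 1 = l at *
  generalize 2 ^ Nat.log 2 n = P at *
  have hD : (σ + 1) ^ 3 ≤ 16 * P := by
    rcases Nat.eq_zero_or_pos σ with rfl | h
    · omega
    · have : (σ + 1) ^ 3 ≤ (2 * σ) ^ 3 := Nat.pow_le_pow_left (by omega) 3
      rw [mul_pow] at this
      omega
  suffices h : (σ + 1) ^ 2 * l ≤ 13 * P by omega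
  refine le_of_pow_le_pow_left₀ (n := 3) (by omega) (by omega) ?_
  calc ((σ + 1) ^ 2 * l) ^ 3 = (σ + 1) ^ 3 * (σ + 1) ^ 3 * l ^ 3 := by ring
    _ ≤ 16 * P * (16 * P) * (8 * P) := by gcongr
    _ = 2048 * P ^ 3 := by ring
    _ ≤ 2197 * P ^ 3 := Nat.mul_le_mul_right _ (by omega)
    _ = (13 * P) ^ 3 := by ring

/-- The integer part of the cube root of `n` stands in for `σ`, so that the bound depends only on
`n` and `C`, given the number `r` of registers. -/
noncomputable def spaceBound (r C n : ℕ) : ℕ :=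
  C * (Nat.log 2 n + 1) * (r + 20 * ((⌊(n : ℝ) ^ (1 / 3 : ℝ)⌋₊ + 1) ^ 2 * (Nat.log 2 n + 1)))

open Asymptotics Filter in
-- Each of the two logarithms is `O(n ^ (1/12))`. The number of cells is then `O(n ^ (2/3 + 1/12))`,
-- the number of bits `O(n ^ (5/6))`.
theorem spaceBound_isLittleO (r C : ℕ) :
    (fun n : ℕ => (spaceBound r C n : ℝ)) =o[atTop] (fun n : ℕ => (n : ℝ)) := by
  have one : ∀ {e : ℝ}, 0 ≤ e → (fun _ : ℕ => (1 : ℝ)) =O[atTop] fun n : ℕ => (n : ℝ) ^ e := by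
    intro e he
    refine IsBigO.of_bound 1 ?_
    filter_upwards [eventually_ge_atTop 1] with n hn
    have : (1 : ℝ) ≤ (n : ℝ) ^ e := Real.one_le_rpow (by exact_mod_cast hn) he
    rw [norm_one, one_mul, Real.norm_of_nonneg (by linarith)]
    exact this
  have hlog : (fun n : ℕ => (Nat.log 2 n : ℝ) + 1) =O[atTop] fun n : ℕ => (n : ℝ) ^ (1 / 12 : ℝ) := by
    refine IsBigO.add ?_ (one (by norm_num))
    have h1 : (fun n : ℕ => (Nat.log 2 n : ℝ)) =O[atTop] fun n : ℕ => Real.log n := by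
      refine IsBigO.of_bound (1 / Real.log 2) ?_
      filter_upwards [eventually_ge_atTop 1] with n hn
      have h := Real.natLog_le_logb n 2
      have h0 : 0 ≤ Real.log n := Real.log_nonneg (by exact_mod_cast hn)
      rw [Real.norm_of_nonneg (by positivity), Real.norm_of_nonneg h0]
      rw [Real.logb] at h
      calc (Nat.log 2 n : ℝ) ≤ Real.log n / Real.log (2 : ℕ) := h
        _ = 1 / Real.log 2 * Real.log n := by push_cast; ring
    exact h1.trans ((isLittleO_log_rpow_atTop (by norm_num)).comp_tendsto
      tendsto_natCast_atTop_atTop).isBigO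
  have hroot : (fun n : ℕ => (⌊(n : ℝ) ^ (1 / 3 : ℝ)⌋₊ : ℝ) + 1) =O[atTop]
      fun n : ℕ => (n : ℝ) ^ (1 / 3 : ℝ) := by
    refine IsBigO.add (IsBigO.of_bound 1 (Eventually.of_forall fun n => ?_)) (one (by norm_num))
    have : (0 : ℝ) ≤ (n : ℝ) ^ (1 / 3 : ℝ) := by positivity
    rw [one_mul, Real.norm_of_nonneg (by positivity), Real.norm_of_nonneg this]
    exact Nat.floor_le this
  have hcells : (fun n : ℕ => ((⌊(n : ℝ) ^ (1 / 3 : ℝ)⌋₊ : ℝ) + 1) ^ 2 * ((Nat.log 2 n : ℝ) + 1))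
      =O[atTop] fun n : ℕ => (n : ℝ) ^ (3 / 4 : ℝ) := by
    refine ((hroot.pow 2).mul hlog).congr_right fun n => ?_
    rw [← Real.rpow_natCast, ← Real.rpow_mul (by positivity),
      ← Real.rpow_add_of_nonneg (by positivity) (by norm_num) (by norm_num)]
    norm_num
  have hsum := ((one (e := 3 / 4) (by norm_num)).const_mul_left (r : ℝ)).add
    (hcells.const_mul_left 20)
  have := (hlog.const_mul_left (C : ℝ)).mul hsum
  have hbig : (fun n : ℕ => (spaceBound r C n : ℝ)) =O[atTop]
      fun n : ℕ => (n : ℝ) ^ (5 / 6 : ℝ) := by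
    refine (this.congr_left fun n => ?_).congr_right fun n => ?_
    · simp [spaceBound]
    · rw [← Real.rpow_add_of_nonneg (by positivity) (by norm_num) (by norm_num)]
      norm_num
  have hlit : (fun n : ℕ => (n : ℝ) ^ (5 / 6 : ℝ)) =o[atTop] fun n : ℕ => (n : ℝ) := by
    refine isLittleO_of_tendsto' ?_ ?_
    · filter_upwards [eventually_ge_atTop 1] with n hn h0
      exact absurd (Nat.cast_eq_zero.1 h0) (by omega)
    · refine ((tendsto_rpow_neg_atTop (y := 1 / 6) (by norm_num)).comp
        tendsto_natCast_atTop_atTop).congr' ?_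
      filter_upwards [eventually_ge_atTop 1] with n hn
      have h0 : (0 : ℝ) < n := by exact_mod_cast hn
      rw [Function.comp_apply, show (-(1 / 6) : ℝ) = 5 / 6 - 1 by norm_num, Real.rpow_sub h0,
        Real.rpow_one]
  exact hbig.trans_isLittleO hlit

theorem le_floor_root {n σ : ℕ} (hσ : σ ^ 3 ≤ n) : σ ≤ ⌊(n : ℝ) ^ (1 / 3 : ℝ)⌋₊ := by
  refine Nat.le_floor ?_
  have h : ((σ : ℝ) ^ 3) ^ (1 / 3 : ℝ) ≤ (n : ℝ) ^ (1 / 3 : ℝ) :=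
    Real.rpow_le_rpow (by positivity) (by exact_mod_cast hσ) (by norm_num)
  rwa [← Real.rpow_natCast, ← Real.rpow_mul (by positivity),
    show ((3 : ℕ) : ℝ) * (1 / 3) = 1 by norm_num, Real.rpow_one] at h

theorem spaceBits_le {n σ w C : ℕ} {p : Cmd} {s : State} (hσ : σ ^ 3 ≤ n)
    (hw : w ≤ C * (Nat.log 2 n + 1)) (hs : s.cells ≤ rows n σ * (3 * σ + 4)) :
    spaceBits w p s ≤ spaceBound p.numRegs C n := by
  have h1 := le_floor_root hσ
  refine Nat.mul_le_mul hw (Nat.add_le_add_left (hs.trans ((rows_mul_le n σ).trans ?_)) _)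
  gcongr

/-! ### The program -/

/-- Compute the number of cells in each row, then enumerate. -/
def enumerate : Cmd :=
  (.const 101 3 ⨾ .op .mul 100 1 101 ⨾ .const 101 4 ⨾ .op .add 100 100 101) ⨾
    prepare ⨾ .loop Var.sp.idx visitNode

theorem exec_rowWidth {A : Machine} {n σ : ℕ} (hF : A.F = 3 * σ + 4) (hR : 2 ≤ A.R) :
    ∃ s, Exec A.toEnv (.const 101 3 ⨾ .op .mul 100 1 101 ⨾ .const 101 4 ⨾ .op .add 100 100 101)
      (initState n σ) s ∧ Rel A s (startState n σ) := by
  have hc := A.consts_fit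
  have hm := A.mem_fit
  have hF' : 2 * A.F ≤ A.R * A.F := Nat.mul_le_mul_right _ hR
  refine ⟨_, .seq _ _ _ _ _ (.const _ _ _) (.seq _ _ _ _ _ (.op _ _ _ _ _)
    (.seq _ _ _ _ _ (.const _ _ _) (.op _ _ _ _ _))), ⟨?_, ?_, ?_, rfl, le_rfl, Nat.zero_le _⟩⟩
  · intro x
    have := x.idx_lt
    have e0 : x.idx = 0 ↔ x = .n := by rw [← Var.idx_inj]; rfl
    have e1 : x.idx = 1 ↔ x = .sigma := by rw [← Var.idx_inj]; rfl
    simp [State.setReg, State.tick, initState, startState, e0, e1,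
      show x.idx ≠ 100 by omega, show x.idx ≠ 101 by omega]
  · simp only [State.setReg, State.tick, initState, BinOp.eval, Function.update_apply]
    norm_num
    rw [hF]
    exact (Nat.mod_eq_of_lt (a := σ * 3 + 4) (by omega)).trans (by omega)
  · intro i _ j _
    rfl

/-- The parameters of the run for a text. -/
def textSetup {T : List ℕ} {σ : ℕ} (hT : ∀ x ∈ T, 1 ≤ x ∧ x ≤ σ) (hσ : σ ^ 3 ≤ size T)
    {report : ℕ → ℕ → List (ℕ × ℕ × ℕ)} (hrep : IsRangeReporter (bwt T) report)
    {te : ℕ} (hte : 1 ≤ te) {w : ℕ} (hw : Nat.log 2 (size T) + 1 + 8 ≤ w) : TextSetup T σ :=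
  have hpow : 512 * 2 ^ Nat.log 2 (size T) ≤ 2 ^ w := by
    calc 512 * 2 ^ Nat.log 2 (size T) = 2 ^ (Nat.log 2 (size T) + 1 + 8) := by ring
      _ ≤ 2 ^ w := Nat.pow_le_pow_right (by omega) hw
  have hpos : 1 ≤ 2 ^ Nat.log 2 (size T) := Nat.one_le_two_pow
  have hn : 1 ≤ size T := Nat.succ_pos _
  { w, te, report
    n := size T
    F := 3 * σ + 4
    R := rows (size T) σ
    C := smaller T
    consts_fit := by omega
    mem_fit := (memory_fits hn hσ).trans hpow
    F_eq := rfl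
    R_ge := by
      have : (σ + 1) * 1 ≤ (σ + 1) * (Nat.log 2 (size T) + 1) := Nat.mul_le_mul_left _ (by omega)
      unfold rows
      omega
    n_lt := by
      have : size T < 2 ^ (Nat.log 2 (size T) + 1) := Nat.lt_pow_succ_log_self (by omega) _
      rw [pow_succ] at this
      omega
    C_eq := rfl
    n_eq := rfl
    one_le := fun x hx => (hT x hx).1
    le_sigma := fun x hx => (hT x hx).2
    isRangeReporter := hrep
    one_le_te := hte
    room := by
      unfold rows
      rw [Nat.add_mul, Nat.mul_add]
      omega
    sigma_le := (Nat.le_self_pow (by omega) σ).trans hσ }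

theorem isEnumeration {T : List ℕ} {σ : ℕ} (hT : ∀ x ∈ T, x ≤ σ) {D : List (List ℕ)}
    (hD : Explored T D []) :
    IsEnumeration T (D.flatMap fun p => (nodeRecord T σ p).encode) := by
  refine ⟨D.map fun p => (p, nodeRecord T σ p), ?_, ?_, ?_, ?_⟩
  · simpa [Function.comp_def] using hD.nodup
  · simpa [Function.comp_def] using hD.complete
  · intro x hx
    obtain ⟨p, hp, rfl⟩ := List.mem_map.1 hx
    have h := (hD.complete p).1 hp
    exact ⟨isInterval_lo_hi h.occurs, kids_sorted T σ p, fun c i j => (isChildEntry_iff hT).symm⟩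
  · rw [List.flatMap_map]

theorem runs_enumerate {T : List ℕ} {σ : ℕ} (A : TextSetup T σ) :
    Runs A.toMachine (prepare ⨾ .loop Var.sp.idx visitNode) (startState (size T) σ) fun v' =>
      v'.time ≤ 5001 * (size T * A.te) ∧ IsEnumeration T v'.out := by
  apply Runs.seq
  refine (runs_prepare A).mono ?_
  rintro v ⟨ho, ht, S, t, hb, hg, he⟩
  refine (runs_mainLoop A hb hg he ho).mono ?_
  rintro v' ⟨ht', D, hD, ho'⟩
  have : 1 ≤ size T * A.te := Nat.mul_pos (Nat.succ_pos _) A.one_le_te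
  exact ⟨by omega, ho' ▸ isEnumeration A.le_sigma hD⟩

end BWTEnum

theorem mainTheorem5 :
    ∃ (prog : BWTEnum.Cmd) (c₀ K : ℕ), ∀ C : ℕ, ∃ space : ℕ → ℕ,
      (fun n : ℕ => (space n : ℝ)) =o[Filter.atTop] (fun n : ℕ => (n : ℝ)) ∧
      ∀ (σ : ℕ) (T : List ℕ),
        (∀ x ∈ T, 1 ≤ x ∧ x ≤ σ) →
        σ ^ 3 ≤ BWTEnum.size T →
        ∀ report : ℕ → ℕ → List (ℕ × ℕ × ℕ),
          BWTEnum.IsRangeReporter (BWTEnum.bwt T) report →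
          ∀ te : ℕ, 1 ≤ te →
          ∀ w : ℕ,
            Nat.log 2 (BWTEnum.size T) + 1 + c₀ ≤ w →
            w ≤ C * (Nat.log 2 (BWTEnum.size T) + 1) →
            ∃ s : BWTEnum.State,
              BWTEnum.Exec ⟨w, BWTEnum.size T, report, te⟩ prog
                (BWTEnum.initState (BWTEnum.size T) σ) s ∧
              BWTEnum.IsEnumeration T s.out ∧
              s.time ≤ K * (BWTEnum.size T * te) ∧
              BWTEnum.spaceBits w prog s ≤ space (BWTEnum.size T) := by
  -- With `8` extra bits the address space has at least `512 * 2 ^ log n` cells, as `memory_fits`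
  -- requires. The factor `5001` is `500` for the preparation, `4500 = 900 * 5` for the visits and
  -- `1` for the last test of the loop.
  refine ⟨BWTEnum.enumerate, 8, 5001, fun C => ⟨BWTEnum.spaceBound BWTEnum.enumerate.numRegs C,
    BWTEnum.spaceBound_isLittleO _ C, ?_⟩⟩
  intro σ T hT hσ report hrep te hte w hw hwC
  let A := BWTEnum.textSetup hT hσ hrep hte hw
  have hR := A.R_ge
  obtain ⟨s₀, e₀, r₀⟩ := BWTEnum.exec_rowWidth (A := A.toMachine) (n := BWTEnum.size T)
    A.F_eq (by omega)
  obtain ⟨s, v, e, r, ht, ho⟩ := BWTEnum.runs_enumerate A s₀ r₀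
  exact ⟨s, .seq _ _ _ _ _ e₀ e, r.out ▸ ho, r.time.trans ht, BWTEnum.spaceBits_le hσ hwC r.cells⟩
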